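/- Let $n\ge 1$, let $\mu$ be a nonzero finite Borel measure on the unit sphere $\mathbb S^{n-1}\subset\mathbb R^n$, let $s\in(0,1)$, and let $L\subset\mathbb R^n$ be an origin-symmetric convex body, where a convex body is a compact convex set with nonempty interior. For a convex body $K$ write $h_K(v)=\max_{x\in K}v\cdot x$ for its support function, $$P_s(K,L)=\int_K\int_{\mathbb R^n\setminus K}\frac{1}{\|x-y\|_L^{n+s}}\,dy\,dx ,$$ where $\|\cdot\|_L$ is the norm with closed unit ball $L$, and, for Borel sets $\eta\subset\mathbb S^{n-1}$, $$\mathcal A_s(K,L,\eta)=\frac ns\int_{\nu_K^{-1}(\eta)}\tilde V_{n+s}(K,L,z)\,d\mathcal H^{n-1}(z),\qquad \tilde V_{n+s}(K,L,z)=\frac1n\int_{\{u\in\mathbb S^{n-1}:\ \rho_{K,z}(u)>0\}}\rho_{K,z}(u)^{-s}\rho_{L,o}(u)^{n+s}\,du .$$ Here $o$ is the origin, $\rho_{K,z}(u)=\max\{t\ge 0: z+tu\in K\}$ for $z\in K$ (and likewise for $L$), $du$ is spherical Lebesgue measure, $\mathcal H^{n-1}$ is $(n-1)$-dimensional Hausdorff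 measure, and $\nu_K^{-1}(\eta)$ is the set of $z\in\partial K$ for which there is $v\in\eta$ with $v\cdot z=h_K(v)$. Suppose $K_0\subset\mathbb R^n$ is a convex body with $P_s(K_0,L)=1$ and $$\int_{\mathbb S^{n-1}}h_{K_0}\,d\mu=\inf\Big\{\int_{\mathbb S^{n-1}}h_K\,d\mu:\ K\subset\mathbb R^n\text{ a convex body},\ P_s(K,L)=1\Big\}.$$ Then there is a constant $c>0$ such that $\mu=\mathcal A_s(cK_0,L,\cdot)$ on the Borel subsets of $\mathbb S^{n-1}$. -/

import Mathlib

open MeasureTheory Set Metric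
open scoped ENNReal Pointwise

noncomputable section

namespace FractionalArea

/-- Euclidean space of dimension `n`. -/
abbrev Eucl (n : ℕ) : Type := EuclideanSpace ℝ (Fin n)

/-- The unit sphere of `n`-dimensional Euclidean space. -/
abbrev Sph (n : ℕ) : Type := sphere (0 : Eucl n) 1

/-- A convex body: a compact convex set with nonempty interior. -/
def IsConvexBody {n : ℕ} (K : Set (Eucl n)) : Prop :=
  Convex ℝ K ∧ IsCompact K ∧ (interior K).Nonempty

/-- An origin-symmetric convex body. -/
def IsSymmConvexBody {n : ℕ} (L : Set (Eucl n)) : Prop :=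
  IsConvexBody L ∧ ∀ x ∈ L, -x ∈ L

/-- The support function `h_K(v) = max {v · x : x ∈ K}`. -/
def supp {n : ℕ} (K : Set (Eucl n)) (v : Sph n) : ℝ :=
  sSup ((fun x : Eucl n => inner ℝ (v : Eucl n) x) '' K)

/-- The radial function `ρ_{K,z}(u) = max {t ≥ 0 : z + t u ∈ K}` of `K` with respect to `z ∈ K`. -/
def radial {n : ℕ} (K : Set (Eucl n)) (z : Eucl n) (u : Sph n) : ℝ :=
  sSup {t : ℝ | 0 ≤ t ∧ z + t • (u : Eucl n) ∈ K}

/-- The inverse Gauss image `ν_K⁻¹(η)`: the boundary points of `K` that have a unit outer normal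
in `η`. -/
def invGauss {n : ℕ} (K : Set (Eucl n)) (η : Set (Sph n)) : Set (Eucl n) :=
  {z | z ∈ frontier K ∧ ∃ v ∈ η, inner ℝ (v : Eucl n) z = supp K v}

/-- The dual mixed volume `Ṽ_p(K, L, z) = (1/n) ∫ ρ_{K,z}(u)^(n-p) ρ_L(u)^p du`, the integral being
over the directions with `ρ_{K,z}(u) > 0`, with respect to spherical Lebesgue measure. -/
def dualMixedVolume {n : ℕ} (p : ℝ) (K L : Set (Eucl n)) (z : Eucl n) : ℝ≥0∞ :=
  (n : ℝ≥0∞)⁻¹ * ∫⁻ u in {u : Sph n | 0 < radial K z u},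
    ENNReal.ofReal (radial K z u ^ ((n : ℝ) - p) * radial L 0 u ^ p)
      ∂((volume : Measure (Eucl n)).toSphere)

/-- The anisotropic `s`-fractional area measure
`A_s(K, L, η) = (n/s) ∫_{ν_K⁻¹(η)} Ṽ_{n+s}(K, L, z) dH^{n-1}(z)`, for Borel sets `η`. Here `μHE` is
the Hausdorff measure normalized so that it agrees with Lebesgue measure. -/
def fracArea {n : ℕ} (s : ℝ) (K L : Set (Eucl n)) (η : Set (Sph n)) : ℝ≥0∞ :=
  ENNReal.ofReal ((n : ℝ) / s) *
    ∫⁻ z in invGauss K η, dualMixedVolume ((n : ℝ) + s) K L z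
      ∂(Measure.euclideanHausdorffMeasure (n - 1) : Measure (Eucl n))

/-- The anisotropic fractional `s`-perimeter
`P_s(E, L) = ∫_E ∫_{Eᶜ} ‖x - y‖_L^{-(n+s)} dx dy`; the norm with closed unit ball `L` is the gauge
of `L`. -/
def fracPerimeter {n : ℕ} (s : ℝ) (E L : Set (Eucl n)) : ℝ≥0∞ :=
  ∫⁻ x in E, ∫⁻ y in Eᶜ, ENNReal.ofReal (1 / gauge L (x - y) ^ ((n : ℝ) + s))

end FractionalArea

end

noncomputable section

namespace FractionalArea

open Filter Topology

/-! ### Gauges of convex bodies with the origin inside. -/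

section Gauge

variable {n : ℕ} {K : Set (Eucl n)}

/-! The proof is a variational argument using one-sided perturbations only: the first variation
gives an inequality between two measures, and testing it against `h_K` forces equality.

Perimeter. In polar coordinates about `x`, the kernel integrates over the complement to
`ρ_{K,x}(u)^(-s) / s` in each direction. Moving `x` along a chord of length `ℓ` then gives `ℓ^(1-s)
/ (s (1-s))`. Hence `fracPerimeter_eq`: `P_s = Q / (s (1-s))`, where the chord energy `Q` integrates
`ℓ^(-s)` over points of `K` and directions weighted by `ρ_L^(n+s)`. It is finite, translation
invariant and homogeneous of degree `n - s`.

Area. Let `D(z)` be the integral of `ℓ^(-s)` over all directions at a boundary point `z`, and let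
`A` be the image under the Gauss map of surface area times `D`. Opposite directions see the same
chord, so `A_s = A / (2s)` (`fracArea_eq`). This requires surface area in polar coordinates
(`lintegral_frontier`). It is obtained by cutting the boundary into pieces with almost constant
normal, flattening each to a hyperplane, and comparing volumes of cones.

First inequality. By translation invariance `μ` is centred, so the origin may be placed inside `K`.
For continuous `f ≥ 0` let `K_t ⊇ K` be the Wulff shape of `h_K + t f`. Concavity of `ℓ^(1-s)` on
every line bounds `Q(K_t) - Q(K)` below by `1 - s` times the integral over `K_t \ K` of the weights
of `K_t`. Fatou's lemma turns this into the rate `(1-s) ∫ f dA` (`exists_chordEnergy_wulff_ge`). On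
the other hand, minimality and scaling give `P_s(K_t) ≤ (1 + t F / M)^(n-s)` with `F = ∫ f dμ` and
`M = ∫ h_K dμ`. Comparing slopes at `0` gives `l A ≤ μ` with `l = M / (s (n-s))`
(`lintegral_areaMeasure_le`).

Equality. Comparing `K` with `r K` as `r → 1`, again by concavity on lines, gives `(n-s) Q(K) ≤
(1-s) ∫ h_K dA` (`chordEnergy_le_boundary`). Since `Q(K) = s (1-s)`, the integral of `h_K` against
`l A` is at least `M`, its integral against `μ`. As `h_K > 0` and `l A ≤ μ`, the two measures
coincide (`eq_smul_areaMeasure`). The fractional area measure is homogeneous of degree `n - 1 - s ≠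
0`, so a dilation absorbs the remaining constant. -/

lemma mem_iff_gauge_le_one (hK : IsConvexBody K) (h0 : K ∈ 𝓝 0) {x : Eucl n} :
    x ∈ K ↔ gauge K x ≤ 1 := by
  rw [gauge_le_one_iff_mem_closure hK.1 h0, hK.2.1.isClosed.closure_eq]

lemma mem_frontier_iff_gauge (hK : IsConvexBody K) (h0 : K ∈ 𝓝 0) {x : Eucl n} :
    x ∈ frontier K ↔ gauge K x = 1 :=
  (gauge_eq_one_iff_mem_frontier hK.1 h0).symm

lemma mem_interior_iff_gauge (hK : IsConvexBody K) (h0 : K ∈ 𝓝 0) {x : Eucl n} :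
    x ∈ interior K ↔ gauge K x < 1 :=
  (gauge_lt_one_iff_mem_interior hK.1 h0).symm

lemma gauge_pos_of_ne (hK : IsConvexBody K) (h0 : K ∈ 𝓝 0) {x : Eucl n} (hx : x ≠ 0) :
    0 < gauge K x :=
  (gauge_pos (absorbent_nhds_zero h0) (NormedSpace.isVonNBounded_of_isBounded ℝ hK.2.1.isBounded)).2
    hx

lemma gauge_smul_pos (r : ℝ) (hr : 0 ≤ r) (x : Eucl n) : gauge K (r • x) = r * gauge K x := by
  rw [gauge_smul_of_nonneg hr, smul_eq_mul]

lemma exists_closedBall_subset (h0 : K ∈ 𝓝 0) : ∃ r > 0, closedBall (0 : Eucl n) r ⊆ K :=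
  Metric.nhds_basis_closedBall.mem_iff.1 h0

lemma exists_norm_le (hK : IsConvexBody K) : ∃ R > 0, ∀ x ∈ K, ‖x‖ ≤ R := by
  obtain ⟨R, hR⟩ := hK.2.1.isBounded.exists_norm_le
  exact ⟨max R 1, by positivity, fun x hx => (hR x hx).trans (le_max_left _ _)⟩

lemma inv_gauge_smul_mem_frontier (hK : IsConvexBody K) (h0 : K ∈ 𝓝 0) {x : Eucl n} (hx : x ≠ 0) :
    (gauge K x)⁻¹ • x ∈ frontier K := by
  have := gauge_pos_of_ne hK h0 hx
  rw [mem_frontier_iff_gauge hK h0, gauge_smul_pos _ (by positivity)]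
  exact inv_mul_cancel₀ this.ne'

lemma frontier_subset_body (hK : IsConvexBody K) : frontier K ⊆ K := hK.2.1.isClosed.frontier_subset

lemma ne_zero_of_mem_frontier (h0 : K ∈ 𝓝 0) {z : Eucl n} (hz : z ∈ frontier K) : z ≠ 0 := by
  rintro rfl
  exact hz.2 (mem_interior_iff_mem_nhds.2 h0)

lemma isConvexBody_smul (hK : IsConvexBody K) {c : ℝ} (hc : c ≠ 0) : IsConvexBody (c • K) := by
  refine ⟨hK.1.smul c, hK.2.1.smul c, ?_⟩
  rw [interior_smul₀ hc]
  exact hK.2.2.smul_set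

lemma smul_mem_nhds_zero (h0 : K ∈ 𝓝 0) {c : ℝ} (hc : c ≠ 0) : c • K ∈ 𝓝 (0 : Eucl n) := by
  simpa using smul_mem_nhds_smul₀ hc h0

lemma smul_subset_smul (hK : IsConvexBody K) (h0 : K ∈ 𝓝 0) {a b : ℝ} (ha : 0 ≤ a) (hab : a ≤ b) :
    a • K ⊆ b • K := by
  rintro _ ⟨x, hx, rfl⟩
  rcases ha.eq_or_lt with rfl | ha
  · exact ⟨0, mem_of_mem_nhds h0, by simp⟩
  have hb : 0 < b := ha.trans_le hab
  refine ⟨(a / b) • x, ?_, ?_⟩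
  · have := hK.1 hx (mem_of_mem_nhds h0) (show 0 ≤ a / b by positivity)
      (show 0 ≤ 1 - a / b by rw [sub_nonneg]; exact (div_le_one hb).2 hab) (by ring)
    simpa using this
  · simp only [smul_smul]; congr 1; field_simp

lemma isConvexBody_translate (hK : IsConvexBody K) (a : Eucl n) : IsConvexBody (a +ᵥ K) := by
  refine ⟨hK.1.vadd a, ?_, ?_⟩
  · rw [← image_vadd]; exact hK.2.1.image (by simp only [vadd_eq_add]; fun_prop)
  · rw [interior_vadd]; exact hK.2.2.vadd_set

end Gauge

/-! ### Support functions. -/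

section Support

variable {n : ℕ} {K : Set (Eucl n)}

lemma bddAbove_inner (hK : IsConvexBody K) (v : Eucl n) :
    BddAbove ((fun x : Eucl n => inner ℝ v x) '' K) :=
  (hK.2.1.image (by fun_prop)).bddAbove

lemma inner_le_supp (hK : IsConvexBody K) (v : Sph n) {x : Eucl n} (hx : x ∈ K) :
    inner ℝ (v : Eucl n) x ≤ supp K v :=
  le_csSup (bddAbove_inner hK _) (mem_image_of_mem _ hx)

lemma body_nonempty (hK : IsConvexBody K) : K.Nonempty := hK.2.2.mono interior_subset

lemma supp_le (hK : IsConvexBody K) (v : Sph n) {c : ℝ}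
    (h : ∀ x ∈ K, inner ℝ (v : Eucl n) x ≤ c) : supp K v ≤ c := by
  refine csSup_le ((body_nonempty hK).image _) ?_
  rintro _ ⟨x, hx, rfl⟩
  exact h x hx

lemma exists_inner_eq_supp (hK : IsConvexBody K) (v : Sph n) :
    ∃ x ∈ K, inner ℝ (v : Eucl n) x = supp K v := by
  obtain ⟨x, hx, h⟩ := hK.2.1.exists_isMaxOn (body_nonempty hK)
    (f := fun x : Eucl n => inner ℝ (v : Eucl n) x) (by fun_prop)
  exact ⟨x, hx, le_antisymm (inner_le_supp hK v hx) (supp_le hK v h)⟩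

lemma supp_smul (hK : IsConvexBody K) {c : ℝ} (hc : 0 < c) (v : Sph n) :
    supp (c • K) v = c * supp K v := by
  apply le_antisymm
  · refine supp_le (isConvexBody_smul hK hc.ne') v ?_
    rintro _ ⟨x, hx, rfl⟩
    simp only [inner_smul_right]
    gcongr
    exact inner_le_supp hK v hx
  · obtain ⟨x, hx, h⟩ := exists_inner_eq_supp hK v
    rw [← h, ← inner_smul_right]
    exact inner_le_supp (isConvexBody_smul hK hc.ne') v (smul_mem_smul_set hx)

lemma supp_translate (hK : IsConvexBody K) (a : Eucl n) (v : Sph n) :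
    supp (a +ᵥ K) v = inner ℝ (v : Eucl n) a + supp K v := by
  apply le_antisymm
  · refine supp_le (isConvexBody_translate hK a) v ?_
    rintro _ ⟨x, hx, rfl⟩
    simp only [vadd_eq_add, inner_add_right]
    gcongr
    exact inner_le_supp hK v hx
  · obtain ⟨x, hx, h⟩ := exists_inner_eq_supp hK v
    rw [← h, ← inner_add_right]
    exact inner_le_supp (isConvexBody_translate hK a) v (vadd_mem_vadd_set hx)

lemma continuous_supp (hK : IsConvexBody K) : Continuous (supp K) := by
  obtain ⟨R, hR, hKR⟩ := exists_norm_le hK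
  have key : ∀ v w : Sph n, supp K v ≤ supp K w + R * dist v w := by
    intro v w
    refine supp_le hK v fun x hx => ?_
    have h1 := inner_le_supp hK w hx
    have h2 : inner ℝ ((v : Eucl n) - w) x ≤ ‖(v : Eucl n) - w‖ * ‖x‖ := real_inner_le_norm _ _
    have h3 : ‖(v : Eucl n) - w‖ * ‖x‖ ≤ dist v w * R := by
      rw [Subtype.dist_eq, dist_eq_norm]
      exact mul_le_mul_of_nonneg_left (hKR x hx) (norm_nonneg _)
    rw [inner_sub_left] at h2
    linarith
  have : LipschitzWith (Real.toNNReal R) (supp K) :=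
    LipschitzWith.of_le_add_mul _ fun v w => by
      rw [Real.coe_toNNReal _ hR.le]; exact key v w
  exact this.continuous

lemma supp_pos (hK : IsConvexBody K) (h0 : K ∈ 𝓝 0) (v : Sph n) : 0 < supp K v := by
  obtain ⟨r, hr, hrK⟩ := exists_closedBall_subset h0
  have h := inner_le_supp hK v (x := r • (v : Eucl n)) (hrK (by
    simp [norm_smul, abs_of_pos hr]))
  rw [inner_smul_right, real_inner_self_eq_norm_sq] at h
  have : ‖(v : Eucl n)‖ = 1 := by simp
  rw [this] at h
  linarith

lemma inner_le_norm_mul_supp (hK : IsConvexBody K) {a : Eucl n} (ha : a ≠ 0) {c : ℝ} :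
    (∀ x ∈ K, inner ℝ a x ≤ c) ↔
      ‖a‖ * supp K ⟨‖a‖⁻¹ • a, by simp [norm_smul, ha]⟩ ≤ c := by
  have hpos : 0 < ‖a‖ := norm_pos_iff.2 ha
  constructor
  · intro h
    obtain ⟨x, hx, hxe⟩ := exists_inner_eq_supp hK ⟨‖a‖⁻¹ • a, by simp [norm_smul, ha]⟩
    rw [← hxe]
    simp only [inner_smul_left, RCLike.conj_to_real]
    rw [← mul_assoc, mul_inv_cancel₀ hpos.ne', one_mul]
    exact h x hx
  · intro h x hx
    refine le_trans ?_ h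
    have := inner_le_supp hK ⟨‖a‖⁻¹ • a, by simp [norm_smul, ha]⟩ hx
    simp only [inner_smul_left, RCLike.conj_to_real] at this
    calc inner ℝ a x = ‖a‖ * (‖a‖⁻¹ * inner ℝ a x) := by field_simp
      _ ≤ _ := by gcongr

/-- Hahn-Banach separates an outside point by a functional, whose normalized Riesz vector is a
direction violating the hypothesis. This is what bounds Wulff shapes by dilates of the body. -/
lemma mem_of_forall_inner_le_supp (hK : IsConvexBody K) {x : Eucl n}
    (h : ∀ v : Sph n, inner ℝ (v : Eucl n) x ≤ supp K v) : x ∈ K := by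
  by_contra hx
  obtain ⟨f, u, hfu, hfx⟩ := geometric_hahn_banach_closed_point hK.1 hK.2.1.isClosed hx
  set a : Eucl n := (InnerProductSpace.toDual ℝ (Eucl n)).symm f with ha
  have hin : ∀ y, inner ℝ a y = f y := fun y => by
    rw [ha, InnerProductSpace.toDual_symm_apply]
  have ha0 : a ≠ 0 := by
    intro h0
    obtain ⟨y, hy⟩ := body_nonempty hK
    have h1 := hfu y hy
    rw [← hin] at h1 hfx
    rw [h0, inner_zero_left] at h1 hfx
    linarith
  have h1 := (inner_le_norm_mul_supp hK ha0 (c := u)).1 fun y hy => by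
    rw [hin]; exact (hfu y hy).le
  have h2 := h ⟨‖a‖⁻¹ • a, by simp [norm_smul, ha0]⟩
  have hpos : 0 < ‖a‖ := norm_pos_iff.2 ha0
  have h3 : inner ℝ a x ≤ u := by
    refine le_trans ?_ h1
    simp only [inner_smul_left, RCLike.conj_to_real] at h2
    calc inner ℝ a x = ‖a‖ * (‖a‖⁻¹ * inner ℝ a x) := by field_simp
      _ ≤ _ := by gcongr
  rw [hin] at h3
  linarith

end Support

/-! ### Outer normals, the gradient of the gauge and the Gauss map. -/

section Normals

variable {n : ℕ} {K : Set (Eucl n)}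

/-- The outer normals `a` of `K` at `z`, normalized by `a · z = 1`. -/
def normals (K : Set (Eucl n)) (z : Eucl n) : Set (Eucl n) :=
  {a | inner ℝ a z = 1 ∧ ∀ x ∈ K, inner ℝ a x ≤ 1}

/-- A functional separating `z` from the interior is positive at `z`, because the origin is
interior, so it can be normalized to be `1` there. -/
lemma normals_nonempty (hK : IsConvexBody K) (h0 : K ∈ 𝓝 0) {z : Eucl n} (hz : z ∈ frontier K) :
    (normals K z).Nonempty := by
  obtain ⟨f, hf⟩ := geometric_hahn_banach_open_point hK.1.interior isOpen_interior hz.2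
  have h00 := hf 0 (mem_interior_iff_mem_nhds.2 h0)
  rw [map_zero] at h00
  have hle : ∀ x ∈ K, f x ≤ f z := by
    intro x hx
    have hx' : x ∈ closure (interior K) := by
      rw [hK.1.closure_interior_eq_closure_of_nonempty_interior hK.2.2]
      exact subset_closure hx
    exact closure_minimal (fun y hy => (hf y hy).le)
      (isClosed_le f.continuous continuous_const) hx'
  refine ⟨(f z)⁻¹ • (InnerProductSpace.toDual ℝ (Eucl n)).symm f, ?_, fun x hx => ?_⟩
  · rw [inner_smul_left, InnerProductSpace.toDual_symm_apply]
    simp [h00.ne']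
  · rw [inner_smul_left, InnerProductSpace.toDual_symm_apply]
    simp only [RCLike.conj_to_real]
    rw [inv_mul_le_iff₀ h00, mul_one]
    exact hle x hx

lemma inner_le_gauge (hK : IsConvexBody K) (h0 : K ∈ 𝓝 0) {a : Eucl n}
    (ha : ∀ x ∈ K, inner ℝ a x ≤ 1) (x : Eucl n) : inner ℝ a x ≤ gauge K x := by
  rcases eq_or_ne x 0 with rfl | hx
  · simp [gauge_zero]
  have hp := gauge_pos_of_ne hK h0 hx
  have := ha _ (frontier_subset_body hK (inv_gauge_smul_mem_frontier hK h0 hx))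
  rw [inner_smul_right, inv_mul_le_iff₀ hp, mul_one] at this
  exact this

/-- The gradient of the gauge of `K`. -/
def grad (K : Set (Eucl n)) (x : Eucl n) : Eucl n :=
  (InnerProductSpace.toDual ℝ (Eucl n)).symm (fderiv ℝ (gauge K) x)

lemma inner_grad (x y : Eucl n) : inner ℝ (grad K x) y = fderiv ℝ (gauge K) x y := by
  rw [grad, InnerProductSpace.toDual_symm_apply]

lemma measurable_grad (K : Set (Eucl n)) : Measurable (grad K) :=
  (LinearIsometryEquiv.continuous _).measurable.comp (measurable_fderiv ℝ _)

/-- The gauge dominates `a · x` with equality at `z`, so the difference has a minimum at `z` and its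
derivative there vanishes. Thus a smooth boundary point has exactly one normalized normal. -/
lemma eq_grad_of_mem_normals (hK : IsConvexBody K) (h0 : K ∈ 𝓝 0) {z a : Eucl n}
    (hz : z ∈ frontier K) (hd : DifferentiableAt ℝ (gauge K) z) (ha : a ∈ normals K z) :
    a = grad K z := by
  have hmin : IsLocalMin (fun x => gauge K x - inner ℝ a x) z := by
    refine Filter.Eventually.of_forall fun x => ?_
    have h1 := inner_le_gauge hK h0 ha.2 x
    have h2 := (mem_frontier_iff_gauge hK h0).1 hz
    simp only
    rw [h2, ha.1]
    linarith
  have hd2 : HasFDerivAt (fun x => inner ℝ a x) (innerSL ℝ a) z := (innerSL ℝ a).hasFDerivAt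
  have h3 := hmin.hasFDerivAt_eq_zero (hd.hasFDerivAt.sub hd2)
  refine ext_inner_right ℝ fun y => ?_
  rw [inner_grad]
  have := DFunLike.congr_fun h3 y
  simp at this
  linarith

lemma grad_mem_normals (hK : IsConvexBody K) (h0 : K ∈ 𝓝 0) {z : Eucl n}
    (hz : z ∈ frontier K) (hd : DifferentiableAt ℝ (gauge K) z) : grad K z ∈ normals K z := by
  obtain ⟨a, ha⟩ := normals_nonempty hK h0 hz
  rwa [← eq_grad_of_mem_normals hK h0 hz hd ha]

lemma ne_zero_of_mem_normals {z a : Eucl n} (ha : a ∈ normals K z) : a ≠ 0 := by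
  rintro rfl
  have := ha.1
  simp at this

lemma hasFDerivAt_gauge_smul {x : Eucl n} {f : Eucl n →L[ℝ] ℝ}
    (hd : HasFDerivAt (gauge K) f x) {r : ℝ} (hr : 0 < r) :
    HasFDerivAt (gauge K) f (r • x) := by
  have h1 : HasFDerivAt (fun y : Eucl n => r⁻¹ • y) (r⁻¹ • ContinuousLinearMap.id ℝ (Eucl n))
      (r • x) := (hasFDerivAt_id _).const_smul r⁻¹
  have h2 : HasFDerivAt (gauge K) f (r⁻¹ • (r • x)) := by
    rwa [smul_smul, inv_mul_cancel₀ hr.ne', one_smul]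
  have h3 := (h2.comp (r • x) h1).const_smul r
  have e1 : (r • (gauge K ∘ fun y : Eucl n => r⁻¹ • y)) = gauge K := by
    ext y
    simp only [Pi.smul_apply, Function.comp, smul_eq_mul]
    rw [gauge_smul_pos _ (by positivity), ← mul_assoc, mul_inv_cancel₀ hr.ne', one_mul]
  have e2 : r • f.comp (r⁻¹ • ContinuousLinearMap.id ℝ (Eucl n)) = f := by
    ext y
    simp [hr.ne']
  rw [e2] at h3
  rw [← e1]
  exact h3

lemma differentiableAt_gauge_smul_iff {x : Eucl n} {r : ℝ} (hr : 0 < r) :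
    DifferentiableAt ℝ (gauge K) (r • x) ↔ DifferentiableAt ℝ (gauge K) x := by
  constructor
  · intro h
    have := hasFDerivAt_gauge_smul h.hasFDerivAt (inv_pos.2 hr)
    rw [smul_smul, inv_mul_cancel₀ hr.ne', one_smul] at this
    exact this.differentiableAt
  · intro h
    exact (hasFDerivAt_gauge_smul h.hasFDerivAt hr).differentiableAt

lemma grad_smul (x : Eucl n) {r : ℝ} (hr : 0 < r) : grad K (r • x) = grad K x := by
  unfold grad
  congr 1
  by_cases h : DifferentiableAt ℝ (gauge K) x
  · exact (hasFDerivAt_gauge_smul h.hasFDerivAt hr).fderiv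
  · rw [fderiv_zero_of_not_differentiableAt h, fderiv_zero_of_not_differentiableAt]
    rwa [differentiableAt_gauge_smul_iff hr]

lemma ae_differentiableAt_gauge (hK : IsConvexBody K) (h0 : K ∈ 𝓝 0) :
    ∀ᵐ x : Eucl n, DifferentiableAt ℝ (gauge K) x := by
  obtain ⟨C, hC⟩ := hK.1.lipschitz_gauge h0
  exact hC.ae_differentiableAt

/-- Cauchy-Schwarz in `a · z = 1`. The bound later turns an absolute error in a normal into a
relative one. -/
lemma inv_le_norm_normals {z a : Eucl n} {R : ℝ} (hR : 0 < R) (hz : ‖z‖ ≤ R)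
    (ha : a ∈ normals K z) : R⁻¹ ≤ ‖a‖ := by
  have h1 : (1 : ℝ) ≤ ‖a‖ * ‖z‖ := by rw [← ha.1]; exact real_inner_le_norm _ _
  rw [← one_div, div_le_iff₀ hR]
  exact h1.trans (by gcongr)

/-- The unit outer normal of `K` on the ray through `x`, with a junk value where the gauge of `K`
has zero gradient. -/
def unitNormal (K : Set (Eucl n)) (u : Sph n) : Sph n :=
  open Classical in
  if h : grad K (u : Eucl n) = 0 then u
  else ⟨‖grad K (u : Eucl n)‖⁻¹ • grad K (u : Eucl n), by simp [norm_smul, h]⟩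

lemma measurable_unitNormal (K : Set (Eucl n)) : Measurable (unitNormal K) := by
  suffices Measurable fun u : Sph n => ((unitNormal K u : Sph n) : Eucl n) from
    this.subtype_mk (h := fun u => (unitNormal K u).2)
  have : (fun u : Sph n => ((unitNormal K u : Sph n) : Eucl n)) = fun u : Sph n =>
      open Classical in
      if grad K (u : Eucl n) = 0 then (u : Eucl n)
      else ‖grad K (u : Eucl n)‖⁻¹ • grad K (u : Eucl n) := by
    funext u
    unfold unitNormal
    split_ifs <;> rfl
  rw [this]
  have hg : Measurable fun u : Sph n => grad K (u : Eucl n) :=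
    (measurable_grad K).comp measurable_subtype_coe
  exact Measurable.ite (hg (measurableSet_singleton 0)) measurable_subtype_coe
    (hg.norm.inv.smul hg)

end Normals

/-! ### Fubini along parallel lines. -/

section Lines

variable {n : ℕ}

lemma lintegral_eq_lintegral_lines (u : Sph n) {F : Eucl n → ℝ≥0∞} (hF : Measurable F) :
    ∫⁻ x, F x = ∫⁻ y : (ℝ ∙ (u : Eucl n))ᗮ, ∫⁻ τ : ℝ, F ((y : Eucl n) + τ • (u : Eucl n)) := by
  have hu : ‖(u : Eucl n)‖ = 1 := by simp
  have h1 := (ℝ ∙ (u : Eucl n)).measurePreserving_measurableEquivProd (0 : Eucl n)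
  rw [InnerProductSpace.euclideanHausdorffMeasure_eq_volume] at h1
  have h2 := h1.symm
  rw [← h2.lintegral_comp hF, Measure.volume_eq_prod, lintegral_prod_symm']
  · refine lintegral_congr fun y => ?_
    have h3 := (LinearIsometryEquiv.toSpanUnitSingleton (𝕜 := ℝ) (u : Eucl n) hu).measurePreserving
    rw [← h3.lintegral_comp]
    · refine lintegral_congr fun τ => ?_
      simp [add_comm]
    · exact hF.comp (h2.measurable.comp (by fun_prop))
  · exact hF.comp h2.measurable

/-- Reduces the comparisons of chord energies below to one-dimensional inequalities between chord
lengths. -/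
lemma lintegral_le_of_lines (u : Sph n) {F G : Eucl n → ℝ≥0∞} (hF : Measurable F)
    (hG : Measurable G)
    (h : ∀ y : Eucl n, ∫⁻ τ : ℝ, F (y + τ • (u : Eucl n)) ≤ ∫⁻ τ : ℝ, G (y + τ • (u : Eucl n))) :
    ∫⁻ x, F x ≤ ∫⁻ x, G x := by
  rw [lintegral_eq_lintegral_lines u hF, lintegral_eq_lintegral_lines u hG]
  exact lintegral_mono fun y => h y

end Lines

/-! ### One-dimensional inequalities for powers of lengths. -/

section Interval

lemma rpow_neg_anti {s : ℝ} (hs : 0 ≤ s) {a b : ℝ≥0∞} (h : a ≤ b) : b ^ (-s) ≤ a ^ (-s) := by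
  rw [ENNReal.rpow_neg, ENNReal.rpow_neg]
  exact ENNReal.inv_le_inv.2 (ENNReal.rpow_le_rpow h hs)

lemma eq_empty_or_Icc {J : Set ℝ} (hc : Convex ℝ J) (hk : IsCompact J) :
    J = ∅ ∨ ∃ a b, a ≤ b ∧ J = Icc a b := by
  rcases J.eq_empty_or_nonempty with h | h
  · exact Or.inl h
  · right
    have := eq_Icc_of_connected_compact ⟨h, hc.isPreconnected⟩ hk
    refine ⟨_, _, ?_, this⟩
    rw [this] at h
    exact nonempty_Icc.1 h

lemma ofReal_rpow_neg_mul {s ℓ : ℝ} (hℓ : 0 < ℓ) :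
    ENNReal.ofReal ℓ ^ (-s) * ENNReal.ofReal ℓ = ENNReal.ofReal (ℓ ^ (1 - s)) := by
  rw [ENNReal.ofReal_rpow_of_pos hℓ, ← ENNReal.ofReal_mul (by positivity)]
  congr 1
  rw [show 1 - s = -s + 1 by ring, Real.rpow_add_one hℓ.ne']

/-- The value is `ℓ^(1-s) / (1-s)`, written as `ℓ^(-s) * ℓ` because it is to be read as a constant
weight integrated over a chord. At `ℓ = 0` this form is still right, since `⊤ * 0 = 0`. -/
lemma lintegral_rpow_sub {s a c : ℝ} (hs1 : s < 1) (hac : a ≤ c) :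
    ∫⁻ τ in Icc a c, ENNReal.ofReal (c - τ) ^ (-s) =
      ENNReal.ofReal (1 / (1 - s)) * (ENNReal.ofReal (c - a) ^ (-s) * ENNReal.ofReal (c - a)) := by
  rcases hac.eq_or_lt with rfl | hac
  · simp
  rw [ofReal_rpow_neg_mul (sub_pos.2 hac), ← ENNReal.ofReal_mul (by
    have : 0 < 1 - s := by linarith
    positivity)]
  have h1 : ∫⁻ τ in Icc a c, ENNReal.ofReal (c - τ) ^ (-s) =
      ∫⁻ τ in Ioo a c, ENNReal.ofReal ((c - τ) ^ (-s)) := by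
    rw [setLIntegral_congr Ioo_ae_eq_Icc.symm]
    refine setLIntegral_congr_fun measurableSet_Ioo fun τ hτ => ?_
    exact ENNReal.ofReal_rpow_of_pos (sub_pos.2 hτ.2)
  have hi : IntervalIntegrable (fun τ => (c - τ) ^ (-s)) volume a c := by
    have := (intervalIntegral.intervalIntegrable_rpow' (a := c - a) (b := 0) (r := -s)
      (by linarith)).comp_sub_left c
    simpa using this
  rw [h1, setLIntegral_congr Ioo_ae_eq_Ioc, ← ofReal_integral_eq_lintegral_ofReal]
  · rw [← intervalIntegral.integral_of_le hac.le, intervalIntegral.integral_comp_sub_left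
      (fun x => x ^ (-s)), integral_rpow (Or.inl (by linarith))]
    congr 1
    rw [sub_self, Real.zero_rpow (by linarith : -s + 1 ≠ 0), show -s + 1 = 1 - s by ring]
    ring
  · exact (intervalIntegrable_iff_integrableOn_Ioc_of_le hac.le).1 hi
  · refine (ae_restrict_iff' measurableSet_Ioc).2 (Eventually.of_forall fun τ hτ => ?_)
    exact Real.rpow_nonneg (by linarith [hτ.2]) _

lemma forward_length_Icc {a c τ : ℝ} (hτ : τ ∈ Icc a c) :
    volume {b : ℝ | 0 < b ∧ τ + b ∈ Icc a c} = ENNReal.ofReal (c - τ) := by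
  have : {b : ℝ | 0 < b ∧ τ + b ∈ Icc a c} = Ioc 0 (c - τ) := by
    ext b
    simp only [mem_ofPred_eq, mem_Icc, mem_Ioc]
    constructor
    · rintro ⟨h1, h2, h3⟩; exact ⟨h1, by linarith⟩
    · rintro ⟨h1, h2⟩; exact ⟨h1, by linarith [hτ.1], by linarith⟩
  rw [this, Real.volume_Ioc, sub_zero]

lemma lintegral_forward_length {s : ℝ} (hs1 : s < 1) {J : Set ℝ} (hc : Convex ℝ J)
    (hk : IsCompact J) :
    ∫⁻ τ in J, volume {b : ℝ | 0 < b ∧ τ + b ∈ J} ^ (-s) =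
      ENNReal.ofReal (1 / (1 - s)) * (volume J ^ (-s) * volume J) := by
  rcases eq_empty_or_Icc hc hk with rfl | ⟨a, c, hac, rfl⟩
  · simp
  rw [setLIntegral_congr_fun measurableSet_Icc (g := fun τ => ENNReal.ofReal (c - τ) ^ (-s))
    (fun τ hτ => by simp only [forward_length_Icc hτ]), lintegral_rpow_sub hs1 hac, Real.volume_Icc]

/-- The concave function `t^(1-s)` lies below its tangent at `x`; this is Bernoulli's inequality for
`y / x`. -/
lemma bernoulli_length {s x y : ℝ} (hs0 : 0 < s) (hs1 : s < 1) (hx : 0 < x) (hy : 0 ≤ y) :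
    y ^ (1 - s) ≤ x ^ (1 - s) + (1 - s) * x ^ (-s) * (y - x) := by
  have h := rpow_one_add_le_one_add_mul_self (s := y / x - 1) (p := 1 - s)
    (by have : 0 ≤ y / x := by positivity
        linarith) (by linarith) (by linarith)
  have h2 : (1 + (y / x - 1)) = y / x := by ring
  rw [h2, Real.div_rpow hy hx.le, div_le_iff₀ (by positivity)] at h
  refine h.trans (le_of_eq ?_)
  have h3 : x ^ (1 - s) = x ^ (-s) * x := by
    rw [show 1 - s = -s + 1 by ring, Real.rpow_add_one hx.ne']
  rw [h3]
  field_simp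

/-- The tangent inequality at the longer length `y`, arranged without negative terms. -/
lemma length_superset {s : ℝ} (hs0 : 0 < s) (hs1 : s < 1) {x y : ℝ≥0∞} (hy : y ≠ ⊤) (hxy : x ≤ y) :
    x ^ (-s) * x + ENNReal.ofReal (1 - s) * (y ^ (-s) * (y - x)) ≤ y ^ (-s) * y := by
  lift y to NNReal using hy
  lift x to NNReal using ne_top_of_le_ne_top ENNReal.coe_ne_top hxy
  have hxy' : (x : ℝ) ≤ y := by exact_mod_cast hxy
  rcases eq_or_ne y 0 with rfl | hy0
  · have : x = 0 := le_antisymm (by exact_mod_cast hxy) zero_le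
    simp [this]
  have hy1 : 0 < (y : ℝ) := by positivity
  have e1 : (x : ℝ≥0∞) ^ (-s) * x = ENNReal.ofReal ((x : ℝ) ^ (1 - s)) := by
    rcases eq_or_ne x 0 with rfl | hx0
    · simp [Real.zero_rpow (by linarith : 1 - s ≠ 0)]
    · have := ofReal_rpow_neg_mul (s := s) (ℓ := (x : ℝ)) (by positivity)
      simpa using this
  have e2 : (y : ℝ≥0∞) ^ (-s) * y = ENNReal.ofReal ((y : ℝ) ^ (1 - s)) := by
    have := ofReal_rpow_neg_mul (s := s) hy1
    simpa using this
  have e3 : (y : ℝ≥0∞) ^ (-s) = ENNReal.ofReal ((y : ℝ) ^ (-s)) := by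
    rw [← ENNReal.ofReal_rpow_of_pos hy1]; simp
  have e4 : (y : ℝ≥0∞) - x = ENNReal.ofReal ((y : ℝ) - x) := by
    rw [ENNReal.ofReal_sub _ x.coe_nonneg]; simp
  have h := bernoulli_length hs0 hs1 hy1 x.coe_nonneg
  have hp : 0 ≤ (1 - s) := by linarith
  have hd : 0 ≤ (y : ℝ) - x := by linarith
  rw [e1, e2, e3, e4, ← ENNReal.ofReal_mul (by positivity), ← ENNReal.ofReal_mul hp,
    ← ENNReal.ofReal_add (by positivity) (by positivity)]
  refine ENNReal.ofReal_le_ofReal ?_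
  nlinarith

/-- Two bounds in one. The tangent at the shorter length `x` has the sharp factor `1 - s` but blows
up as `x → 0`. The cruder one, from `y^(-s) ≤ x^(-s)`, loses that factor but stays controlled, and
supplies the dominating function in a limit. -/
lemma length_subset {s : ℝ} (hs0 : 0 < s) (hs1 : s < 1) {x y : ℝ≥0∞} (hy : y ≠ ⊤) (hxy : x ≤ y) :
    y ^ (-s) * y ≤ x ^ (-s) * x +
      min (y ^ (-s)) (ENNReal.ofReal (1 - s) * x ^ (-s)) * (y - x) := by
  rcases min_cases (y ^ (-s)) (ENNReal.ofReal (1 - s) * x ^ (-s)) with ⟨h, -⟩ | ⟨h, h'⟩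
  · rw [h]
    calc y ^ (-s) * y = y ^ (-s) * (x + (y - x)) := by rw [add_tsub_cancel_of_le hxy]
      _ = y ^ (-s) * x + y ^ (-s) * (y - x) := mul_add _ _ _
      _ ≤ _ := by gcongr ?_ * _ + _; exact rpow_neg_anti hs0.le hxy
  · rw [h]
    lift y to NNReal using hy
    lift x to NNReal using ne_top_of_le_ne_top ENNReal.coe_ne_top hxy
    have hxy' : (x : ℝ) ≤ y := by exact_mod_cast hxy
    rcases eq_or_ne x 0 with rfl | hx0
    -- For `x = 0` the second entry of the minimum is `⊤` and cannot be strictly smaller than the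
    -- first.
    · exfalso
      simp only [ENNReal.coe_zero, ENNReal.zero_rpow_of_neg (neg_neg_of_pos hs0)] at h'
      rw [ENNReal.mul_top (by simpa using hs1)] at h'
      exact not_top_lt h'
    have hx1 : 0 < (x : ℝ) := by positivity
    have hy1 : 0 < (y : ℝ) := by linarith
    have e1 : (x : ℝ≥0∞) ^ (-s) * x = ENNReal.ofReal ((x : ℝ) ^ (1 - s)) := by
      have := ofReal_rpow_neg_mul (s := s) hx1
      simpa using this
    have e2 : (y : ℝ≥0∞) ^ (-s) * y = ENNReal.ofReal ((y : ℝ) ^ (1 - s)) := by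
      have := ofReal_rpow_neg_mul (s := s) hy1
      simpa using this
    have e3 : (x : ℝ≥0∞) ^ (-s) = ENNReal.ofReal ((x : ℝ) ^ (-s)) := by
      rw [← ENNReal.ofReal_rpow_of_pos hx1]; simp
    have e4 : (y : ℝ≥0∞) - x = ENNReal.ofReal ((y : ℝ) - x) := by
      rw [ENNReal.ofReal_sub _ x.coe_nonneg]; simp
    have hp : 0 ≤ (1 - s) := by linarith
    have hd : 0 ≤ (y : ℝ) - x := by linarith
    rw [e1, e2, e3, e4, ← ENNReal.ofReal_mul hp, ← ENNReal.ofReal_mul (by positivity),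
      ← ENNReal.ofReal_add (by positivity) (by positivity)]
    exact ENNReal.ofReal_le_ofReal (bernoulli_length hs0 hs1 hx1 y.coe_nonneg)

end Interval

/-! ### Chord lengths and their weights. -/

section Chord

variable {n : ℕ} {K : Set (Eucl n)}

/-- The set of parameters at which the line through `x` in direction `u` meets `K`. -/
def lineSet (K : Set (Eucl n)) (x u : Eucl n) : Set ℝ := {b : ℝ | x + b • u ∈ K}

/-- The length of the chord of `K` through `x` in direction `u`. -/
def chord (K : Set (Eucl n)) (x u : Eucl n) : ℝ≥0∞ := volume (lineSet K x u)

/-- The length of the part of the chord of `K` that lies ahead of `x` in direction `u`. -/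
def halfChord (K : Set (Eucl n)) (x u : Eucl n) : ℝ≥0∞ := volume {b : ℝ | 0 < b ∧ x + b • u ∈ K}

lemma isClosed_lineSet (hK : IsClosed K) (x u : Eucl n) : IsClosed (lineSet K x u) :=
  hK.preimage (by fun_prop)

lemma convex_lineSet (hK : Convex ℝ K) (x u : Eucl n) : Convex ℝ (lineSet K x u) := by
  intro a ha b hb p q hp hq hpq
  have := hK ha hb hp hq hpq
  simp only [lineSet, mem_ofPred_eq] at this ⊢
  convert this using 1
  have hx : x = p • x + q • x := by rw [← add_smul, hpq, one_smul]
  nth_rewrite 1 [hx]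
  simp only [smul_add, add_smul, smul_smul, smul_eq_mul]
  abel

lemma abs_le_of_mem_lineSet {R : ℝ} (hR : ∀ x ∈ K, ‖x‖ ≤ R) {x : Eucl n} {u : Sph n} {b : ℝ}
    (hb : b ∈ lineSet K x u) : |b| ≤ R + ‖x‖ := by
  have h1 : ‖b • (u : Eucl n)‖ = |b| := by simp [norm_smul]
  rw [← h1]
  have : b • (u : Eucl n) = (x + b • (u : Eucl n)) - x := by abel
  rw [this]
  exact (norm_sub_le _ _).trans (by gcongr; exact hR _ hb)

lemma isCompact_lineSet (hK : IsCompact K) (x : Eucl n) (u : Sph n) :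
    IsCompact (lineSet K x u) := by
  obtain ⟨R, hR⟩ := hK.isBounded.exists_norm_le
  refine isCompact_of_isClosed_isBounded (isClosed_lineSet hK.isClosed _ _) ?_
  refine (Metric.isBounded_closedBall (x := (0 : ℝ)) (r := R + ‖x‖)).subset fun b hb => ?_
  simpa using abs_le_of_mem_lineSet hR hb

lemma chord_ne_top (hK : IsCompact K) (x : Eucl n) (u : Sph n) : chord K x u ≠ ⊤ :=
  (isCompact_lineSet hK x u).measure_lt_top.ne

lemma chord_mono {K' : Set (Eucl n)} (h : K ⊆ K') (x u : Eucl n) : chord K x u ≤ chord K' x u :=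
  measure_mono fun _ hb => h hb

lemma lineSet_add_smul (y u : Eucl n) (τ : ℝ) :
    lineSet K (y + τ • u) u = (fun b => b + τ) ⁻¹' lineSet K y u := by
  ext b
  simp only [lineSet, mem_ofPred_eq, mem_preimage, add_smul]
  rw [show y + τ • u + b • u = y + (b • u + τ • u) by abel]

lemma chord_add_smul (y u : Eucl n) (τ : ℝ) : chord K (y + τ • u) u = chord K y u := by
  unfold chord
  rw [lineSet_add_smul, measure_preimage_add_right]

lemma halfChord_add_smul (y u : Eucl n) (τ : ℝ) :
    halfChord K (y + τ • u) u = volume {b : ℝ | 0 < b ∧ τ + b ∈ lineSet K y u} := by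
  unfold halfChord lineSet
  congr 1
  ext b
  simp only [mem_ofPred_eq, add_smul, add_assoc]

lemma measurable_chord (hK : MeasurableSet K) :
    Measurable fun p : Eucl n × Eucl n => chord K p.1 p.2 := by
  have : MeasurableSet {q : (Eucl n × Eucl n) × ℝ | q.1.1 + q.2 • q.1.2 ∈ K} :=
    hK.preimage (Continuous.measurable (by fun_prop))
  exact measurable_measure_prodMk_left (ν := (volume : Measure ℝ)) this

lemma measurable_halfChord (hK : MeasurableSet K) :
    Measurable fun p : Eucl n × Eucl n => halfChord K p.1 p.2 := by
  have : MeasurableSet {q : (Eucl n × Eucl n) × ℝ | 0 < q.2 ∧ q.1.1 + q.2 • q.1.2 ∈ K} :=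
    (measurableSet_lt measurable_const measurable_snd).inter
      (hK.preimage (Continuous.measurable (by fun_prop)))
  exact measurable_measure_prodMk_left (ν := (volume : Measure ℝ)) this

/-- The weight `ℓ ^ (-s)` of a chord of length `ℓ`. -/
def chordWeight (s : ℝ) (K : Set (Eucl n)) (x u : Eucl n) : ℝ≥0∞ := chord K x u ^ (-s)

lemma measurable_chordWeight (s : ℝ) (hK : MeasurableSet K) :
    Measurable fun p : Eucl n × Eucl n => chordWeight s K p.1 p.2 :=
  (measurable_chord hK).pow_const _

lemma measurable_chordWeight_left (s : ℝ) (hK : MeasurableSet K) (u : Eucl n) :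
    Measurable fun x : Eucl n => chordWeight s K x u :=
  (measurable_chordWeight s hK).comp (measurable_id.prodMk measurable_const)

lemma indicator_line {A : Set (Eucl n)} (G : Eucl n → ℝ≥0∞) (y u : Eucl n) (τ : ℝ) :
    A.indicator G (y + τ • u) = (lineSet A y u).indicator (fun t => G (y + t • u)) τ := by
  by_cases h : τ ∈ lineSet A y u
  · rw [indicator_of_mem h, indicator_of_mem (show y + τ • u ∈ A from h)]
  · rw [indicator_of_notMem h, indicator_of_notMem (show y + τ • u ∉ A from h)]

lemma measurableSet_lineSet {A : Set (Eucl n)} (hA : MeasurableSet A) (y u : Eucl n) :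
    MeasurableSet (lineSet A y u) :=
  hA.preimage (Continuous.measurable (by fun_prop))

lemma setLIntegral_line {A : Set (Eucl n)} (hA : MeasurableSet A) (G : Eucl n → ℝ≥0∞)
    (y u : Eucl n) :
    ∫⁻ τ : ℝ, A.indicator G (y + τ • u) = ∫⁻ τ in lineSet A y u, G (y + τ • u) := by
  rw [← lintegral_indicator (measurableSet_lineSet hA y u)]
  exact lintegral_congr fun τ => indicator_line G y u τ

/-- On a line parallel to `u` the chord length is constant while the forward part sweeps through all
lengths up to it, so the interval identity applies line by line. -/
lemma lintegral_halfChord {s : ℝ} (hs1 : s < 1) (hK : IsConvexBody K) (u : Sph n) :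
    ∫⁻ x in K, halfChord K x u ^ (-s) =
      ENNReal.ofReal (1 / (1 - s)) * ∫⁻ x in K, chordWeight s K x u := by
  have hKm := hK.2.1.measurableSet
  have hm : Measurable fun x : Eucl n => halfChord K x u ^ (-s) :=
    ((measurable_halfChord hKm).comp (measurable_id.prodMk measurable_const)).pow_const _
  have hw := measurable_chordWeight_left s hKm (u : Eucl n)
  rw [← lintegral_const_mul _ hw, ← lintegral_indicator hKm, ← lintegral_indicator hKm]
  have key : ∀ y : Eucl n,
      ∫⁻ τ : ℝ, K.indicator (fun x => halfChord K x u ^ (-s)) (y + τ • (u : Eucl n)) =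
      ∫⁻ τ : ℝ, K.indicator (fun x => ENNReal.ofReal (1 / (1 - s)) * chordWeight s K x u)
        (y + τ • (u : Eucl n)) := by
    intro y
    rw [setLIntegral_line hKm, setLIntegral_line hKm]
    simp only [chordWeight, chord_add_smul, halfChord_add_smul]
    rw [lintegral_forward_length hs1 (convex_lineSet hK.1 _ _) (isCompact_lineSet hK.2.1 _ _),
      setLIntegral_const, mul_assoc]
    rfl
  refine le_antisymm ?_ ?_
  · exact lintegral_le_of_lines u (hm.indicator hKm) ((hw.const_mul _).indicator hKm)
      fun y => (key y).le
  · exact lintegral_le_of_lines u ((hw.const_mul _).indicator hKm) (hm.indicator hKm)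
      fun y => (key y).ge

lemma chordWeight_superset {s : ℝ} (hs0 : 0 < s) (hs1 : s < 1) {K' : Set (Eucl n)}
    (hK : IsConvexBody K) (hK' : IsConvexBody K') (h : K ⊆ K') (u : Sph n) :
    (∫⁻ x in K, chordWeight s K x u) +
        ENNReal.ofReal (1 - s) * ∫⁻ x in K' \ K, chordWeight s K' x u ≤
      ∫⁻ x in K', chordWeight s K' x u := by
  have hKm := hK.2.1.measurableSet
  have hKm' := hK'.2.1.measurableSet
  have hw := measurable_chordWeight_left s hKm (u : Eucl n)
  have hw' := measurable_chordWeight_left s hKm' (u : Eucl n)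
  rw [← lintegral_const_mul _ hw', ← lintegral_indicator hKm, ← lintegral_indicator hKm',
    ← lintegral_indicator (hKm'.diff hKm), ← lintegral_add_left (hw.indicator hKm)]
  refine lintegral_le_of_lines u
    ((hw.indicator hKm).add ((hw'.const_mul _).indicator (hKm'.diff hKm))) (hw'.indicator hKm')
    fun y => ?_
  rw [lintegral_add_left]
  swap
  · exact (hw.indicator hKm).comp (Continuous.measurable (by fun_prop))
  rw [setLIntegral_line hKm, setLIntegral_line hKm', setLIntegral_line (hKm'.diff hKm)]
  simp only [chordWeight, chord_add_smul, setLIntegral_const]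
  have hd : volume (lineSet (K' \ K) y u) = chord K' y u - chord K y u := by
    have : lineSet (K' \ K) y u = lineSet K' y u \ lineSet K y u := rfl
    rw [this, measure_sdiff (show lineSet _ y u ⊆ lineSet _ y u from fun b hb => h hb) (measurableSet_lineSet hKm y u).nullMeasurableSet
      (chord_ne_top hK.2.1 y u)]
    rfl
  rw [hd, mul_assoc]
  exact length_superset hs0 hs1 (chord_ne_top hK'.2.1 y u) (chord_mono h y u)

lemma chordWeight_subset {s : ℝ} (hs0 : 0 < s) (hs1 : s < 1) {K' : Set (Eucl n)}
    (hK : IsConvexBody K) (hK' : IsConvexBody K') (h : K' ⊆ K) (u : Sph n) :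
    ∫⁻ x in K, chordWeight s K x u ≤ (∫⁻ x in K', chordWeight s K' x u) +
      ∫⁻ x in K \ K', min (chordWeight s K x u) (ENNReal.ofReal (1 - s) * chordWeight s K' x u) := by
  have hKm := hK.2.1.measurableSet
  have hKm' := hK'.2.1.measurableSet
  have hw := measurable_chordWeight_left s hKm (u : Eucl n)
  have hw' := measurable_chordWeight_left s hKm' (u : Eucl n)
  rw [← lintegral_indicator hKm, ← lintegral_indicator hKm',
    ← lintegral_indicator (hKm.diff hKm'), ← lintegral_add_left (hw'.indicator hKm')]
  refine lintegral_le_of_lines u (hw.indicator hKm) ((hw'.indicator hKm').add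
    ((hw.min (hw'.const_mul _)).indicator (hKm.diff hKm')))
    fun y => ?_
  rw [lintegral_add_left]
  swap
  · exact (hw'.indicator hKm').comp (Continuous.measurable (by fun_prop))
  rw [setLIntegral_line hKm, setLIntegral_line hKm', setLIntegral_line (hKm.diff hKm')]
  simp only [chordWeight, chord_add_smul, setLIntegral_const]
  have hd : volume (lineSet (K \ K') y u) = chord K y u - chord K' y u := by
    have : lineSet (K \ K') y u = lineSet K y u \ lineSet K' y u := rfl
    rw [this, measure_sdiff (show lineSet _ y u ⊆ lineSet _ y u from fun b hb => h hb) (measurableSet_lineSet hKm' y u).nullMeasurableSet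
      (chord_ne_top hK'.2.1 y u)]
    rfl
  rw [hd]
  exact length_subset hs0 hs1 (chord_ne_top hK.2.1 y u) (chord_mono h y u)

lemma rpow_neg_mul_self_mono {s : ℝ} (hs0 : 0 < s) (hs1 : s < 1) {x y : ℝ≥0∞} (hy : y ≠ ⊤)
    (hxy : x ≤ y) : x ^ (-s) * x ≤ y ^ (-s) * y :=
  le_self_add.trans (length_superset hs0 hs1 hy hxy)

/-- A chord has length at most `2 * R`, and a line meeting `K` spends at least length `2 * R` in the
ball of radius `3 * R`. Monotonicity of `ℓ^(1-s)` then bounds the contribution of each line,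
uniformly in the direction. -/
lemma lintegral_chordWeight_le {s : ℝ} (hs0 : 0 < s) (hs1 : s < 1) (hK : IsConvexBody K) {R : ℝ}
    (hR : ∀ x ∈ K, ‖x‖ ≤ R) (u : Sph n) :
    ∫⁻ x in K, chordWeight s K x u ≤
      ENNReal.ofReal (2 * R) ^ (-s) * volume (closedBall (0 : Eucl n) (3 * R)) := by
  have hKm := hK.2.1.measurableSet
  have hw := measurable_chordWeight_left s hKm (u : Eucl n)
  have hBm : MeasurableSet (closedBall (0 : Eucl n) (3 * R)) := isClosed_closedBall.measurableSet
  rw [← setLIntegral_const, ← lintegral_indicator hKm, ← lintegral_indicator hBm]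
  refine lintegral_le_of_lines u (hw.indicator hKm) (measurable_const.indicator hBm) fun y => ?_
  rw [setLIntegral_line hKm, setLIntegral_line hBm]
  simp only [chordWeight, chord_add_smul, setLIntegral_const]
  rcases (lineSet K y u).eq_empty_or_nonempty with he | ⟨t, ht⟩
  · simp [he]
  have h1 : Icc t (t + 2 * R) ⊆ lineSet (closedBall (0 : Eucl n) (3 * R)) y u := by
    intro b hb
    simp only [lineSet, mem_ofPred_eq, mem_closedBall_zero_iff]
    have h2 : y + b • (u : Eucl n) = (y + t • (u : Eucl n)) + (b - t) • (u : Eucl n) := by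
      rw [sub_smul]; abel
    rw [h2]
    refine (norm_add_le _ _).trans ?_
    have h3 : ‖(b - t) • (u : Eucl n)‖ ≤ 2 * R := by
      have : ‖(b - t) • (u : Eucl n)‖ = |b - t| := by simp [norm_smul]
      rw [this, abs_of_nonneg (by linarith [hb.1])]
      linarith [hb.2]
    have := hR _ ht
    linarith
  have h2 : ENNReal.ofReal (2 * R) ≤ volume (lineSet (closedBall (0 : Eucl n) (3 * R)) y u) := by
    refine le_trans (le_of_eq ?_) (measure_mono h1)
    rw [Real.volume_Icc]; congr 1; ring
  have h3 : chord K y u ≤ ENNReal.ofReal (2 * R) := by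
    have : lineSet K y u ⊆ Icc (-R - inner ℝ (u : Eucl n) y) (R - inner ℝ (u : Eucl n) y) := by
      intro b hb
      have h4 := (abs_real_inner_le_norm (u : Eucl n) (y + b • (u : Eucl n))).trans
        (by simpa using hR _ hb)
      rw [inner_add_right, inner_smul_right, real_inner_self_eq_norm_sq] at h4
      have h5 : ‖(u : Eucl n)‖ = 1 := by simp
      rw [h5, abs_le] at h4
      constructor <;> linarith [h4.1, h4.2]
    refine (measure_mono this).trans ?_
    rw [Real.volume_Icc]
    exact ENNReal.ofReal_le_ofReal (by linarith)
  calc chord K y u ^ (-s) * volume (lineSet K y u)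
      ≤ ENNReal.ofReal (2 * R) ^ (-s) * ENNReal.ofReal (2 * R) :=
        rpow_neg_mul_self_mono hs0 hs1 ENNReal.ofReal_ne_top h3
    _ ≤ _ := by gcongr

end Chord

/-! ### Polar coordinates and the sphere measure. -/

section Polar

variable {n : ℕ}

lemma lintegral_polar [NeZero n] {F : Eucl n → ℝ≥0∞} (hF : Measurable F) :
    ∫⁻ x, F x = ∫⁻ u : Sph n, (∫⁻ r in Ioi (0 : ℝ),
      ENNReal.ofReal (r ^ (n - 1)) * F (r • (u : Eucl n))) ∂((volume : Measure (Eucl n)).toSphere) := by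
  have hp := (Measure.measurePreserving_homeomorphUnitSphereProd (volume : Measure (Eucl n))).symm
    (homeomorphUnitSphereProd (Eucl n)).toMeasurableEquiv
  have h1 : ∫⁻ x, F x = ∫⁻ x : ({0}ᶜ : Set (Eucl n)), F x ∂(Measure.comap Subtype.val volume) := by
    rw [lintegral_subtype_comap (measurableSet_singleton _).compl, restrict_compl_singleton]
  have hFm : Measurable fun x : ({0}ᶜ : Set (Eucl n)) => F x := hF.comp measurable_subtype_coe
  rw [h1, ← hp.lintegral_comp hFm, lintegral_prod]
  · refine lintegral_congr fun u => ?_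
    rw [Measure.volumeIoiPow, lintegral_withDensity_eq_lintegral_mul]
    · rw [← lintegral_subtype_comap measurableSet_Ioi]
      simp
    · fun_prop
    · exact (hFm.comp hp.measurable).comp measurable_prodMk_left
  · exact (hFm.comp hp.measurable).aemeasurable

lemma toSphere_map_neg :
    Measure.map (fun u : Sph n => -u) (volume : Measure (Eucl n)).toSphere =
      (volume : Measure (Eucl n)).toSphere := by
  have hm : Measurable fun u : Sph n => -u := continuous_neg.measurable
  ext A hA
  rw [Measure.map_apply hm hA, Measure.toSphere_apply' _ (hm hA), Measure.toSphere_apply' _ hA]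
  congr 1
  rw [← Measure.measure_neg]
  congr 1
  ext x
  simp only [Set.mem_neg, Set.mem_smul, mem_image, mem_preimage]
  constructor
  · rintro ⟨r, hr, y, ⟨u, hu, rfl⟩, h⟩
    refine ⟨r, hr, _, ⟨-u, hu, rfl⟩, ?_⟩
    rw [← neg_neg x, ← h]
    simp
  · rintro ⟨r, hr, y, ⟨u, hu, rfl⟩, h⟩
    refine ⟨r, hr, _, ⟨-u, by simpa using hu, rfl⟩, ?_⟩
    rw [← h]
    simp

/-- The cone over the exceptional directions lies in a hyperplane, hence is null. Tangential
directions at a smooth boundary point are discarded this way. -/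
lemma ae_toSphere_inner_ne_zero {a : Eucl n} (ha : a ≠ 0) :
    ∀ᵐ u : Sph n ∂(volume : Measure (Eucl n)).toSphere, inner ℝ (u : Eucl n) a ≠ 0 := by
  have hm : MeasurableSet {u : Sph n | inner ℝ (u : Eucl n) a = 0} :=
    (isClosed_eq (by fun_prop) continuous_const).measurableSet
  rw [ae_iff]
  simp only [ne_eq, not_not]
  rw [Measure.toSphere_apply' _ hm]
  have hs : Ioo (0 : ℝ) 1 • ((↑) '' {u : Sph n | inner ℝ (u : Eucl n) a = 0} : Set (Eucl n)) ⊆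
      ((ℝ ∙ a)ᗮ : Submodule ℝ (Eucl n)) := by
    rintro _ ⟨r, -, _, ⟨u, hu, rfl⟩, rfl⟩
    rw [SetLike.mem_coe, Submodule.mem_orthogonal_singleton_iff_inner_left]
    simp only [inner_smul_left]
    rw [mem_ofPred_eq] at hu
    rw [hu, mul_zero]
  have h0 : (volume : Measure (Eucl n)) ((ℝ ∙ a)ᗮ : Submodule ℝ (Eucl n)) = 0 := by
    refine Measure.addHaar_submodule _ _ fun htop => ha ?_
    have : a ∈ (ℝ ∙ a)ᗮ := htop ▸ Submodule.mem_top
    rw [Submodule.mem_orthogonal_singleton_iff_inner_left] at this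
    exact inner_self_eq_zero.1 this
  rw [measure_mono_null hs h0, mul_zero]

lemma setLIntegral_smul {c : ℝ} (hc : 0 < c) (A : Set (Eucl n)) (F : Eucl n → ℝ≥0∞) :
    ∫⁻ x in c • A, F x = ENNReal.ofReal (c ^ n) * ∫⁻ x in A, F (c • x) := by
  have he : MeasurableEmbedding fun x : Eucl n => c • x :=
    (Homeomorph.smulOfNeZero c hc.ne').measurableEmbedding
  have hmap : (volume : Measure (Eucl n)) =
      ENNReal.ofReal (c ^ n) • Measure.map (fun x : Eucl n => c • x) volume := by
    rw [Measure.map_addHaar_smul _ hc.ne', smul_smul, ← ENNReal.ofReal_mul (by positivity)]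
    rw [finrank_euclideanSpace_fin, abs_of_pos (by positivity), mul_inv_cancel₀ (by positivity)]
    simp
  nth_rewrite 1 [hmap]
  rw [Measure.restrict_smul, lintegral_smul_measure, smul_eq_mul, he.restrict_map, he.lintegral_map]
  congr 3
  ext x
  simp [Set.mem_smul_set_iff_inv_smul_mem₀ hc.ne', hc.ne']

end Polar

/-! ### The fractional perimeter as a chord energy; scaling and translation. -/

section Perimeter

variable {n : ℕ} {K L : Set (Eucl n)}

lemma symm_mem_nhds_zero (hL : IsSymmConvexBody L) : L ∈ 𝓝 (0 : Eucl n) := by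
  obtain ⟨x, hx⟩ := hL.1.2.2
  have hx' : -x ∈ interior L := by
    have : -x ∈ interior (-L) := by
      have h : interior (-L) = -interior L := ((Homeomorph.neg (Eucl n)).preimage_interior L).symm
      rw [h]; simpa using hx
    refine interior_mono (fun y hy => ?_) this
    have := hL.2 _ hy
    simpa using this
  have := hL.1.1.interior hx hx' (show (0 : ℝ) ≤ 1 / 2 by norm_num) (show (0 : ℝ) ≤ 1 / 2 by norm_num)
    (by norm_num)
  rw [← mem_interior_iff_mem_nhds]
  simpa using this

lemma setOf_nonneg_mem_eq_Icc (hK : IsConvexBody K) {x : Eucl n} (hx : x ∈ K) (u : Sph n) :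
    0 ≤ radial K x u ∧ {t : ℝ | 0 ≤ t ∧ x + t • (u : Eucl n) ∈ K} = Icc 0 (radial K x u) := by
  set J := {t : ℝ | 0 ≤ t ∧ x + t • (u : Eucl n) ∈ K} with hJ
  have hJ' : J = Ici 0 ∩ lineSet K x u := rfl
  have h0 : (0 : ℝ) ∈ J := ⟨le_rfl, by simpa using hx⟩
  have hc : Convex ℝ J := (convex_Ici 0).inter (convex_lineSet hK.1 _ _)
  have hk : IsCompact J := (isCompact_lineSet hK.2.1 x u).inter_left isClosed_Ici
  rcases eq_empty_or_Icc hc hk with h | ⟨a, b, hab, h⟩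
  · rw [h] at h0; exact absurd h0 (notMem_empty _)
  · have hr : radial K x u = b := by
      show sSup J = b
      rw [h, csSup_Icc hab]
    have ha : a = 0 := by
      rw [h] at h0
      have h1 : a ∈ J := by rw [h]; exact left_mem_Icc.2 hab
      exact le_antisymm h0.1 h1.1
    subst ha
    rw [hr]
    exact ⟨hab, h⟩

lemma radial_nonneg (hK : IsConvexBody K) {x : Eucl n} (hx : x ∈ K) (u : Sph n) :
    0 ≤ radial K x u := (setOf_nonneg_mem_eq_Icc hK hx u).1

lemma add_smul_mem_iff_le_radial (hK : IsConvexBody K) {x : Eucl n} (hx : x ∈ K) (u : Sph n) {t : ℝ}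
    (ht : 0 ≤ t) : x + t • (u : Eucl n) ∈ K ↔ t ≤ radial K x u := by
  have := Set.ext_iff.1 (setOf_nonneg_mem_eq_Icc hK hx u).2 t
  simpa [ht] using this

lemma halfChord_eq_radial (hK : IsConvexBody K) {x : Eucl n} (hx : x ∈ K) (u : Sph n) :
    halfChord K x u = ENNReal.ofReal (radial K x u) := by
  have : {b : ℝ | 0 < b ∧ x + b • (u : Eucl n) ∈ K} = Ioc 0 (radial K x u) := by
    ext b
    rw [mem_Ioc, mem_ofPred_eq]
    exact and_congr_right fun h => add_smul_mem_iff_le_radial hK hx u h.le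
  rw [halfChord, this, Real.volume_Ioc, sub_zero]

lemma radial_pos_of_mem_interior (hK : IsConvexBody K) {x : Eucl n} (hx : x ∈ interior K)
    (u : Sph n) : 0 < radial K x u := by
  obtain ⟨ε, hε, h⟩ := Metric.nhds_basis_closedBall.mem_iff.1 (mem_interior_iff_mem_nhds.1 hx)
  refine hε.trans_le ((add_smul_mem_iff_le_radial hK (interior_subset hx) u hε.le).1 (h ?_))
  simp [norm_smul, abs_of_pos hε]

lemma norm_sph (u : Sph n) : ‖(u : Eucl n)‖ = 1 := by simp

lemma sph_ne_zero (u : Sph n) : (u : Eucl n) ≠ 0 := by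
  rw [← norm_pos_iff, norm_sph]; exact one_pos

lemma radial_zero_eq (hK : IsConvexBody K) (h0 : K ∈ 𝓝 0) (u : Sph n) :
    radial K 0 u = (gauge K (u : Eucl n))⁻¹ := by
  have hp := gauge_pos_of_ne hK h0 (sph_ne_zero u)
  have : {t : ℝ | 0 ≤ t ∧ (0 : Eucl n) + t • (u : Eucl n) ∈ K} = Icc 0 (gauge K (u : Eucl n))⁻¹ := by
    ext t
    rw [mem_Icc, mem_ofPred_eq]
    refine and_congr_right fun ht => ?_
    rw [zero_add, mem_iff_gauge_le_one hK h0, gauge_smul_pos _ ht, ← one_div, le_div_iff₀ hp]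
  rw [radial, this, csSup_Icc (by positivity)]

/-- Spherical Lebesgue measure weighted by `ρ_L ^ (n + s)`. -/
def sphWeight (s : ℝ) (L : Set (Eucl n)) : Measure (Sph n) :=
  ((volume : Measure (Eucl n)).toSphere).withDensity
    fun u => ENNReal.ofReal (radial L 0 u ^ ((n : ℝ) + s))

lemma continuous_radial_zero (hL : IsConvexBody L) (h0 : L ∈ 𝓝 0) :
    Continuous fun u : Sph n => radial L 0 u := by
  simp only [radial_zero_eq hL h0]
  exact ((continuous_gauge hL.1 h0).comp continuous_subtype_val).inv₀
    fun u => (gauge_pos_of_ne hL h0 (sph_ne_zero u)).ne'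

lemma continuous_radial_rpow {s : ℝ} (hL : IsConvexBody L) (h0 : L ∈ 𝓝 0) :
    Continuous fun u : Sph n => radial L 0 u ^ ((n : ℝ) + s) := by
  refine (continuous_radial_zero hL h0).rpow_const fun u => Or.inl ?_
  rw [radial_zero_eq hL h0]
  exact (inv_pos.2 (gauge_pos_of_ne hL h0 (sph_ne_zero u))).ne'

lemma measurable_radial_rpow {s : ℝ} (hL : IsConvexBody L) (h0 : L ∈ 𝓝 0) :
    Measurable fun u : Sph n => ENNReal.ofReal (radial L 0 u ^ ((n : ℝ) + s)) :=
  (continuous_radial_rpow hL h0).measurable.ennreal_ofReal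

lemma isFiniteMeasure_sphWeight {s : ℝ} (hL : IsConvexBody L) (h0 : L ∈ 𝓝 0) :
    IsFiniteMeasure (sphWeight s L) := by
  refine isFiniteMeasure_withDensity_ofReal ?_
  have hc := continuous_radial_rpow (s := s) hL h0
  exact (hc.integrable_of_hasCompactSupport
    (HasCompactSupport.of_compactSpace _)).2

lemma sphWeight_ae {s : ℝ} {p : Sph n → Prop}
    (h : ∀ᵐ u ∂((volume : Measure (Eucl n)).toSphere), p u) : ∀ᵐ u ∂(sphWeight s L), p u :=
  (withDensity_absolutelyContinuous _ _).ae_le h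

lemma lintegral_sphWeight {s : ℝ} (hL : IsConvexBody L) (h0 : L ∈ 𝓝 0) {F : Sph n → ℝ≥0∞}
    (hF : Measurable F) : ∫⁻ u, F u ∂(sphWeight s L) =
      ∫⁻ u, ENNReal.ofReal (radial L 0 u ^ ((n : ℝ) + s)) * F u
        ∂((volume : Measure (Eucl n)).toSphere) := by
  rw [sphWeight, lintegral_withDensity_eq_lintegral_mul _ (measurable_radial_rpow hL h0) hF]
  rfl

lemma lintegral_sphWeight_neg {s : ℝ} (hL : IsSymmConvexBody L) {F : Sph n → ℝ≥0∞}
    (hF : Measurable F) : ∫⁻ u, F (-u) ∂(sphWeight s L) = ∫⁻ u, F u ∂(sphWeight s L) := by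
  have h0 := symm_mem_nhds_zero hL
  have hm : Measurable fun u : Sph n => -u := continuous_neg.measurable
  rw [lintegral_sphWeight hL.1 h0 hF, lintegral_sphWeight hL.1 h0 (F := fun u => F (-u)) (hF.comp hm)]
  conv_rhs => rw [← toSphere_map_neg,
    lintegral_map (f := fun u => ENNReal.ofReal (radial L 0 u ^ ((n : ℝ) + s)) * F u)
      ((measurable_radial_rpow hL.1 h0).mul hF) hm]
  refine lintegral_congr fun u => ?_
  have : radial L 0 (-u) = radial L 0 u := by
    rw [radial_zero_eq hL.1 h0, radial_zero_eq hL.1 h0, coe_neg_sphere, gauge_neg hL.2]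
  rw [this]

/-- In polar coordinates at `x` the integrand along `u` is `ρ_L(u)^(n+s) r^(-1-s)` beyond the exit
distance and `0` before it. That distance is positive because `x` is interior, and the tail integral
is its power `-s` divided by `s`. -/
lemma lintegral_kernel_compl [NeZero n] {s : ℝ} (hs0 : 0 < s) (hK : IsConvexBody K)
    (hL : IsSymmConvexBody L) {x : Eucl n} (hx : x ∈ interior K) :
    ∫⁻ y in Kᶜ, ENNReal.ofReal (1 / gauge L (x - y) ^ ((n : ℝ) + s)) =
      ENNReal.ofReal (1 / s) * ∫⁻ u, halfChord K x u ^ (-s) ∂(sphWeight s L) := by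
  have h0 := symm_mem_nhds_zero hL
  have hKm := hK.2.1.measurableSet
  have hLc := (continuous_gauge hL.1.1 h0)
  have hxK := interior_subset hx
  have hhm : Measurable fun u : Sph n => halfChord K x u ^ (-s) :=
    ((measurable_halfChord hKm).comp (measurable_const.prodMk measurable_subtype_coe)).pow_const _
  rw [← lintegral_const_mul _ hhm, lintegral_sphWeight hL.1 h0 (hhm.const_mul _)]
  have hkm : Measurable fun y : Eucl n => ENNReal.ofReal (1 / gauge L (x - y) ^ ((n : ℝ) + s)) :=
    (((hLc.measurable.comp (by fun_prop)).pow_const _).const_div 1).ennreal_ofReal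
  rw [← lintegral_indicator hKm.compl, ← lintegral_add_left_eq_self _ x,
    lintegral_polar (F := fun w => Kᶜ.indicator
      (fun y => ENNReal.ofReal (1 / gauge L (x - y) ^ ((n : ℝ) + s))) (x + w))
      ((hkm.indicator hKm.compl).comp (by fun_prop))]
  refine lintegral_congr fun u => ?_
  have hgu := gauge_pos_of_ne hL.1 h0 (sph_ne_zero u)
  have hρ := radial_pos_of_mem_interior hK hx u
  set ρ := radial K x u
  have h1 : ∀ r ∈ Ioi (0 : ℝ), ENNReal.ofReal (r ^ (n - 1)) *
      Kᶜ.indicator (fun y => ENNReal.ofReal (1 / gauge L (x - y) ^ ((n : ℝ) + s)))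
        (x + r • (u : Eucl n)) =
      ENNReal.ofReal (radial L 0 u ^ ((n : ℝ) + s)) *
        (Ioi ρ).indicator (fun r => ENNReal.ofReal (r ^ (-1 - s))) r := by
    intro r hr
    rw [mem_Ioi] at hr
    by_cases h : r ≤ ρ
    · rw [indicator_of_notMem, indicator_of_notMem]
      · simp
      · simpa using h
      · simpa using (add_smul_mem_iff_le_radial hK hxK u hr.le).2 h
    · rw [indicator_of_mem, indicator_of_mem]
      · rw [← ENNReal.ofReal_mul (by positivity), ← ENNReal.ofReal_mul
          (Real.rpow_nonneg (radial_nonneg hL.1 (mem_of_mem_nhds h0) u) _)]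
        congr 1
        have e1 : x - (x + r • (u : Eucl n)) = -(r • (u : Eucl n)) := by abel
        rw [e1, gauge_neg hL.2, gauge_smul_pos _ hr.le, radial_zero_eq hL.1 h0,
          Real.mul_rpow hr.le hgu.le, Real.inv_rpow hgu.le]
        have e2 : r ^ (n - 1) = r ^ ((n : ℝ) + s) * r ^ (-1 - s) := by
          rw [← Real.rpow_add hr, ← Real.rpow_natCast,
            Nat.cast_sub (Nat.one_le_iff_ne_zero.2 (NeZero.ne n))]
          congr 1
          push_cast
          ring
        rw [e2]
        have : 0 < r ^ ((n : ℝ) + s) := by positivity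
        field_simp
      · simpa using h
      · rw [mem_compl_iff, add_smul_mem_iff_le_radial hK hxK u hr.le]
        exact h
  rw [setLIntegral_congr_fun measurableSet_Ioi h1, lintegral_const_mul]
  swap
  · exact (Measurable.ennreal_ofReal (by fun_prop)).indicator measurableSet_Ioi
  congr 1
  rw [setLIntegral_indicator measurableSet_Ioi, Ioi_inter_Ioi, sup_eq_left.2 hρ.le]
  rw [← ofReal_integral_eq_lintegral_ofReal (integrableOn_Ioi_rpow_of_lt (by linarith) hρ)]
  · rw [integral_Ioi_rpow_of_lt (by linarith) hρ, halfChord_eq_radial hK hxK,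
      ENNReal.ofReal_rpow_of_pos hρ, ← ENNReal.ofReal_mul (by positivity)]
    congr 1
    rw [show -1 - s + 1 = -s by ring]
    field_simp
  · refine (ae_restrict_iff' measurableSet_Ioi).2 (Eventually.of_forall fun r hr => ?_)
    exact Real.rpow_nonneg (hρ.trans hr).le _

/-- The chord energy of `K`: the integral of `ℓ ^ (-s)` over all points of `K` and all directions,
where `ℓ` is the length of the chord through the point in the direction. -/
def chordEnergy (s : ℝ) (K L : Set (Eucl n)) : ℝ≥0∞ :=
  ∫⁻ u, (∫⁻ x in K, chordWeight s K x u) ∂(sphWeight s L)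

lemma fracPerimeter_eq [NeZero n] {s : ℝ} (hs0 : 0 < s) (hs1 : s < 1) (hK : IsConvexBody K)
    (hL : IsSymmConvexBody L) :
    fracPerimeter s K L = ENNReal.ofReal (1 / (s * (1 - s))) * chordEnergy s K L := by
  have h0 := symm_mem_nhds_zero hL
  have hKm := hK.2.1.measurableSet
  have := isFiniteMeasure_sphWeight (s := s) hL.1 h0
  have hint : (interior K : Set (Eucl n)) =ᵐ[volume] K :=
    (interior_ae_eq_of_null_frontier (hK.1.addHaar_frontier _))
  have hm : Measurable fun p : Eucl n × Sph n => halfChord K p.1 p.2 ^ (-s) :=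
    ((measurable_halfChord hKm).comp
      (measurable_fst.prodMk (measurable_subtype_coe.comp measurable_snd))).pow_const _
  have hmw : Measurable fun p : Sph n × Eucl n => chordWeight s K p.2 p.1 :=
    (measurable_chordWeight s hKm).comp
      (measurable_snd.prodMk (measurable_subtype_coe.comp measurable_fst))
  -- The boundary of a convex set is null, so `x` may be restricted to the interior while the inner
  -- integral is evaluated.
  rw [fracPerimeter, ← setLIntegral_congr hint,
    setLIntegral_congr_fun isOpen_interior.measurableSet
      (fun x hx => lintegral_kernel_compl hs0 hK hL hx),
    setLIntegral_congr hint, lintegral_const_mul _ hm.lintegral_prod_right',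
    lintegral_lintegral_swap hm.aemeasurable]
  simp only [lintegral_halfChord hs1 hK]
  rw [lintegral_const_mul _ hmw.lintegral_prod_right', ← mul_assoc,
    ← ENNReal.ofReal_mul (by positivity)]
  congr 2
  field_simp

lemma lineSet_smul {c : ℝ} (hc : 0 < c) (x u : Eucl n) :
    lineSet (c • K) (c • x) u = c • lineSet K x u := by
  ext b
  rw [Set.mem_smul_set_iff_inv_smul_mem₀ hc.ne', lineSet, lineSet, mem_ofPred_eq, mem_ofPred_eq,
    Set.mem_smul_set_iff_inv_smul_mem₀ hc.ne', smul_add, smul_smul, smul_smul,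
    inv_mul_cancel₀ hc.ne', one_smul, smul_eq_mul]

lemma chord_smul {c : ℝ} (hc : 0 < c) (x u : Eucl n) :
    chord (c • K) (c • x) u = ENNReal.ofReal c * chord K x u := by
  rw [chord, lineSet_smul hc, Measure.addHaar_smul]
  simp [chord, abs_of_pos hc]

lemma chordWeight_smul {s c : ℝ} (hc : 0 < c) (x u : Eucl n) :
    chordWeight s (c • K) (c • x) u = ENNReal.ofReal (c ^ (-s)) * chordWeight s K x u := by
  have h1 : ENNReal.ofReal c ^ (-s) = ENNReal.ofReal (c ^ (-s)) := ENNReal.ofReal_rpow_of_pos hc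
  have h2 : ENNReal.ofReal c ≠ 0 := by simpa using hc
  -- A negative power is multiplicative except on products of `0` and `⊤`, excluded since the
  -- dilation factor is neither.
  rw [chordWeight, chord_smul hc, chordWeight, ← h1, ENNReal.mul_rpow_eq_ite, if_neg]
  rintro ⟨h | h, -⟩
  · exact absurd h.1 h2
  · exact absurd h.1 ENNReal.ofReal_ne_top

/-- Volume contributes the exponent `n`, the weight `ℓ^(-s)` the exponent `-s`. -/
lemma chordEnergy_smul {s c : ℝ} (hc : 0 < c) (hK : IsConvexBody K) :
    chordEnergy s (c • K) L = ENNReal.ofReal (c ^ ((n : ℝ) - s)) * chordEnergy s K L := by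
  have hKm := hK.2.1.measurableSet
  have hmw : Measurable fun p : Sph n × Eucl n => chordWeight s K p.2 p.1 :=
    (measurable_chordWeight s hKm).comp
      (measurable_snd.prodMk (measurable_subtype_coe.comp measurable_fst))
  rw [chordEnergy, chordEnergy, ← lintegral_const_mul _ hmw.lintegral_prod_right']
  refine lintegral_congr fun u => ?_
  rw [setLIntegral_smul hc]
  simp only [chordWeight_smul hc]
  rw [lintegral_const_mul _ (measurable_chordWeight_left s hKm _), ← mul_assoc,
    ← ENNReal.ofReal_mul (by positivity)]
  congr 2
  rw [sub_eq_add_neg, Real.rpow_add hc, Real.rpow_natCast]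

lemma fracPerimeter_smul [NeZero n] {s c : ℝ} (hs0 : 0 < s) (hs1 : s < 1) (hc : 0 < c)
    (hK : IsConvexBody K) (hL : IsSymmConvexBody L) :
    fracPerimeter s (c • K) L = ENNReal.ofReal (c ^ ((n : ℝ) - s)) * fracPerimeter s K L := by
  rw [fracPerimeter_eq hs0 hs1 (isConvexBody_smul hK hc.ne') hL, fracPerimeter_eq hs0 hs1 hK hL,
    chordEnergy_smul hc hK]
  ring

lemma chordEnergy_translate {s : ℝ} (a : Eucl n) :
    chordEnergy s (a +ᵥ K) L = chordEnergy s K L := by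
  rw [chordEnergy, chordEnergy]
  refine lintegral_congr fun u => ?_
  have he : MeasurableEmbedding fun x : Eucl n => a + x :=
    (Homeomorph.addLeft a).measurableEmbedding
  have hp := measurePreserving_add_left (volume : Measure (Eucl n)) a
  rw [← hp.setLIntegral_comp_preimage_emb he]
  have h1 : (fun x : Eucl n => a + x) ⁻¹' (a +ᵥ K) = K := by
    ext x
    simp [Set.mem_vadd_set_iff_neg_vadd_mem]
  rw [h1]
  refine lintegral_congr fun x => ?_
  have h2 : lineSet (a +ᵥ K) (a + x) u = lineSet K x u := by
    ext b
    simp [lineSet, Set.mem_vadd_set_iff_neg_vadd_mem, add_assoc]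
  rw [chordWeight, chordWeight, chord, chord, h2]

lemma fracPerimeter_translate [NeZero n] {s : ℝ} (hs0 : 0 < s) (hs1 : s < 1)
    (hK : IsConvexBody K) (hL : IsSymmConvexBody L) (a : Eucl n) :
    fracPerimeter s (a +ᵥ K) L = fracPerimeter s K L := by
  rw [fracPerimeter_eq hs0 hs1 (isConvexBody_translate hK a) hL, fracPerimeter_eq hs0 hs1 hK hL,
    chordEnergy_translate]

lemma chordEnergy_ne_top {s : ℝ} (hs0 : 0 < s) (hs1 : s < 1) (hK : IsConvexBody K)
    (hL : IsSymmConvexBody L) : chordEnergy s K L ≠ ⊤ := by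
  have := isFiniteMeasure_sphWeight (s := s) hL.1 (symm_mem_nhds_zero hL)
  obtain ⟨R, hR0, hR⟩ := exists_norm_le hK
  refine ne_top_of_le_ne_top ?_ (lintegral_mono fun u => lintegral_chordWeight_le hs0 hs1 hK hR u)
  rw [lintegral_const]
  refine ENNReal.mul_ne_top (ENNReal.mul_ne_top ?_ measure_closedBall_lt_top.ne)
    (measure_ne_top _ _)
  rw [ENNReal.ofReal_rpow_of_pos (by positivity)]
  exact ENNReal.ofReal_ne_top

end Perimeter

/-! ### Area in a hyperplane as the volume of a cone. -/

section FlatCone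

variable {n : ℕ}

lemma lintegral_Ioc_pow [NeZero n] {b : ℝ} (hb : 0 ≤ b) :
    ∫⁻ r in Ioc 0 b, ENNReal.ofReal (r ^ (n - 1)) = ENNReal.ofReal (b ^ n / n) := by
  have hn : n - 1 + 1 = n := Nat.sub_add_cancel (Nat.one_le_iff_ne_zero.2 (NeZero.ne n))
  rw [← ofReal_integral_eq_lintegral_ofReal]
  · rw [← intervalIntegral.integral_of_le hb, integral_pow, hn]
    congr 1
    rw [zero_pow (NeZero.ne n), sub_zero, ← Nat.cast_add_one, hn]
  · exact ((continuous_pow _).intervalIntegrable 0 b).1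
  · exact (ae_restrict_iff' measurableSet_Ioc).2 (Eventually.of_forall fun r hr => pow_nonneg hr.1.le _)

lemma hausdorff_smul {c : ℝ} (hc : 0 < c) (A : Set (Eucl n)) (d : ℕ) :
    (Measure.euclideanHausdorffMeasure d : Measure (Eucl n)) (c • A) =
      ENNReal.ofReal (c ^ d) * (Measure.euclideanHausdorffMeasure d : Measure (Eucl n)) A := by
  rw [Measure.euclideanHausdorffMeasure_smul₀ _ hc.ne', ENNReal.smul_def, smul_eq_mul]
  congr 1
  rw [Real.nnnorm_of_nonneg hc.le, ENNReal.ofReal, Real.toNNReal_pow hc.le,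
    Real.toNNReal_of_nonneg hc.le]

/-- The volume of the cone over a subset of a hyperplane. -/
lemma hausdorff_hyperplane [NeZero n] {c : Eucl n} (hc : c ≠ 0) {A : Set (Eucl n)}
    (hA : MeasurableSet A) :
    (Measure.euclideanHausdorffMeasure (n - 1) : Measure (Eucl n)) ({y | inner ℝ c y = 1} ∩ A) =
      ENNReal.ofReal (n * ‖c‖) *
        volume {x : Eucl n | 0 < inner ℝ c x ∧ inner ℝ c x ≤ 1 ∧ (inner ℝ c x)⁻¹ • x ∈ A} := by
  have hn0 : (0 : ℝ) < n := by exact_mod_cast Nat.pos_of_ne_zero (NeZero.ne n)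
  have hcp : 0 < ‖c‖ := norm_pos_iff.2 hc
  set t := {x : Eucl n | 0 < inner ℝ c x ∧ inner ℝ c x ≤ 1 ∧ (inner ℝ c x)⁻¹ • x ∈ A} with ht
  set B := {y : Eucl n | inner ℝ c y = 1} ∩ A with hB
  have hic : Measurable fun x : Eucl n => inner ℝ c x := Continuous.measurable (by fun_prop)
  have htm : MeasurableSet t := by
    refine (measurableSet_lt measurable_const hic).inter
      ((measurableSet_le hic measurable_const).inter ?_)
    exact (hic.inv.smul measurable_id) hA
  set e : Eucl n := ‖c‖⁻¹ • c with he
  have hen : ‖e‖ = 1 := by simp [he, norm_smul, hcp.ne']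
  have he0 : e ≠ 0 := by rw [← norm_pos_iff, hen]; exact one_pos
  have h1 := EuclideanGeometry.euclideanHausdorffMeasure_eq_lintegral (0 : Eucl n) he0 htm
  rw [InnerProductSpace.euclideanHausdorffMeasure_eq_volume, finrank_euclideanSpace_fin] at h1
  have hce : inner ℝ c e = ‖c‖ := by
    rw [he, inner_smul_right, real_inner_self_eq_norm_sq]; field_simp
  -- The slice at height `x` is the base scaled by `‖c‖ * x`, for heights up to `‖c‖⁻¹`, the
  -- distance of the hyperplane from the origin. Integrating `x^(n-1)` gives the factor `1/n` in the
  -- volume of a cone.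
  have hslice : ∀ x : ℝ, (Measure.euclideanHausdorffMeasure (n - 1) : Measure (Eucl n))
      (t ∩ (AffineSubspace.mk' (x • e +ᵥ (0 : Eucl n)) (ℝ ∙ e)ᗮ : AffineSubspace ℝ (Eucl n))) =
      (Ioc 0 ‖c‖⁻¹).indicator (fun x => ENNReal.ofReal (‖c‖ ^ (n - 1)) *
        (Measure.euclideanHausdorffMeasure (n - 1) : Measure (Eucl n)) B *
          ENNReal.ofReal (x ^ (n - 1))) x := by
    intro x
    have hmem : ∀ y : Eucl n, y ∈ (AffineSubspace.mk' (x • e +ᵥ (0 : Eucl n)) (ℝ ∙ e)ᗮ :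
        AffineSubspace ℝ (Eucl n)) ↔ inner ℝ c y = ‖c‖ * x := by
      intro y
      rw [AffineSubspace.mem_mk', Submodule.mem_orthogonal_singleton_iff_inner_right]
      simp only [vadd_eq_add, add_zero, vsub_eq_sub, inner_sub_right, inner_smul_right]
      rw [real_inner_self_eq_norm_sq, hen, he, inner_smul_left]
      simp only [RCLike.conj_to_real]
      constructor
      · intro h
        field_simp at h
        linarith
      · intro h
        rw [h]; field_simp; ring
    by_cases hx : x ∈ Ioc 0 ‖c‖⁻¹
    · rw [indicator_of_mem hx]
      have hx1 : 0 < ‖c‖ * x := mul_pos hcp hx.1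
      have hx2 : ‖c‖ * x ≤ 1 := by
        have := mul_le_mul_of_nonneg_left hx.2 hcp.le
        rwa [mul_inv_cancel₀ hcp.ne'] at this
      have hset : t ∩ (AffineSubspace.mk' (x • e +ᵥ (0 : Eucl n)) (ℝ ∙ e)ᗮ :
          AffineSubspace ℝ (Eucl n)) = (‖c‖ * x) • B := by
        ext y
        rw [mem_inter_iff, SetLike.mem_coe, hmem, Set.mem_smul_set_iff_inv_smul_mem₀ hx1.ne']
        simp only [ht, hB, mem_ofPred_eq, mem_inter_iff, inner_smul_right]
        constructor
        · rintro ⟨⟨h1, h2, h3⟩, h4⟩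
          rw [h4] at h3 ⊢
          exact ⟨inv_mul_cancel₀ hx1.ne', h3⟩
        · rintro ⟨h1, h2⟩
          have h4 : inner ℝ c y = ‖c‖ * x := by
            rwa [inv_mul_eq_one₀ hx1.ne', eq_comm] at h1
          rw [h4]
          exact ⟨⟨hx1, hx2, h2⟩, rfl⟩
      rw [hset, hausdorff_smul hx1, mul_pow, ENNReal.ofReal_mul (by positivity)]
      ring
    · rw [indicator_of_notMem hx]
      convert measure_empty (μ := (Measure.euclideanHausdorffMeasure (n - 1) : Measure (Eucl n)))
      rw [eq_empty_iff_forall_notMem]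
      rintro y ⟨hy1, hy2⟩
      rw [SetLike.mem_coe, hmem] at hy2
      have h1 := hy1.1
      have h2 := hy1.2.1
      rw [hy2] at h1 h2
      refine hx ⟨pos_of_mul_pos_right h1 hcp.le, ?_⟩
      rw [← one_div, le_div_iff₀ hcp]; linarith
  simp_rw [hslice] at h1
  rw [lintegral_indicator measurableSet_Ioc, lintegral_const_mul _ (by fun_prop),
    lintegral_Ioc_pow (by positivity)] at h1
  have : ‖e‖ₑ = 1 := by rw [enorm_eq_iff_norm_eq (F := ℝ) (y := (1 : ℝ)) |>.2 (by simpa using hen)]; simp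
  rw [this, one_mul] at h1
  rw [h1]
  rw [mul_comm (ENNReal.ofReal (‖c‖ ^ (n - 1))), mul_assoc, ← ENNReal.ofReal_mul (by positivity),
    mul_left_comm, ← ENNReal.ofReal_mul (by positivity)]
  have hn : n - 1 + 1 = n := Nat.sub_add_cancel (Nat.one_le_iff_ne_zero.2 (NeZero.ne n))
  have : (n * ‖c‖ * (‖c‖ ^ (n - 1) * (‖c‖⁻¹ ^ n / n)) : ℝ) = 1 := by
    have h2 : ‖c‖ ^ n = ‖c‖ * ‖c‖ ^ (n - 1) := by rw [← pow_succ', hn]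
    rw [inv_pow, h2]
    field_simp
  rw [this]
  simp

end FlatCone

/-! ### Boundary pieces with almost constant normal. -/

section Pieces

variable {n : ℕ} {K : Set (Eucl n)}

/-- Radial projection to the boundary of `K`. -/
def radialProj (K : Set (Eucl n)) (x : Eucl n) : Eucl n := (gauge K x)⁻¹ • x

lemma measurable_radialProj (hK : IsConvexBody K) (h0 : K ∈ 𝓝 0) : Measurable (radialProj K) :=
  (continuous_gauge hK.1 h0).measurable.inv.smul measurable_id

lemma radialProj_smul {r : ℝ} (hr : 0 < r) (x : Eucl n) :
    radialProj K (r • x) = radialProj K x := by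
  rw [radialProj, radialProj, gauge_smul_pos _ hr.le, smul_smul]
  congr 1
  field_simp

lemma radialProj_mem_frontier (hK : IsConvexBody K) (h0 : K ∈ 𝓝 0) {x : Eucl n} (hx : x ≠ 0) :
    radialProj K x ∈ frontier K := inv_gauge_smul_mem_frontier hK h0 hx

lemma radialProj_of_mem_frontier (hK : IsConvexBody K) (h0 : K ∈ 𝓝 0) {z : Eucl n}
    (hz : z ∈ frontier K) : radialProj K z = z := by
  rw [radialProj, (mem_frontier_iff_gauge hK h0).1 hz, inv_one, one_smul]

lemma gauge_smul_radialProj (hK : IsConvexBody K) (h0 : K ∈ 𝓝 0) {x : Eucl n} (hx : x ≠ 0) :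
    gauge K x • radialProj K x = x := by
  rw [radialProj, smul_smul, mul_inv_cancel₀ (gauge_pos_of_ne hK h0 hx).ne', one_smul]

/-- The part of `K` that projects radially to `B`. -/
def coneOver (K B : Set (Eucl n)) : Set (Eucl n) := {x | x ∈ K ∧ radialProj K x ∈ B}

lemma measurableSet_coneOver (hK : IsConvexBody K) (h0 : K ∈ 𝓝 0) {B : Set (Eucl n)}
    (hB : MeasurableSet B) : MeasurableSet (coneOver K B) :=
  hK.2.1.measurableSet.inter (measurable_radialProj hK h0 hB)

/-- The boundary points of `K` that have a normalized outer normal within `ε` of `c`. -/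
def nearNormal (K : Set (Eucl n)) (c : Eucl n) (ε : ℝ) : Set (Eucl n) :=
  {z | z ∈ frontier K ∧ ∃ a ∈ normals K z, ‖a - c‖ ≤ ε}

/-- It is the projection of a compact set of pairs (normal, point). Only the resulting measurability
is used. -/
lemma isClosed_nearNormal (hK : IsConvexBody K) (c : Eucl n) (ε : ℝ) :
    IsClosed (nearNormal K c ε) := by
  have hfr : IsCompact (frontier K) := hK.2.1.of_isClosed_subset isClosed_frontier
    (frontier_subset_body hK)
  have h1 : IsCompact (closedBall c ε ×ˢ frontier K) := (isCompact_closedBall c ε).prod hfr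
  have h2 : IsClosed {p : Eucl n × Eucl n | inner ℝ p.1 p.2 = 1 ∧ ∀ x ∈ K, inner ℝ p.1 x ≤ 1} := by
    have h3 : IsClosed {p : Eucl n × Eucl n | inner ℝ p.1 p.2 = 1} :=
      isClosed_eq (by fun_prop) continuous_const
    refine h3.inter (s₂ := {p : Eucl n × Eucl n | ∀ x ∈ K, inner ℝ p.1 x ≤ 1}) ?_
    have : {p : Eucl n × Eucl n | ∀ x ∈ K, inner ℝ p.1 x ≤ 1} =
        ⋂ x ∈ K, {p : Eucl n × Eucl n | inner ℝ p.1 x ≤ 1} := by ext; simp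
    rw [this]
    exact isClosed_biInter fun x _ => isClosed_le (by fun_prop) continuous_const
  have h3 : nearNormal K c ε = Prod.snd '' ((closedBall c ε ×ˢ frontier K) ∩
      {p : Eucl n × Eucl n | inner ℝ p.1 p.2 = 1 ∧ ∀ x ∈ K, inner ℝ p.1 x ≤ 1}) := by
    ext z
    simp only [nearNormal, normals, mem_ofPred_eq, mem_image, mem_inter_iff, mem_prod,
      mem_closedBall, dist_eq_norm, Prod.exists, exists_eq_right]
    constructor
    · rintro ⟨h, a, h', h''⟩; exact ⟨a, ⟨h'', h⟩, h'⟩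
    · rintro ⟨a, ⟨h'', h⟩, h'⟩; exact ⟨h, a, h', h''⟩
  rw [h3]
  exact ((h1.inter_right h2).image continuous_snd).isClosed

/-- A normal at `z` is nonnegative on `z - z'` and one at `z'` is nonpositive there. Both are within
`ε` of `c`, so the piece is a graph of small slope over a hyperplane orthogonal to `c`. -/
lemma nearNormal_inner_sub {c : Eucl n} {ε : ℝ} {z z' : Eucl n} (hK : IsConvexBody K)
    (hz : z ∈ nearNormal K c ε) (hz' : z' ∈ nearNormal K c ε) :
    |inner ℝ c (z - z')| ≤ ε * ‖z - z'‖ := by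
  obtain ⟨hzf, a, ha, hac⟩ := hz
  obtain ⟨hzf', a', ha', hac'⟩ := hz'
  have h1 : inner ℝ a (z - z') ≥ 0 := by
    rw [inner_sub_right, ha.1]; linarith [ha.2 z' (frontier_subset_body hK hzf')]
  have h2 : inner ℝ a' (z - z') ≤ 0 := by
    rw [inner_sub_right, ha'.1]; linarith [ha'.2 z (frontier_subset_body hK hzf)]
  have h3 : |inner ℝ (a - c) (z - z')| ≤ ε * ‖z - z'‖ :=
    (abs_real_inner_le_norm _ _).trans (by gcongr)
  have h4 : |inner ℝ (a' - c) (z - z')| ≤ ε * ‖z - z'‖ :=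
    (abs_real_inner_le_norm _ _).trans (by gcongr)
  rw [inner_sub_left, abs_le] at h3 h4
  rw [abs_le]
  constructor <;> linarith [h3.1, h3.2, h4.1, h4.2]

lemma nearNormal_inner_sub_one {c : Eucl n} {ε R : ℝ} {z : Eucl n} (hε : 0 ≤ ε)
    (hR : ∀ x ∈ K, ‖x‖ ≤ R) (hK : IsConvexBody K)
    (hz : z ∈ nearNormal K c ε) : |inner ℝ c z - 1| ≤ ε * R := by
  obtain ⟨hzf, a, ha, hac⟩ := hz
  have h3 : |inner ℝ (a - c) z| ≤ ε * R :=
    (abs_real_inner_le_norm _ _).trans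
      (mul_le_mul hac (hR z (frontier_subset_body hK hzf)) (norm_nonneg _) hε)
  rwa [inner_sub_left, ha.1, abs_sub_comm] at h3

variable {c : Eucl n} {ε R : ℝ} {B : Set (Eucl n)}

/-- Flattening moves `z` along its ray to the hyperplane `c · y = 1`. The error is a multiple of
`z'` with coefficient controlled by `c · (z - z')`, which is small on a piece. So flattening is
nearly an isometry; the next two lemmas draw the Lipschitz bounds in both directions. -/
lemma flatten_sub_le (hε : 0 ≤ ε) (hR : ∀ x ∈ K, ‖x‖ ≤ R) (hη : ε * R < 1)
    (hK : IsConvexBody K) {z z' : Eucl n}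
    (hz : z ∈ nearNormal K c ε) (hz' : z' ∈ nearNormal K c ε) :
    ‖((inner ℝ c z)⁻¹ • z - (inner ℝ c z')⁻¹ • z') - (inner ℝ c z)⁻¹ • (z - z')‖ ≤
      ε * R / (1 - ε * R) ^ 2 * ‖z - z'‖ := by
  have h1 := abs_le.1 (nearNormal_inner_sub_one hε hR hK hz)
  have h2 := abs_le.1 (nearNormal_inner_sub_one hε hR hK hz')
  have h3 := nearNormal_inner_sub hK hz hz'
  set p := inner ℝ c z with hp
  set q := inner ℝ c z' with hq
  have hη' : 0 < 1 - ε * R := by linarith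
  have hp0 : 1 - ε * R ≤ p := by linarith [h1.1]
  have hq0 : 1 - ε * R ≤ q := by linarith [h2.1]
  have hp1 : 0 < p := hη'.trans_le hp0
  have hq1 : 0 < q := hη'.trans_le hq0
  have hz'R := hR z' (frontier_subset_body hK hz'.1)
  rw [inner_sub_right, ← hp, ← hq] at h3
  have e1 : (p⁻¹ • z - q⁻¹ • z') - p⁻¹ • (z - z') = (-(p - q) / (p * q)) • z' := by
    rw [smul_sub]
    have : (-(p - q) / (p * q)) = p⁻¹ - q⁻¹ := by field_simp; ring
    rw [this, sub_smul]; abel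
  rw [e1, norm_smul, Real.norm_eq_abs, abs_div, abs_neg, abs_of_pos (mul_pos hp1 hq1)]
  have h4 : (1 - ε * R) ^ 2 ≤ p * q := by
    rw [sq]; exact mul_le_mul hp0 hq0 hη'.le hp1.le
  calc |p - q| / (p * q) * ‖z'‖ ≤ (ε * ‖z - z'‖) / (1 - ε * R) ^ 2 * R := by
        gcongr
    _ = ε * R / (1 - ε * R) ^ 2 * ‖z - z'‖ := by ring

lemma flatten_dist_le (hε : 0 ≤ ε) (hR : ∀ x ∈ K, ‖x‖ ≤ R) (hη : ε * R < 1)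
    (hK : IsConvexBody K) {z z' : Eucl n}
    (hz : z ∈ nearNormal K c ε) (hz' : z' ∈ nearNormal K c ε) :
    ‖(inner ℝ c z)⁻¹ • z - (inner ℝ c z')⁻¹ • z'‖ ≤ ((1 - ε * R) ^ 2)⁻¹ * ‖z - z'‖ := by
  have h := flatten_sub_le hε hR hη hK hz hz'
  have h1 := abs_le.1 (nearNormal_inner_sub_one hε hR hK hz)
  set p := inner ℝ c z with hp
  have hη' : 0 < 1 - ε * R := by linarith
  have hp0 : 1 - ε * R ≤ p := by linarith [h1.1]
  have hp1 : 0 < p := hη'.trans_le hp0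
  have h2 : ‖p⁻¹ • (z - z')‖ ≤ (1 - ε * R)⁻¹ * ‖z - z'‖ := by
    rw [norm_smul, norm_inv, Real.norm_eq_abs, abs_of_pos hp1]
    gcongr
  have h3 := norm_le_norm_sub_add ((p⁻¹ • z - (inner ℝ c z')⁻¹ • z')) (p⁻¹ • (z - z'))
  refine h3.trans ((add_le_add h h2).trans (le_of_eq ?_))
  field_simp
  ring

lemma flatten_dist_ge (hε : 0 ≤ ε) (hR : ∀ x ∈ K, ‖x‖ ≤ R) (hη : ε * R < 1)
    (hK : IsConvexBody K) {z z' : Eucl n}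
    (hz : z ∈ nearNormal K c ε) (hz' : z' ∈ nearNormal K c ε) :
    ((1 + ε * R)⁻¹ - ε * R / (1 - ε * R) ^ 2) * ‖z - z'‖ ≤
      ‖(inner ℝ c z)⁻¹ • z - (inner ℝ c z')⁻¹ • z'‖ := by
  have h := flatten_sub_le hε hR hη hK hz hz'
  have h1 := abs_le.1 (nearNormal_inner_sub_one hε hR hK hz)
  set p := inner ℝ c z with hp
  have hη' : 0 < 1 - ε * R := by linarith
  have hp0 : 1 - ε * R ≤ p := by linarith [h1.1]
  have hp2 : p ≤ 1 + ε * R := by linarith [h1.2]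
  have hp1 : 0 < p := hη'.trans_le hp0
  have h2 : (1 + ε * R)⁻¹ * ‖z - z'‖ ≤ ‖p⁻¹ • (z - z')‖ := by
    rw [norm_smul, norm_inv, Real.norm_eq_abs, abs_of_pos hp1]
    gcongr
  have h3 := norm_le_norm_sub_add (p⁻¹ • (z - z')) ((p⁻¹ • z - (inner ℝ c z')⁻¹ • z'))
  rw [norm_sub_rev] at h
  linarith

lemma hausdorff_image_le {L : ℝ} (hL : 0 ≤ L) {f : Eucl n → Eucl n} {A : Set (Eucl n)} {d : ℕ}
    (h : ∀ x ∈ A, ∀ y ∈ A, ‖f x - f y‖ ≤ L * ‖x - y‖) :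
    (Measure.euclideanHausdorffMeasure d : Measure (Eucl n)) (f '' A) ≤
      ENNReal.ofReal (L ^ d) * (Measure.euclideanHausdorffMeasure d : Measure (Eucl n)) A := by
  have hl : LipschitzOnWith L.toNNReal f A := by
    refine LipschitzOnWith.of_dist_le_mul fun x hx y hy => ?_
    rw [dist_eq_norm, dist_eq_norm, Real.coe_toNNReal _ hL]
    exact h x hx y hy
  have h1 := hl.hausdorffMeasure_image_le (d := (d : ℝ)) (by positivity)
  rw [Measure.euclideanHausdorffMeasure_def, Measure.smul_apply, Measure.smul_apply,
    ENNReal.smul_def, ENNReal.smul_def, smul_eq_mul, smul_eq_mul, mul_left_comm]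
  gcongr
  refine h1.trans (le_of_eq ?_)
  congr 1
  rw [ENNReal.rpow_natCast, ← ENNReal.ofReal, ENNReal.ofReal_pow hL]

/-- The cone with apex the origin, over the radial projection of `B` to the hyperplane `c · x = 1`.
-/
def flatCone (K : Set (Eucl n)) (c : Eucl n) (B : Set (Eucl n)) : Set (Eucl n) :=
  {x | 0 < inner ℝ c x ∧ inner ℝ c x ≤ 1 ∧ radialProj K x ∈ B}

lemma hausdorff_flatten [NeZero n] (hK : IsConvexBody K) (h0 : K ∈ 𝓝 0) (hc : c ≠ 0)
    (hB : MeasurableSet B) :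
    (Measure.euclideanHausdorffMeasure (n - 1) : Measure (Eucl n))
      ({y | inner ℝ c y = 1} ∩ radialProj K ⁻¹' B) =
    ENNReal.ofReal (n * ‖c‖) * volume (flatCone K c B) := by
  rw [hausdorff_hyperplane hc (measurable_radialProj hK h0 hB)]
  congr 2
  ext x
  simp only [flatCone, mem_ofPred_eq, mem_preimage]
  refine and_congr_right fun h => ?_
  rw [radialProj_smul (inv_pos.2 h)]

lemma flatten_image (hε : 0 ≤ ε) (hR : ∀ x ∈ K, ‖x‖ ≤ R) (hη : ε * R < 1)
    (hK : IsConvexBody K) (h0 : K ∈ 𝓝 0) (hB : B ⊆ nearNormal K c ε) :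
    (fun z => (inner ℝ c z)⁻¹ • z) '' B = {y | inner ℝ c y = 1} ∩ radialProj K ⁻¹' B := by
  have hpos : ∀ z ∈ B, 0 < inner ℝ c z := fun z hz => by
    have := abs_le.1 (nearNormal_inner_sub_one hε hR hK (hB hz))
    linarith [this.1]
  ext y
  simp only [mem_image, mem_inter_iff, mem_ofPred_eq, mem_preimage]
  constructor
  · rintro ⟨z, hz, rfl⟩
    rw [radialProj_smul (inv_pos.2 (hpos z hz)), radialProj_of_mem_frontier hK h0 (hB hz).1,
      inner_smul_right]
    exact ⟨inv_mul_cancel₀ (hpos z hz).ne', hz⟩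
  · rintro ⟨hy, hz⟩
    refine ⟨_, hz, ?_⟩
    have hy0 : y ≠ 0 := by rintro rfl; simp at hy
    have hg := gauge_pos_of_ne hK h0 hy0
    rw [radialProj, inner_smul_right, hy, mul_one, inv_inv, smul_smul, mul_inv_cancel₀ hg.ne',
      one_smul]

lemma ne_zero_of_radialProj_mem_frontier (h0 : K ∈ 𝓝 0) {x : Eucl n}
    (hx : radialProj K x ∈ frontier K) : x ≠ 0 := by
  rintro rfl
  exact ne_zero_of_mem_frontier h0 hx (by simp [radialProj])

/-- Over the piece, `c · x` is the gauge of `x` times a factor within `ε * R` of `1`. The conditions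
`c · x ≤ 1` and gauge at most `1` therefore differ only by a dilation close to the identity. -/
lemma volume_flatCone_le (hε : 0 ≤ ε) (hR : ∀ x ∈ K, ‖x‖ ≤ R) (hη : ε * R < 1)
    (hK : IsConvexBody K) (h0 : K ∈ 𝓝 0) (hB : B ⊆ nearNormal K c ε) :
    volume (flatCone K c B) ≤ ENNReal.ofReal ((1 - ε * R)⁻¹ ^ n) * volume (coneOver K B) := by
  have hη' : 0 < 1 - ε * R := by linarith
  have : flatCone K c B ⊆ (1 - ε * R)⁻¹ • coneOver K B := by
    rintro x ⟨h1, h2, h3⟩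
    rw [Set.mem_smul_set_iff_inv_smul_mem₀ (inv_pos.2 hη').ne', inv_inv]
    have hx0 := ne_zero_of_radialProj_mem_frontier h0 (hB h3).1
    have hg := gauge_pos_of_ne hK h0 hx0
    refine ⟨?_, by rwa [radialProj_smul hη']⟩
    rw [mem_iff_gauge_le_one hK h0, gauge_smul_pos _ hη'.le]
    have h4 := (abs_le.1 (nearNormal_inner_sub_one hε hR hK (hB h3))).1
    have h5 : inner ℝ c x = gauge K x * inner ℝ c (radialProj K x) := by
      rw [← inner_smul_right, gauge_smul_radialProj hK h0 hx0]
    nlinarith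
  refine (measure_mono this).trans (le_of_eq ?_)
  rw [Measure.addHaar_smul, finrank_euclideanSpace_fin, abs_of_pos (by positivity)]

lemma volume_coneOver_le (hε : 0 ≤ ε) (hR0 : 0 ≤ R) (hR : ∀ x ∈ K, ‖x‖ ≤ R) (hη : ε * R < 1)
    (hK : IsConvexBody K) (h0 : K ∈ 𝓝 0) (hB : B ⊆ nearNormal K c ε) :
    volume (coneOver K B) ≤ ENNReal.ofReal ((1 + ε * R) ^ n) * volume (flatCone K c B) := by
  have hη' : 0 < 1 + ε * R := by positivity
  have : coneOver K B ⊆ (1 + ε * R) • flatCone K c B := by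
    rintro x ⟨h1, h3⟩
    rw [Set.mem_smul_set_iff_inv_smul_mem₀ hη'.ne']
    have hx0 := ne_zero_of_radialProj_mem_frontier h0 (hB h3).1
    have hg := gauge_pos_of_ne hK h0 hx0
    rw [mem_iff_gauge_le_one hK h0] at h1
    have h4 := (abs_le.1 (nearNormal_inner_sub_one hε hR hK (hB h3)))
    have h5 : inner ℝ c x = gauge K x * inner ℝ c (radialProj K x) := by
      rw [← inner_smul_right, gauge_smul_radialProj hK h0 hx0]
    have h6 : 0 < inner ℝ c (radialProj K x) := by linarith [h4.1]
    have h7 : 0 < inner ℝ c x := by rw [h5]; positivity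
    refine ⟨?_, ?_, by rwa [radialProj_smul (inv_pos.2 hη')]⟩
    · rw [inner_smul_right]; positivity
    · rw [inner_smul_right, inv_mul_le_iff₀ hη', mul_one, h5]
      nlinarith [h4.2]
  refine (measure_mono this).trans (le_of_eq ?_)
  rw [Measure.addHaar_smul, finrank_euclideanSpace_fin, abs_of_pos (by positivity)]

/-- The density with respect to volume whose integral over cones is boundary area. -/
def coneDensity (K : Set (Eucl n)) (x : Eucl n) : ℝ≥0∞ := ENNReal.ofReal (n * ‖grad K x‖)

lemma measurable_coneDensity (K : Set (Eucl n)) : Measurable (coneDensity K) :=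
  ((measurable_grad K).norm.const_mul _).ennreal_ofReal

lemma norm_grad_sub_le (hK : IsConvexBody K) (h0 : K ∈ 𝓝 0) (hB : B ⊆ nearNormal K c ε)
    {x : Eucl n} (hx : x ∈ coneOver K B) (hd : DifferentiableAt ℝ (gauge K) x) :
    ‖grad K x - c‖ ≤ ε ∧ grad K x ∈ normals K (radialProj K x) := by
  have hx0 := ne_zero_of_radialProj_mem_frontier h0 (hB hx.2).1
  have hg := gauge_pos_of_ne hK h0 hx0
  obtain ⟨hf, a, ha, hac⟩ := hB hx.2
  have h1 : a = grad K (radialProj K x) := eq_grad_of_mem_normals hK h0 hf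
    ((differentiableAt_gauge_smul_iff (inv_pos.2 hg)).2 hd) ha
  rw [radialProj, grad_smul _ (inv_pos.2 hg)] at h1
  rw [← h1]
  exact ⟨hac, ha⟩

lemma mul_volume_coneOver_le (hε : 0 ≤ ε) (hR0 : 0 < R) (hR : ∀ x ∈ K, ‖x‖ ≤ R)
    (hK : IsConvexBody K) (h0 : K ∈ 𝓝 0) (hBm : MeasurableSet B) (hB : B ⊆ nearNormal K c ε) :
    ENNReal.ofReal (n * ‖c‖) * volume (coneOver K B) ≤
      ENNReal.ofReal (1 + ε * R) * ∫⁻ x in coneOver K B, coneDensity K x := by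
  have hCm := measurableSet_coneOver hK h0 hBm
  rw [← setLIntegral_const, ← lintegral_const_mul _ (measurable_coneDensity K)]
  refine lintegral_mono_ae ((ae_restrict_iff' hCm).2 ?_)
  filter_upwards [ae_differentiableAt_gauge hK h0] with x hd hx
  obtain ⟨h1, h2⟩ := norm_grad_sub_le hK h0 hB hx hd
  have h3 := inv_le_norm_normals hR0 (hR _ (frontier_subset_body hK (hB hx.2).1)) h2
  rw [coneDensity, ← ENNReal.ofReal_mul (by positivity)]
  refine ENNReal.ofReal_le_ofReal ?_
  have h4 : ‖c‖ ≤ ‖grad K x‖ + ε := by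
    have := norm_le_norm_add_norm_sub' c (grad K x)
    rw [norm_sub_rev] at this
    linarith
  -- The lower bound `R⁻¹` on the gradient absorbs the additive error `ε` into a multiplicative one.
  have h5 : ε ≤ ε * R * ‖grad K x‖ := by
    have h := mul_le_mul_of_nonneg_left h3 (mul_nonneg hε hR0.le)
    rwa [mul_assoc, mul_inv_cancel₀ hR0.ne', mul_one] at h
  calc (n : ℝ) * ‖c‖ ≤ n * (‖grad K x‖ + ε * R * ‖grad K x‖) := by gcongr; linarith
    _ = (1 + ε * R) * (n * ‖grad K x‖) := by ring

lemma lintegral_coneDensity_le (hε : 0 ≤ ε) (hR0 : 0 < R) (hR : ∀ x ∈ K, ‖x‖ ≤ R) (hη : ε * R < 1)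
    (hK : IsConvexBody K) (h0 : K ∈ 𝓝 0) (hBm : MeasurableSet B) (hB : B ⊆ nearNormal K c ε) :
    ∫⁻ x in coneOver K B, coneDensity K x ≤
      ENNReal.ofReal (1 - ε * R)⁻¹ * (ENNReal.ofReal (n * ‖c‖) * volume (coneOver K B)) := by
  have hη' : 0 < 1 - ε * R := by linarith
  have hCm := measurableSet_coneOver hK h0 hBm
  rw [← setLIntegral_const, ← lintegral_const_mul _ measurable_const]
  refine lintegral_mono_ae ((ae_restrict_iff' hCm).2 ?_)
  filter_upwards [ae_differentiableAt_gauge hK h0] with x hd hx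
  obtain ⟨h1, h2⟩ := norm_grad_sub_le hK h0 hB hx hd
  have h3 := inv_le_norm_normals hR0 (hR _ (frontier_subset_body hK (hB hx.2).1)) h2
  rw [coneDensity, ← ENNReal.ofReal_mul (by positivity)]
  refine ENNReal.ofReal_le_ofReal ?_
  have h4 : ‖grad K x‖ ≤ ‖c‖ + ε := by
    have := norm_le_norm_add_norm_sub' (grad K x) c
    linarith
  have h5 : ε ≤ ε * R * ‖grad K x‖ := by
    have h := mul_le_mul_of_nonneg_left h3 (mul_nonneg hε hR0.le)
    rwa [mul_assoc, mul_inv_cancel₀ hR0.ne', mul_one] at h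
  rw [inv_mul_eq_div, le_div_iff₀ hη']
  calc (n : ℝ) * ‖grad K x‖ * (1 - ε * R) = n * (‖grad K x‖ - ε * R * ‖grad K x‖) := by ring
    _ ≤ n * ‖c‖ := by gcongr; linarith

end Pieces

/-! ### Surface area of a convex body in polar coordinates. -/

section AreaFormula

variable {n : ℕ} {K : Set (Eucl n)}

/-- A distortion factor that tends to `1` as `η → 0`. -/
def distortion (n : ℕ) (η : ℝ) : ℝ :=
  (((1 + η)⁻¹ - η / (1 - η) ^ 2)⁻¹ ^ (n - 1) * ((1 - η)⁻¹ ^ n * (1 + η))) +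
    (1 - η)⁻¹ * ((1 + η) ^ n * ((1 - η) ^ 2)⁻¹ ^ (n - 1)) - 1

lemma tendsto_distortion (n : ℕ) : Tendsto (distortion n) (𝓝 0) (𝓝 1) := by
  have : ContinuousAt (distortion n) 0 := by
    unfold distortion
    have h1 : (1 + (0 : ℝ)) ≠ 0 := by norm_num
    have h2 : (1 - (0 : ℝ)) ≠ 0 := by norm_num
    have h3 : (1 - (0 : ℝ)) ^ 2 ≠ 0 := by norm_num
    have h4 : ((1 + (0 : ℝ))⁻¹ - 0 / (1 - 0) ^ 2) ≠ 0 := by norm_num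
    fun_prop (disch := assumption)
  have h0 : distortion n 0 = 1 := by simp [distortion]
  rw [ContinuousAt, h0] at this
  exact this

variable {c : Eucl n} {ε R : ℝ} {B : Set (Eucl n)}

/-- Each of the two products is at least `1`, so each is at most their sum minus `1`; one factor can
thus serve both inequalities for a piece. -/
lemma distortion_bounds {η : ℝ} (hη0 : 0 ≤ η) (hη : η < 1)
    (hκ : 0 < (1 + η)⁻¹ - η / (1 - η) ^ 2) :
    ((1 + η)⁻¹ - η / (1 - η) ^ 2)⁻¹ ^ (n - 1) * ((1 - η)⁻¹ ^ n * (1 + η)) ≤ distortion n η ∧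
    (1 - η)⁻¹ * ((1 + η) ^ n * ((1 - η) ^ 2)⁻¹ ^ (n - 1)) ≤ distortion n η := by
  have h1 : 0 < 1 - η := by linarith
  have hκ1 : (1 + η)⁻¹ - η / (1 - η) ^ 2 ≤ 1 := by
    have h2 : (1 + η)⁻¹ ≤ 1 := inv_le_one_of_one_le₀ (by linarith)
    have h3 : 0 ≤ η / (1 - η) ^ 2 := by positivity
    linarith
  have a1 : 1 ≤ ((1 + η)⁻¹ - η / (1 - η) ^ 2)⁻¹ ^ (n - 1) := one_le_pow₀ ((one_le_inv₀ hκ).2 hκ1)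
  have a2 : 1 ≤ (1 - η)⁻¹ := (one_le_inv₀ h1).2 (by linarith)
  have a3 : 1 ≤ (1 - η)⁻¹ ^ n := one_le_pow₀ a2
  have a4 : (1 : ℝ) ≤ 1 + η := by linarith
  have a5 : 1 ≤ (1 + η) ^ n := one_le_pow₀ a4
  have a6 : 1 ≤ ((1 - η) ^ 2)⁻¹ ^ (n - 1) :=
    one_le_pow₀ ((one_le_inv₀ (by positivity)).2 (pow_le_one₀ h1.le (by linarith)))
  have b1 := one_le_mul_of_one_le_of_one_le a1 (one_le_mul_of_one_le_of_one_le a3 a4)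
  have b2 := one_le_mul_of_one_le_of_one_le a2 (one_le_mul_of_one_le_of_one_le a5 a6)
  unfold distortion
  constructor <;> linarith

/-- Chains four comparisons: the piece with its flattening, the flattening with its flat cone, that
cone with the part of `K` over the piece, and the constant density `n * ‖c‖` with the true one. -/
lemma hausdorff_piece [NeZero n] (hε : 0 ≤ ε) (hR0 : 0 < R) (hR : ∀ x ∈ K, ‖x‖ ≤ R)
    (hη : ε * R < 1) (hκ : 0 < (1 + ε * R)⁻¹ - ε * R / (1 - ε * R) ^ 2)
    (hK : IsConvexBody K) (h0 : K ∈ 𝓝 0) (hBm : MeasurableSet B) (hB : B ⊆ nearNormal K c ε) :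
    (Measure.euclideanHausdorffMeasure (n - 1) : Measure (Eucl n)) B ≤
        ENNReal.ofReal (distortion n (ε * R)) * ∫⁻ x in coneOver K B, coneDensity K x ∧
    ∫⁻ x in coneOver K B, coneDensity K x ≤ ENNReal.ofReal (distortion n (ε * R)) *
      (Measure.euclideanHausdorffMeasure (n - 1) : Measure (Eucl n)) B := by
  rcases B.eq_empty_or_nonempty with rfl | ⟨z₀, hz₀⟩
  · simp [coneOver]
  have hη0 : 0 ≤ ε * R := by positivity
  have hη' : 0 < 1 - ε * R := by linarith
  have hc : c ≠ 0 := by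
    rintro rfl
    have := abs_le.1 (nearNormal_inner_sub_one hε hR hK (hB hz₀))
    rw [inner_zero_left] at this
    linarith [this.1]
  obtain ⟨d1, d2⟩ := distortion_bounds (n := n) hη0 hη hκ
  set H := (Measure.euclideanHausdorffMeasure (n - 1) : Measure (Eucl n)) with hH
  set κ := (1 + ε * R)⁻¹ - ε * R / (1 - ε * R) ^ 2 with hκd
  set f : Eucl n → Eucl n := fun z => (inner ℝ c z)⁻¹ • z with hf
  have hpos : ∀ z ∈ B, 0 < inner ℝ c z := fun z hz => by
    have := abs_le.1 (nearNormal_inner_sub_one hε hR hK (hB hz))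
    linarith [this.1]
  have hfl : H (f '' B) = ENNReal.ofReal (n * ‖c‖) * volume (flatCone K c B) := by
    rw [hf, flatten_image hε hR hη hK h0 hB, hH, hausdorff_flatten hK h0 hc hBm]
  -- Radial projection inverts the flattening, so the lower distance bound for the latter is a
  -- Lipschitz bound for the former.
  have himg : radialProj K '' (f '' B) = B := by
    rw [image_image]
    have : ∀ z ∈ B, radialProj K (f z) = z := fun z hz => by
      rw [hf]
      simp only
      rw [radialProj_smul (inv_pos.2 (hpos z hz)), radialProj_of_mem_frontier hK h0 (hB hz).1]
    rw [image_congr this, image_id']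
  have e1 : H B ≤ ENNReal.ofReal (κ⁻¹ ^ (n - 1)) * H (f '' B) := by
    nth_rewrite 1 [← himg]
    refine hausdorff_image_le (by positivity) ?_
    rintro _ ⟨z, hz, rfl⟩ _ ⟨z', hz', rfl⟩
    have := flatten_dist_ge hε hR hη hK (hB hz) (hB hz')
    simp only [hf]
    rw [radialProj_smul (inv_pos.2 (hpos z hz)), radialProj_of_mem_frontier hK h0 (hB hz).1,
      radialProj_smul (inv_pos.2 (hpos z' hz')), radialProj_of_mem_frontier hK h0 (hB hz').1,
      inv_mul_eq_div, le_div_iff₀ hκ, mul_comm]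
    exact this
  have e2 : H (f '' B) ≤ ENNReal.ofReal (((1 - ε * R) ^ 2)⁻¹ ^ (n - 1)) * H B :=
    hausdorff_image_le (by positivity) fun z hz z' hz' =>
      flatten_dist_le hε hR hη hK (hB hz) (hB hz')
  have e3 := volume_flatCone_le hε hR hη hK h0 hB
  have e4 := volume_coneOver_le hε hR0.le hR hη hK h0 hB
  have e5 := mul_volume_coneOver_le hε hR0 hR hK h0 hBm hB
  have e6 := lintegral_coneDensity_le hε hR0 hR hη hK h0 hBm hB
  constructor
  · calc H B ≤ ENNReal.ofReal (κ⁻¹ ^ (n - 1)) * H (f '' B) := e1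
      _ = ENNReal.ofReal (κ⁻¹ ^ (n - 1)) * (ENNReal.ofReal (n * ‖c‖) * volume (flatCone K c B)) := by
        rw [hfl]
      _ ≤ ENNReal.ofReal (κ⁻¹ ^ (n - 1)) * (ENNReal.ofReal (n * ‖c‖) *
          (ENNReal.ofReal ((1 - ε * R)⁻¹ ^ n) * volume (coneOver K B))) := by gcongr
      _ = ENNReal.ofReal (κ⁻¹ ^ (n - 1)) * (ENNReal.ofReal ((1 - ε * R)⁻¹ ^ n) *
          (ENNReal.ofReal (n * ‖c‖) * volume (coneOver K B))) := by ring
      _ ≤ ENNReal.ofReal (κ⁻¹ ^ (n - 1)) * (ENNReal.ofReal ((1 - ε * R)⁻¹ ^ n) *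
          (ENNReal.ofReal (1 + ε * R) * ∫⁻ x in coneOver K B, coneDensity K x)) := by gcongr
      _ = ENNReal.ofReal (κ⁻¹ ^ (n - 1) * ((1 - ε * R)⁻¹ ^ n * (1 + ε * R))) *
          ∫⁻ x in coneOver K B, coneDensity K x := by
        rw [ENNReal.ofReal_mul (by positivity), ENNReal.ofReal_mul (by positivity)]; ring
      _ ≤ _ := by gcongr
  · calc ∫⁻ x in coneOver K B, coneDensity K x
        ≤ ENNReal.ofReal (1 - ε * R)⁻¹ * (ENNReal.ofReal (n * ‖c‖) * volume (coneOver K B)) := e6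
      _ ≤ ENNReal.ofReal (1 - ε * R)⁻¹ * (ENNReal.ofReal (n * ‖c‖) *
          (ENNReal.ofReal ((1 + ε * R) ^ n) * volume (flatCone K c B))) := by gcongr
      _ = ENNReal.ofReal (1 - ε * R)⁻¹ * (ENNReal.ofReal ((1 + ε * R) ^ n) * H (f '' B)) := by
        rw [hfl]; ring
      _ ≤ ENNReal.ofReal (1 - ε * R)⁻¹ * (ENNReal.ofReal ((1 + ε * R) ^ n) *
          (ENNReal.ofReal (((1 - ε * R) ^ 2)⁻¹ ^ (n - 1)) * H B)) := by gcongr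
      _ = ENNReal.ofReal ((1 - ε * R)⁻¹ * ((1 + ε * R) ^ n * ((1 - ε * R) ^ 2)⁻¹ ^ (n - 1))) *
          H B := by
        rw [ENNReal.ofReal_mul (by positivity), ENNReal.ofReal_mul (by positivity)]; ring
      _ ≤ _ := by gcongr

/-- The measure on the boundary of `K` obtained by integrating `coneDensity` over cones. -/
def coneMeasure (K : Set (Eucl n)) : Measure (Eucl n) :=
  ((volume.restrict K).withDensity (coneDensity K)).map (radialProj K)

lemma coneMeasure_apply (hK : IsConvexBody K) (h0 : K ∈ 𝓝 0) (hB : MeasurableSet B) :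
    coneMeasure K B = ∫⁻ x in coneOver K B, coneDensity K x := by
  have hm := measurable_radialProj hK h0
  rw [coneMeasure, Measure.map_apply hm hB, withDensity_apply _ (hm hB),
    Measure.restrict_restrict (hm hB), inter_comm]
  rfl

lemma measure_le_of_pieces {α : Type*} [MeasurableSpace α] {μ ν : Measure α} {C : ℝ≥0∞}
    {D : ℕ → Set α} (hD : ∀ k, MeasurableSet (D k)) {B : Set α} (hB : MeasurableSet B)
    (hBD : B ⊆ ⋃ k, D k) (h : ∀ A, MeasurableSet A → (∃ k, A ⊆ D k) → A ⊆ B → μ A ≤ C * ν A) :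
    μ B ≤ C * ν B := by
  have hm : ∀ k, MeasurableSet (B ∩ disjointed D k) := fun k => hB.inter (.disjointed hD k)
  have hdis : Pairwise (Function.onFun Disjoint fun k => B ∩ disjointed D k) :=
    fun i j hij => ((disjoint_disjointed D) hij).mono inter_subset_right inter_subset_right
  have hU : B = ⋃ k, B ∩ disjointed D k := by
    rw [← inter_iUnion, iUnion_disjointed, inter_eq_left.2 hBD]
  rw [hU, measure_iUnion hdis hm, measure_iUnion hdis hm, ← ENNReal.tsum_mul_left]
  exact ENNReal.tsum_le_tsum fun k => h _ (hm k)
    ⟨k, inter_subset_right.trans (disjointed_subset D k)⟩ inter_subset_left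

lemma hausdorff_eq_coneMeasure [NeZero n] (hK : IsConvexBody K) (h0 : K ∈ 𝓝 0)
    (hBm : MeasurableSet B) (hB : B ⊆ frontier K) :
    (Measure.euclideanHausdorffMeasure (n - 1) : Measure (Eucl n)) B = coneMeasure K B := by
  set H := (Measure.euclideanHausdorffMeasure (n - 1) : Measure (Eucl n)) with hH
  obtain ⟨R, hR0, hR⟩ := exists_norm_le hK
  have key : ∀ᶠ ε in 𝓝[>] (0 : ℝ), H B ≤ ENNReal.ofReal (distortion n (ε * R)) * coneMeasure K B ∧
      coneMeasure K B ≤ ENNReal.ofReal (distortion n (ε * R)) * H B := by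
    have hc : Tendsto (fun ε : ℝ => ε * R) (𝓝[>] 0) (𝓝 0) := by
      have : Tendsto (fun ε : ℝ => ε * R) (𝓝 0) (𝓝 (0 * R)) := tendsto_id.mul_const R
      rw [zero_mul] at this
      exact this.mono_left nhdsWithin_le_nhds
    have h1 : ∀ᶠ η in 𝓝 (0 : ℝ), η < 1 := eventually_lt_nhds one_pos
    have h2 : ∀ᶠ η in 𝓝 (0 : ℝ), 0 < (1 + η)⁻¹ - η / (1 - η) ^ 2 := by
      have hc : ContinuousAt (fun η : ℝ => (1 + η)⁻¹ - η / (1 - η) ^ 2) 0 := by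
        have h1 : (1 + (0 : ℝ)) ≠ 0 := by norm_num
        have h3 : (1 - (0 : ℝ)) ^ 2 ≠ 0 := by norm_num
        fun_prop (disch := assumption)
      exact hc.eventually_const_lt (by norm_num)
    filter_upwards [hc.eventually h1, hc.eventually h2, self_mem_nhdsWithin] with ε hη hκ hε
    rw [mem_Ioi] at hε
    -- Countably many candidate normals, dense in the space, suffice to cover the boundary by pieces
    -- at every scale `ε`. Letting `ε → 0` sends the distortion to `1`.
    set D : ℕ → Set (Eucl n) := fun k => nearNormal K (TopologicalSpace.denseSeq (Eucl n) k) ε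
    have hD : ∀ k, MeasurableSet (D k) := fun k => (isClosed_nearNormal hK _ _).measurableSet
    have hBD : B ⊆ ⋃ k, D k := by
      intro z hz
      obtain ⟨a, ha⟩ := normals_nonempty hK h0 (hB hz)
      obtain ⟨k, hk⟩ := (TopologicalSpace.denseRange_denseSeq (Eucl n)).exists_dist_lt a hε
      refine mem_iUnion.2 ⟨k, hB hz, a, ha, ?_⟩
      rw [← dist_eq_norm]
      exact hk.le
    have hp : ∀ A, MeasurableSet A → (∃ k, A ⊆ D k) → A ⊆ B →
        H A ≤ ENNReal.ofReal (distortion n (ε * R)) * coneMeasure K A ∧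
        coneMeasure K A ≤ ENNReal.ofReal (distortion n (ε * R)) * H A := by
      rintro A hA ⟨k, hk⟩ -
      rw [coneMeasure_apply hK h0 hA]
      exact hausdorff_piece hε.le hR0 hR hη hκ hK h0 hA hk
    exact ⟨measure_le_of_pieces hD hBm hBD fun A h1 h2 h3 => (hp A h1 h2 h3).1,
      measure_le_of_pieces hD hBm hBD fun A h1 h2 h3 => (hp A h1 h2 h3).2⟩
  have hlim : Tendsto (fun ε : ℝ => ENNReal.ofReal (distortion n (ε * R))) (𝓝[>] 0) (𝓝 1) := by
    have hc : Tendsto (fun ε : ℝ => ε * R) (𝓝[>] 0) (𝓝 0) := by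
      have : Tendsto (fun ε : ℝ => ε * R) (𝓝 0) (𝓝 (0 * R)) := tendsto_id.mul_const R
      rw [zero_mul] at this
      exact this.mono_left nhdsWithin_le_nhds
    have := ENNReal.tendsto_ofReal ((tendsto_distortion n).comp hc)
    rwa [ENNReal.ofReal_one] at this
  have hlim2 : ∀ b : ℝ≥0∞, Tendsto (fun ε : ℝ => ENNReal.ofReal (distortion n (ε * R)) * b)
      (𝓝[>] 0) (𝓝 b) := by
    intro b
    have := ENNReal.Tendsto.mul_const (b := b) hlim (Or.inl one_ne_zero)
    rwa [one_mul] at this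
  exact le_antisymm (ge_of_tendsto (hlim2 _) (key.mono fun _ h => h.1))
    (ge_of_tendsto (hlim2 _) (key.mono fun _ h => h.2))

lemma hausdorff_restrict_frontier [NeZero n] (hK : IsConvexBody K) (h0 : K ∈ 𝓝 0) :
    (Measure.euclideanHausdorffMeasure (n - 1) : Measure (Eucl n)).restrict (frontier K) =
      coneMeasure K := by
  have hfm : MeasurableSet (frontier K) := isClosed_frontier.measurableSet
  ext A hA
  rw [Measure.restrict_apply hA, hausdorff_eq_coneMeasure hK h0 (hA.inter hfm) inter_subset_right,
    coneMeasure_apply hK h0 (hA.inter hfm), coneMeasure_apply hK h0 hA]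
  refine setLIntegral_congr ?_
  have hz : ∀ᵐ x : Eucl n, x ≠ 0 := by
    rw [ae_iff]; simp
  filter_upwards [hz] with x hx
  have h1 : (x ∈ coneOver K (A ∩ frontier K)) = (x ∈ coneOver K A) := by
    simp only [coneOver, mem_ofPred_eq, mem_inter_iff, radialProj_mem_frontier hK h0 hx, and_true]
  exact h1

/-- Integration of a function that is constant on rays over a convex body, in polar coordinates. -/
lemma lintegral_body_of_homogeneous [NeZero n] (hK : IsConvexBody K) (h0 : K ∈ 𝓝 0)
    {F : Eucl n → ℝ≥0∞} (hF : Measurable F) (hom : ∀ (r : ℝ) (x : Eucl n), 0 < r → F (r • x) = F x) :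
    ∫⁻ x in K, F x = ∫⁻ u : Sph n, ENNReal.ofReal (radial K 0 u ^ n / n) * F (u : Eucl n)
      ∂((volume : Measure (Eucl n)).toSphere) := by
  have hKm := hK.2.1.measurableSet
  rw [← lintegral_indicator hKm, lintegral_polar (hF.indicator hKm)]
  refine lintegral_congr fun u => ?_
  have hρ := radial_nonneg hK (mem_of_mem_nhds h0) u
  have h1 : ∀ r ∈ Ioi (0 : ℝ), ENNReal.ofReal (r ^ (n - 1)) * K.indicator F (r • (u : Eucl n)) =
      (Ioc 0 (radial K 0 u)).indicator
        (fun r => F (u : Eucl n) * ENNReal.ofReal (r ^ (n - 1))) r := by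
    intro r hr
    have h2 := add_smul_mem_iff_le_radial hK (mem_of_mem_nhds h0) u (le_of_lt hr)
    rw [zero_add] at h2
    by_cases h : r ≤ radial K 0 u
    · rw [indicator_of_mem (h2.2 h), indicator_of_mem (show r ∈ Ioc 0 (radial K 0 u) from ⟨hr, h⟩),
        hom r _ hr, mul_comm]
    · rw [indicator_of_notMem (fun h' => h (h2.1 h')),
        indicator_of_notMem (fun h' => h h'.2), mul_zero]
  rw [setLIntegral_congr_fun measurableSet_Ioi h1, setLIntegral_indicator measurableSet_Ioc,
    inter_eq_left.2 (fun r hr => hr.1), lintegral_const_mul _ (by fun_prop), lintegral_Ioc_pow hρ,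
    mul_comm]

/-- Integration over the boundary of a convex body, in polar coordinates. -/
lemma lintegral_frontier [NeZero n] (hK : IsConvexBody K) (h0 : K ∈ 𝓝 0)
    {G : Eucl n → ℝ≥0∞} (hG : Measurable G) :
    ∫⁻ z in frontier K, G z ∂(Measure.euclideanHausdorffMeasure (n - 1) : Measure (Eucl n)) =
      ∫⁻ u : Sph n, ENNReal.ofReal (radial K 0 u ^ n * ‖grad K (u : Eucl n)‖) *
        G (radialProj K (u : Eucl n)) ∂((volume : Measure (Eucl n)).toSphere) := by
  have hn0 : (0 : ℝ) < n := by exact_mod_cast Nat.pos_of_ne_zero (NeZero.ne n)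
  have hm := measurable_radialProj hK h0
  rw [hausdorff_restrict_frontier hK h0, coneMeasure, lintegral_map hG hm,
    lintegral_withDensity_eq_lintegral_mul _ (measurable_coneDensity K)
      (g := fun x => G (radialProj K x)) (hG.comp hm),
    lintegral_body_of_homogeneous hK h0 (F := coneDensity K * fun x => G (radialProj K x))
      ((measurable_coneDensity K).mul (hG.comp hm))]
  · refine lintegral_congr fun u => ?_
    have hρ := radial_nonneg hK (mem_of_mem_nhds h0) u
    simp only [Pi.mul_apply, coneDensity]
    rw [← mul_assoc, ← ENNReal.ofReal_mul (by positivity)]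
    congr 2
    field_simp
  · intro r x hr
    simp only [Pi.mul_apply, coneDensity, grad_smul x hr, radialProj_smul hr x]

end AreaFormula

/-! ### The fractional area measure through the Gauss map. -/

section Regular

variable {n : ℕ} {K L : Set (Eucl n)}

lemma ae_sph_differentiableAt_gauge (hK : IsConvexBody K) (h0 : K ∈ 𝓝 0) :
    ∀ᵐ u : Sph n ∂(volume : Measure (Eucl n)).toSphere,
      DifferentiableAt ℝ (gauge K) (u : Eucl n) := by
  have hm : MeasurableSet {u : Sph n | ¬ DifferentiableAt ℝ (gauge K) (u : Eucl n)} :=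
    (measurableSet_of_differentiableAt ℝ (gauge K)).compl.preimage measurable_subtype_coe
  rw [ae_iff, Measure.toSphere_apply' _ hm]
  have hs : Ioo (0 : ℝ) 1 •
      ((↑) '' {u : Sph n | ¬ DifferentiableAt ℝ (gauge K) (u : Eucl n)} : Set (Eucl n)) ⊆
      {x | ¬ DifferentiableAt ℝ (gauge K) x} := by
    rintro _ ⟨r, hr, _, ⟨u, hu, rfl⟩, rfl⟩
    simp only [mem_ofPred_eq] at hu ⊢
    rwa [differentiableAt_gauge_smul_iff hr.1]
  rw [measure_mono_null hs (ae_iff.1 (ae_differentiableAt_gauge hK h0)), mul_zero]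

lemma grad_radialProj (hK : IsConvexBody K) (h0 : K ∈ 𝓝 0) (u : Sph n) :
    grad K (radialProj K u) = grad K (u : Eucl n) :=
  grad_smul _ (inv_pos.2 (gauge_pos_of_ne hK h0 (sph_ne_zero u)))

lemma differentiableAt_radialProj (hK : IsConvexBody K) (h0 : K ∈ 𝓝 0) {u : Sph n}
    (hd : DifferentiableAt ℝ (gauge K) (u : Eucl n)) :
    DifferentiableAt ℝ (gauge K) (radialProj K u) :=
  (differentiableAt_gauge_smul_iff (inv_pos.2 (gauge_pos_of_ne hK h0 (sph_ne_zero u)))).2 hd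

/-- The gauge equals `1` at `z` and has negative derivative along `w`, so it drops below `1`. -/
lemma exists_mem_interior_of_inner_neg (hK : IsConvexBody K) (h0 : K ∈ 𝓝 0) {z w : Eucl n}
    (hz : z ∈ frontier K) (hd : DifferentiableAt ℝ (gauge K) z) (hw : inner ℝ (grad K z) w < 0) :
    ∃ t : ℝ, 0 < t ∧ z + t • w ∈ interior K := by
  have hl : HasDerivAt (fun t : ℝ => gauge K (z + t • w)) (inner ℝ (grad K z) w) 0 := by
    rw [inner_grad]
    have h1 : HasDerivAt (fun t : ℝ => z + t • w) w 0 := by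
      simpa using ((hasDerivAt_id (0 : ℝ)).smul_const w).const_add z
    have h2 : HasFDerivAt (gauge K) (fderiv ℝ (gauge K) z) (z + (0 : ℝ) • w) := by
      simpa using hd.hasFDerivAt
    exact h2.comp_hasDerivAt 0 h1
  have h1 := hl.tendsto_slope_zero_right
  have h2 := (h1.eventually_lt_const hw).and self_mem_nhdsWithin
  obtain ⟨t, ht1, ht2⟩ := h2.exists
  refine ⟨t, ht2, ?_⟩
  rw [mem_interior_iff_gauge hK h0]
  simp only [zero_add, zero_smul, add_zero, (mem_frontier_iff_gauge hK h0).1 hz, smul_eq_mul] at ht1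
  rw [inv_mul_eq_div, div_neg_iff] at ht1
  rcases ht1 with h | h <;> linarith [h.1, h.2]

lemma notMem_of_inner_pos {z a w : Eucl n} (ha : a ∈ normals K z) (hw : 0 < inner ℝ a w) {t : ℝ}
    (ht : 0 < t) : z + t • w ∉ K := by
  intro h
  have := ha.2 _ h
  rw [inner_add_right, inner_smul_right, ha.1] at this
  nlinarith [mul_pos ht hw]

lemma halfChord_eq_zero_of_inner_pos {z a w : Eucl n} (ha : a ∈ normals K z)
    (hw : 0 < inner ℝ a w) : halfChord K z w = 0 := by
  have : {b : ℝ | 0 < b ∧ z + b • w ∈ K} = ∅ := by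
    rw [eq_empty_iff_forall_notMem]
    rintro b ⟨hb, h⟩
    exact notMem_of_inner_pos ha hw hb h
  rw [halfChord, this, measure_empty]

lemma chord_eq_halfChord_of_inner_neg {z a w : Eucl n} (ha : a ∈ normals K z)
    (hw : inner ℝ a w < 0) : chord K z w = halfChord K z w := by
  rw [chord, halfChord]
  refine measure_congr ?_
  have hz : ∀ᵐ b : ℝ, b ≠ 0 := by rw [ae_iff]; simp
  filter_upwards [hz] with b hb
  have : (b ∈ lineSet K z w) = (b ∈ {b : ℝ | 0 < b ∧ z + b • w ∈ K}) := by
    refine propext ⟨fun h => ⟨?_, h⟩, fun h => h.2⟩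
    by_contra hneg
    have hb' : 0 < -b := by
      rcases lt_or_gt_of_ne hb with h' | h'
      · linarith
      · exact absurd h' hneg
    have := notMem_of_inner_pos ha (w := -w) (by rw [inner_neg_right]; linarith) hb'
    rw [neg_smul_neg] at this
    exact this h
  exact this

lemma chord_neg (z w : Eucl n) : chord K z (-w) = chord K z w := by
  have : lineSet K z (-w) = -lineSet K z w := by
    ext b; simp [lineSet]
  rw [chord, this, Measure.measure_neg]
  rfl

/-- The integral of the chord weights over all directions at a point. -/
def dirEnergy (s : ℝ) (K L : Set (Eucl n)) (x : Eucl n) : ℝ≥0∞ :=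
  ∫⁻ u, chordWeight s K x u ∂(sphWeight s L)

lemma measurable_chordWeight_sph (s : ℝ) (hK : MeasurableSet K) :
    Measurable fun p : Eucl n × Sph n => chordWeight s K p.1 p.2 :=
  (measurable_chordWeight s hK).comp
    (measurable_fst.prodMk (measurable_subtype_coe.comp measurable_snd))

lemma measurable_dirEnergy {s : ℝ} (hK : IsConvexBody K) (hL : IsSymmConvexBody L) :
    Measurable (dirEnergy s K L) := by
  have := isFiniteMeasure_sphWeight (s := s) hL.1 (symm_mem_nhds_zero hL)
  exact (measurable_chordWeight_sph s hK.2.1.measurableSet).lintegral_prod_right'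

/-- At a smooth boundary point almost every direction either enters `K` or is opposite to one that
does. The dual mixed volume integrates over entering directions only, while `dirEnergy` counts each
chord from both ends; `L` is symmetric, whence the factor `1/2`. -/
lemma dualMixedVolume_eq_dirEnergy [NeZero n] {s : ℝ} (hK : IsConvexBody K)
    (h0 : K ∈ 𝓝 0) (hL : IsSymmConvexBody L) {z : Eucl n} (hz : z ∈ frontier K)
    (hd : DifferentiableAt ℝ (gauge K) z) :
    dualMixedVolume ((n : ℝ) + s) K L z = ENNReal.ofReal (1 / (2 * n)) * dirEnergy s K L z := by
  have hn0 : (0 : ℝ) < n := by exact_mod_cast Nat.pos_of_ne_zero (NeZero.ne n)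
  have hL0 := symm_mem_nhds_zero hL
  have hKm := hK.2.1.measurableSet
  have hzK := frontier_subset_body hK hz
  have ha := grad_mem_normals hK h0 hz hd
  set a := grad K z with had
  have ha0 : a ≠ 0 := ne_zero_of_mem_normals ha
  have hhm : Measurable fun u : Sph n => halfChord K z u :=
    (measurable_halfChord hKm).comp (measurable_const.prodMk measurable_subtype_coe)
  set S : Set (Sph n) := {u | 0 < radial K z u} with hS
  have hSe : S = {u : Sph n | 0 < halfChord K z u} := by
    ext u
    rw [hS, mem_ofPred_eq, mem_ofPred_eq, halfChord_eq_radial hK hzK, ENNReal.ofReal_pos]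
  have hSm : MeasurableSet S := by
    rw [hSe]; exact measurableSet_lt measurable_const hhm
  set g : Sph n → ℝ≥0∞ := S.indicator fun u => halfChord K z u ^ (-s) with hg
  have hgm : Measurable g := (hhm.pow_const _).indicator hSm
  have hSneg : ∀ u : Sph n, inner ℝ a (u : Eucl n) < 0 → u ∈ S := by
    intro u hu
    obtain ⟨t, ht, hti⟩ := exists_mem_interior_of_inner_neg hK h0 hz hd hu
    exact lt_of_lt_of_le ht ((add_smul_mem_iff_le_radial hK hzK u ht.le).1 (interior_subset hti))
  have hSpos : ∀ u : Sph n, 0 < inner ℝ a (u : Eucl n) → u ∉ S := by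
    intro u hu
    rw [hSe, mem_ofPred_eq, halfChord_eq_zero_of_inner_pos ha hu]
    exact lt_irrefl _
  have h1 : dirEnergy s K L z = ∫⁻ u, g u + g (-u) ∂(sphWeight s L) := by
    refine lintegral_congr_ae ?_
    filter_upwards [sphWeight_ae (s := s) (L := L) (ae_toSphere_inner_ne_zero ha0)] with u hu
    rw [real_inner_comm] at hu
    have hneg : inner ℝ a ((-u : Sph n) : Eucl n) = -inner ℝ a (u : Eucl n) := by
      rw [coe_neg_sphere, inner_neg_right]
    rcases lt_or_gt_of_ne hu with h | h
    · rw [hg, indicator_of_mem (hSneg u h), indicator_of_notMem (hSpos (-u) (by rw [hneg]; linarith)),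
        add_zero, chordWeight, chord_eq_halfChord_of_inner_neg ha h]
    · have h' : inner ℝ a ((-u : Sph n) : Eucl n) < 0 := by rw [hneg]; linarith
      rw [hg, indicator_of_notMem (hSpos u h), indicator_of_mem (hSneg (-u) h'), zero_add,
        chordWeight, ← chord_eq_halfChord_of_inner_neg ha h', coe_neg_sphere, chord_neg]
  have h2 : dirEnergy s K L z = 2 * ∫⁻ u, g u ∂(sphWeight s L) := by
    rw [h1, lintegral_add_left hgm, lintegral_sphWeight_neg hL hgm, two_mul]
  have h3 : ∫⁻ u in S, ENNReal.ofReal (radial K z u ^ ((n : ℝ) - ((n : ℝ) + s)) *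
      radial L 0 u ^ ((n : ℝ) + s)) ∂((volume : Measure (Eucl n)).toSphere) =
      ∫⁻ u, g u ∂(sphWeight s L) := by
    rw [lintegral_sphWeight hL.1 hL0 hgm, ← lintegral_indicator hSm]
    refine lintegral_congr fun u => ?_
    by_cases hu : u ∈ S
    · rw [hg, indicator_of_mem hu, indicator_of_mem hu, halfChord_eq_radial hK hzK,
        ENNReal.ofReal_rpow_of_pos hu, ← ENNReal.ofReal_mul
          (Real.rpow_nonneg (radial_nonneg hL.1 (mem_of_mem_nhds hL0) u) _), mul_comm]
      congr 3
      ring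
    · rw [hg, indicator_of_notMem hu, indicator_of_notMem hu, mul_zero]
  rw [dualMixedVolume, h3, h2, ← mul_assoc]
  congr 1
  rw [← ENNReal.ofReal_natCast, ← ENNReal.ofReal_inv_of_pos hn0,
    show (2 : ℝ≥0∞) = ENNReal.ofReal 2 by simp, ← ENNReal.ofReal_mul (by positivity)]
  congr 1
  field_simp

lemma mem_invGauss_iff (hK : IsConvexBody K) (h0 : K ∈ 𝓝 0) {z : Eucl n} (hz : z ∈ frontier K)
    (hd : DifferentiableAt ℝ (gauge K) z) (η : Set (Sph n)) :
    z ∈ invGauss K η ↔ ∃ v ∈ η, (v : Eucl n) = ‖grad K z‖⁻¹ • grad K z := by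
  have ha := grad_mem_normals hK h0 hz hd
  have ha0 := ne_zero_of_mem_normals ha
  have hap : 0 < ‖grad K z‖ := norm_pos_iff.2 ha0
  simp only [invGauss, mem_ofPred_eq, hz, true_and]
  refine exists_congr fun v => and_congr_right fun _ => ⟨fun h => ?_, fun h => ?_⟩
  · have hp := supp_pos hK h0 v
    have hv : (supp K v)⁻¹ • (v : Eucl n) ∈ normals K z := by
      refine ⟨?_, fun x hx => ?_⟩
      · rw [inner_smul_left, h]
        exact inv_mul_cancel₀ hp.ne'
      · rw [inner_smul_left, RCLike.conj_to_real, inv_mul_le_iff₀ hp, mul_one]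
        exact inner_le_supp hK v hx
    rw [← eq_grad_of_mem_normals hK h0 hz hd hv, norm_smul, norm_sph, mul_one, norm_inv, inv_inv,
      Real.norm_of_nonneg hp.le, smul_smul, mul_inv_cancel₀ hp.ne', one_smul]
  · refine le_antisymm (inner_le_supp hK v (frontier_subset_body hK hz)) (supp_le hK v fun x hx => ?_)
    rw [h, inner_smul_left, inner_smul_left, RCLike.conj_to_real, ha.1]
    gcongr
    exact ha.2 x hx

/-- The density of the fractional area measure in polar coordinates. -/
def areaDensity (s : ℝ) (K L : Set (Eucl n)) (u : Sph n) : ℝ≥0∞ :=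
  ENNReal.ofReal (radial K 0 u ^ n * ‖grad K (u : Eucl n)‖) *
    dirEnergy s K L (radialProj K (u : Eucl n))

lemma measurable_areaDensity {s : ℝ} (hK : IsConvexBody K) (h0 : K ∈ 𝓝 0)
    (hL : IsSymmConvexBody L) : Measurable (areaDensity s K L) := by
  refine Measurable.mul (Measurable.ennreal_ofReal ?_) ?_
  · exact ((continuous_radial_zero hK h0).measurable.pow_const _).mul
      ((measurable_grad K).comp measurable_subtype_coe).norm
  · exact (measurable_dirEnergy hK hL).comp
      ((measurable_radialProj hK h0).comp measurable_subtype_coe)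

/-- The push-forward of `areaDensity` under the Gauss map. -/
def areaMeasure (s : ℝ) (K L : Set (Eucl n)) : Measure (Sph n) :=
  (((volume : Measure (Eucl n)).toSphere).withDensity (areaDensity s K L)).map (unitNormal K)

/-- Differentiability of the gauge is constant on rays, so the cone over the singular boundary
points is null by Rademacher's theorem, and the area formula transfers this to the boundary. -/
lemma ae_frontier_differentiableAt [NeZero n] (hK : IsConvexBody K) (h0 : K ∈ 𝓝 0) :
    ∀ᵐ z ∂(Measure.euclideanHausdorffMeasure (n - 1) : Measure (Eucl n)),
      z ∈ frontier K → DifferentiableAt ℝ (gauge K) z := by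
  have hfm : MeasurableSet (frontier K) := isClosed_frontier.measurableSet
  have hdm := (measurableSet_of_differentiableAt ℝ (gauge K))
  have hm : MeasurableSet (frontier K ∩ {z | DifferentiableAt ℝ (gauge K) z}ᶜ) :=
    hfm.inter hdm.compl
  rw [ae_iff]
  have hs : {z | ¬(z ∈ frontier K → DifferentiableAt ℝ (gauge K) z)} =
      frontier K ∩ {z | DifferentiableAt ℝ (gauge K) z}ᶜ := by
    ext z; simp
  rw [hs, hausdorff_eq_coneMeasure hK h0 hm inter_subset_left, coneMeasure_apply hK h0 hm]
  refine setLIntegral_measure_zero _ _ ?_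
  refine measure_mono_null (fun x hx => ?_) (ae_iff.1 (ae_differentiableAt_gauge hK h0))
  have hx0 := ne_zero_of_radialProj_mem_frontier h0 hx.2.1
  have h1 := hx.2.2
  rw [mem_compl_iff, mem_ofPred_eq, radialProj,
    differentiableAt_gauge_smul_iff (inv_pos.2 (gauge_pos_of_ne hK h0 hx0))] at h1
  exact h1

lemma fracArea_eq [NeZero n] {s : ℝ} (hs0 : 0 < s) (hK : IsConvexBody K) (h0 : K ∈ 𝓝 0)
    (hL : IsSymmConvexBody L) {η : Set (Sph n)} (hη : MeasurableSet η) :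
    fracArea s K L η = ENNReal.ofReal (1 / (2 * s)) * areaMeasure s K L η := by
  have hn0 : (0 : ℝ) < n := by exact_mod_cast Nat.pos_of_ne_zero (NeZero.ne n)
  have hfm : MeasurableSet (frontier K) := isClosed_frontier.measurableSet
  have hηm : MeasurableSet ((↑) '' η : Set (Eucl n)) :=
    (MeasurableEmbedding.subtype_coe isClosed_sphere.measurableSet).measurableSet_image.2 hη
  set P : Set (Eucl n) := (fun z => ‖grad K z‖⁻¹ • grad K z) ⁻¹' ((↑) '' η) with hP
  have hPm : MeasurableSet P := ((measurable_grad K).norm.inv.smul (measurable_grad K)) hηm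
  have hae := ae_frontier_differentiableAt hK h0
  -- Away from the singular points the inverse Gauss image is the preimage of `η` under the
  -- normalized gradient, a set that is visibly measurable.
  have h1 : (invGauss K η : Set (Eucl n)) =ᵐ[Measure.euclideanHausdorffMeasure (n - 1)]
      (frontier K ∩ P : Set (Eucl n)) := by
    filter_upwards [hae] with z hz
    have : (z ∈ invGauss K η) = (z ∈ frontier K ∩ P) := by
      refine propext ⟨fun h => ⟨h.1, ?_⟩, fun h => ?_⟩
      · exact (mem_invGauss_iff hK h0 h.1 (hz h.1) η).1 h
      · exact (mem_invGauss_iff hK h0 h.1 (hz h.1) η).2 h.2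
    exact this
  have hWm := measurable_dirEnergy (s := s) hK hL
  have h2 : ∫⁻ z in frontier K ∩ P, dualMixedVolume ((n : ℝ) + s) K L z
      ∂(Measure.euclideanHausdorffMeasure (n - 1) : Measure (Eucl n)) =
      ENNReal.ofReal (1 / (2 * n)) * ∫⁻ z in frontier K, P.indicator (dirEnergy s K L) z
        ∂(Measure.euclideanHausdorffMeasure (n - 1) : Measure (Eucl n)) := by
    rw [setLIntegral_indicator hPm, inter_comm P, ← lintegral_const_mul _ hWm]
    refine setLIntegral_congr_fun_ae (hfm.inter hPm) ?_
    filter_upwards [hae] with z hz hz'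
    exact dualMixedVolume_eq_dirEnergy hK h0 hL hz'.1 (hz hz'.1)
  have hUm := measurable_unitNormal K hη
  rw [fracArea, setLIntegral_congr h1, h2, lintegral_frontier hK h0 (hWm.indicator hPm), areaMeasure,
    Measure.map_apply (measurable_unitNormal K) hη, withDensity_apply _ hUm,
    ← lintegral_indicator hUm, ← mul_assoc, ← ENNReal.ofReal_mul (by positivity)]
  congr 1
  · congr 1; field_simp
  · refine lintegral_congr_ae ?_
    filter_upwards [ae_sph_differentiableAt_gauge hK h0] with u hd
    have hz := radialProj_mem_frontier hK h0 (sph_ne_zero u)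
    have hg : grad K (u : Eucl n) ≠ 0 := by
      have := ne_zero_of_mem_normals
        (grad_mem_normals hK h0 hz (differentiableAt_radialProj hK h0 hd))
      rwa [grad_radialProj hK h0] at this
    have hiff : radialProj K (u : Eucl n) ∈ P ↔ u ∈ unitNormal K ⁻¹' η := by
      rw [hP, mem_preimage, mem_preimage, grad_radialProj hK h0]
      have hN : (unitNormal K u : Eucl n) = ‖grad K (u : Eucl n)‖⁻¹ • grad K (u : Eucl n) := by
        rw [unitNormal, dif_neg hg]
      rw [← hN]
      exact Subtype.val_injective.mem_set_image
    by_cases h : u ∈ unitNormal K ⁻¹' η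
    · rw [indicator_of_mem h, indicator_of_mem (hiff.2 h), areaDensity]
    · rw [indicator_of_notMem h, indicator_of_notMem (fun h' => h (hiff.1 h')), mul_zero]

end Regular

/-! ### Bounding the chord energy by its boundary values. -/

section BoundaryEnergy

variable {n : ℕ} {K L : Set (Eucl n)}

/-- The convex combination of two parallel chords lies in `K`, and its length is the same
combination of their lengths. -/
lemma min_chord_le (hK : IsConvexBody K) (x y : Eucl n) (u : Sph n) {p q : ℝ} (hp : 0 ≤ p)
    (hq : 0 ≤ q) (hpq : p + q = 1) :
    min (chord K x u) (chord K y u) ≤ chord K (p • x + q • y) u := by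
  rcases eq_empty_or_Icc (convex_lineSet hK.1 x u) (isCompact_lineSet hK.2.1 x u) with
    h1 | ⟨a, b, hab, h1⟩
  · exact (min_le_left _ _).trans (by rw [chord, h1, measure_empty]; exact zero_le)
  rcases eq_empty_or_Icc (convex_lineSet hK.1 y u) (isCompact_lineSet hK.2.1 y u) with
    h2 | ⟨c, d, hcd, h2⟩
  · exact (min_le_right _ _).trans (by rw [chord, h2, measure_empty]; exact zero_le)
  have hcomb : ∀ t t' : ℝ, t ∈ lineSet K x u → t' ∈ lineSet K y u →
      p * t + q * t' ∈ lineSet K (p • x + q • y) u := by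
    intro t t' ht ht'
    have := hK.1 ht ht' hp hq hpq
    rw [lineSet, mem_ofPred_eq]
    convert this using 1
    simp only [smul_add, add_smul, smul_smul]
    abel
  have e1 := hcomb a c (by rw [h1]; exact left_mem_Icc.2 hab) (by rw [h2]; exact left_mem_Icc.2 hcd)
  have e2 := hcomb b d (by rw [h1]; exact right_mem_Icc.2 hab)
    (by rw [h2]; exact right_mem_Icc.2 hcd)
  have hsub : Icc (p * a + q * c) (p * b + q * d) ⊆ lineSet K (p • x + q • y) u :=
    (convex_lineSet hK.1 _ _).ordConnected.out e1 e2
  refine le_trans ?_ (measure_mono hsub)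
  rw [Real.volume_Icc, chord, chord, h1, h2, Real.volume_Icc, Real.volume_Icc]
  rcases le_total (b - a) (d - c) with h | h
  · refine (min_le_left _ _).trans (ENNReal.ofReal_le_ofReal ?_)
    have hp' : p = 1 - q := by linarith
    subst hp'
    nlinarith
  · refine (min_le_right _ _).trans (ENNReal.ofReal_le_ofReal ?_)
    have hp' : q = 1 - p := by linarith
    subst hp'
    nlinarith

/-- A chord with one interior point loses at most its endpoints. This fails for chords inside the
boundary, hence the hypothesis. -/
lemma chord_interior (hK : IsConvexBody K) {z : Eucl n} {u : Sph n} {b₀ : ℝ}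
    (hb₀ : z + b₀ • (u : Eucl n) ∈ interior K) : chord (interior K) z u = chord K z u := by
  refine le_antisymm (chord_mono interior_subset _ _) ?_
  rcases eq_empty_or_Icc (convex_lineSet hK.1 z u) (isCompact_lineSet hK.2.1 z u) with
    h1 | ⟨a, b, hab, h1⟩
  · rw [chord, h1, measure_empty]; exact zero_le
  have hmem : b₀ ∈ Icc a b := by
    rw [← h1]
    exact interior_subset (s := K) hb₀
  have key : ∀ t t' : ℝ, t' ∈ Icc a b → t ∈ openSegment ℝ b₀ t' → t ∈ lineSet (interior K) z u := by
    rintro t t' ht' ⟨p, q, hp, hq, hpq, rfl⟩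
    have ht'' : z + t' • (u : Eucl n) ∈ K := by
      have : t' ∈ lineSet K z u := by rw [h1]; exact ht'
      exact this
    refine hK.1.openSegment_interior_self_subset_interior hb₀ ht'' ⟨p, q, hp, hq, hpq, ?_⟩
    have hz : z = p • z + q • z := by rw [← add_smul, hpq, one_smul]
    nth_rewrite 3 [hz]
    simp only [smul_add, add_smul, smul_smul, smul_eq_mul]
    abel
  have hsub : Ioo a b ⊆ lineSet (interior K) z u := by
    intro t ht
    rcases lt_trichotomy t b₀ with h | h | h
    · refine key t a (left_mem_Icc.2 hab) ?_
      rw [openSegment_symm, openSegment_eq_Ioo (ht.1.trans h)]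
      exact ⟨ht.1, h⟩
    · rw [h]; exact hb₀
    · refine key t b (right_mem_Icc.2 hab) ?_
      rw [openSegment_eq_Ioo (h.trans ht.2)]
      exact ⟨h, ht.2⟩
  refine le_trans ?_ (measure_mono hsub)
  rw [chord, h1, Real.volume_Icc, Real.volume_Ioo]

/-- A sequence increasing to `1`. -/
def ratioSeq (k : ℕ) : ℝ := 1 - 1 / ((k : ℝ) + 2)

lemma ratioSeq_pos (k : ℕ) : 0 < ratioSeq k := by
  have hk : (0 : ℝ) ≤ k := Nat.cast_nonneg k
  rw [ratioSeq, sub_pos, div_lt_one (by positivity)]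
  linarith

lemma ratioSeq_lt_one (k : ℕ) : ratioSeq k < 1 := by
  have : (0 : ℝ) < 1 / ((k : ℝ) + 2) := by positivity
  rw [ratioSeq]; linarith

lemma ratioSeq_mono : Monotone ratioSeq := by
  intro i j hij
  have : (i : ℝ) ≤ j := by exact_mod_cast hij
  rw [ratioSeq, ratioSeq]
  gcongr

lemma tendsto_ratioSeq : Tendsto ratioSeq atTop (𝓝 1) := by
  have h1 : Tendsto (fun k : ℕ => 1 / ((k : ℝ) + 2)) atTop (𝓝 0) := by
    refine Tendsto.div_atTop tendsto_const_nhds ?_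
    exact tendsto_atTop_add_const_right _ _ tendsto_natCast_atTop_atTop
  have := h1.const_sub 1
  rwa [sub_zero] at this

lemma tendsto_chord_ratioSeq (hK : IsConvexBody K) (h0 : K ∈ 𝓝 0) {z : Eucl n} {u : Sph n} {b₀ : ℝ}
    (hb₀ : z + b₀ • (u : Eucl n) ∈ interior K) :
    Tendsto (fun k => chord (ratioSeq k • K) z u) atTop (𝓝 (chord K z u)) := by
  have hmono : Monotone fun k => lineSet (ratioSeq k • K) z u := by
    intro i j hij b hb
    exact smul_subset_smul hK h0 (ratioSeq_pos i).le (ratioSeq_mono hij) hb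
  have h1 := tendsto_measure_iUnion_atTop (μ := (volume : Measure ℝ)) hmono
  have h2 : volume (⋃ k, lineSet (ratioSeq k • K) z u) = chord K z u := by
    apply le_antisymm
    · refine measure_mono (iUnion_subset fun k b hb => ?_)
      have := smul_subset_smul hK h0 (ratioSeq_pos k).le (ratioSeq_lt_one k).le hb
      rwa [one_smul] at this
    · rw [← chord_interior hK hb₀]
      refine measure_mono fun b hb => ?_
      have hg := (mem_interior_iff_gauge hK h0).1 hb
      obtain ⟨k, hk⟩ := ((tendsto_ratioSeq).eventually_const_lt hg).exists
      refine mem_iUnion.2 ⟨k, ?_⟩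
      have hp := ratioSeq_pos k
      rw [lineSet, mem_ofPred_eq, Set.mem_smul_set_iff_inv_smul_mem₀ hp.ne',
        mem_iff_gauge_le_one hK h0, gauge_smul_pos _ (inv_pos.2 hp).le, inv_mul_le_iff₀ hp, mul_one]
      exact hk.le
  rw [h2] at h1
  exact h1

/-- A bound, depending only on the boundary point `z`, for the weights of chords near `z`. -/
def shellWeight (s : ℝ) (K : Set (Eucl n)) (r : ℝ) (z u : Eucl n) : ℝ≥0∞ :=
  min (chordWeight s K 0 u + chordWeight s K z u)
    (ENNReal.ofReal (1 - s) * min (ENNReal.ofReal r * chord K z u) (chord (r • K) z u) ^ (-s))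

lemma shellWeight_le_left (s : ℝ) (K : Set (Eucl n)) (r : ℝ) (z u : Eucl n) :
    shellWeight s K r z u ≤ chordWeight s K 0 u + chordWeight s K z u := min_le_left _ _

lemma shellWeight_le_right (s : ℝ) (K : Set (Eucl n)) (r : ℝ) (z u : Eucl n) :
    shellWeight s K r z u ≤ ENNReal.ofReal (1 - s) *
      min (ENNReal.ofReal r * chord K z u) (chord (r • K) z u) ^ (-s) := min_le_right _ _

lemma measurable_comp_radialProj (hK : IsConvexBody K) (h0 : K ∈ 𝓝 0)
    {F : Eucl n → Eucl n → ℝ≥0∞} (hF : Measurable fun q : Eucl n × Eucl n => F q.1 q.2) :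
    Measurable fun p : Eucl n × Sph n => F (radialProj K p.1) p.2 :=
  hF.comp (((measurable_radialProj hK h0).comp measurable_fst).prodMk
    (measurable_subtype_coe.comp measurable_snd))

lemma measurable_chordWeight_right (s : ℝ) (hK : MeasurableSet K) (z : Eucl n) :
    Measurable fun u : Eucl n => chordWeight s K z u :=
  (measurable_chordWeight s hK).comp (measurable_const.prodMk measurable_id)

lemma measurable_uncurry_swap {F : Eucl n → Sph n → ℝ≥0∞}
    (hF : Measurable fun p : Eucl n × Sph n => F p.1 p.2) :
    Measurable fun p : Sph n × Eucl n => F p.2 p.1 := hF.comp measurable_swap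

lemma measurable_uncurry_left {F : Eucl n → Sph n → ℝ≥0∞}
    (hF : Measurable fun p : Eucl n × Sph n => F p.1 p.2) (u : Sph n) :
    Measurable fun x : Eucl n => F x u := hF.comp (measurable_id.prodMk measurable_const)

lemma measurable_uncurry_right {F : Eucl n → Sph n → ℝ≥0∞}
    (hF : Measurable fun p : Eucl n × Sph n => F p.1 p.2) (x : Eucl n) :
    Measurable fun u : Sph n => F x u := hF.comp (measurable_const.prodMk measurable_id)

lemma rpow_neg_le_of_min_le {s : ℝ} (hs0 : 0 < s) {a b c : ℝ≥0∞} (h : min a b ≤ c) :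
    c ^ (-s) ≤ a ^ (-s) + b ^ (-s) := by
  refine (rpow_neg_anti hs0.le h).trans ?_
  rcases min_choice a b with h | h <;> rw [h]
  · exact le_self_add
  · exact le_add_self

/-- With `z` the radial projection, `x` lies on the segment from `0` to `z`, and also on the one
from `r z` to `z`. Quasi-concavity of chord length, for `K` on the first and for `r K` on the
second, gives the two bounds. The result depends on `x` only through `z`. -/
lemma min_chordWeight_le_shellWeight {s : ℝ} (hs0 : 0 < s) (hK : IsConvexBody K) (h0 : K ∈ 𝓝 0)
    {r : ℝ} (hr : 0 < r) (hr1 : r < 1) {x : Eucl n} (hx : x ∈ K \ r • K) (u : Sph n) :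
    min (chordWeight s K x u) (ENNReal.ofReal (1 - s) * chordWeight s (r • K) x u) ≤
      shellWeight s K r (radialProj K x) u := by
  have hx0 : x ≠ 0 := by
    rintro rfl
    exact hx.2 ⟨0, mem_of_mem_nhds h0, by simp⟩
  set τ := gauge K x with hτ
  set z := radialProj K x with hz
  have hxz : x = τ • z := (gauge_smul_radialProj hK h0 hx0).symm
  have hτ1 : τ ≤ 1 := (mem_iff_gauge_le_one hK h0).1 hx.1
  have hτ0 : 0 < τ := gauge_pos_of_ne hK h0 hx0
  have hτr : r < τ := by
    by_contra h
    refine hx.2 ?_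
    rw [Set.mem_smul_set_iff_inv_smul_mem₀ hr.ne', mem_iff_gauge_le_one hK h0,
      gauge_smul_pos _ (inv_pos.2 hr).le, inv_mul_le_iff₀ hr, mul_one]
    exact not_lt.1 h
  rw [shellWeight]
  refine min_le_min ?_ ?_
  · refine rpow_neg_le_of_min_le hs0 ?_
    have := min_chord_le hK 0 z u (p := 1 - τ) (q := τ) (by linarith) hτ0.le (by ring)
    rwa [smul_zero, zero_add, ← hxz] at this
  · gcongr
    rw [chordWeight]
    refine rpow_neg_anti hs0.le ?_
    rw [← chord_smul hr]
    have h1r : 0 < 1 - r := by linarith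
    have := min_chord_le (isConvexBody_smul hK hr.ne') (r • z) z u (p := (1 - τ) / (1 - r))
      (q := (τ - r) / (1 - r)) (div_nonneg (by linarith) h1r.le)
      (div_nonneg (by linarith) h1r.le) (by field_simp; ring)
    have e : ((1 - τ) / (1 - r)) • r • z + ((τ - r) / (1 - r)) • z = x := by
      rw [smul_smul, ← add_smul, hxz]
      congr 1
      field_simp
      ring
    rwa [e] at this

lemma setLIntegral_shell_le (hK : IsConvexBody K) (h0 : K ∈ 𝓝 0) {r : ℝ} (hr : 0 < r) (hr1 : r < 1)
    {F : Eucl n → ℝ≥0∞} (hn : 0 < n)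
    (hom : ∀ (r : ℝ) (x : Eucl n), 0 < r → F (r • x) = F x) :
    ∫⁻ x in K \ r • K, F x ≤ ENNReal.ofReal (1 - r ^ n) * ∫⁻ x in K, F x := by
  have hrn : r ^ n < 1 := pow_lt_one₀ hr.le hr1 hn.ne'
  have hpos : 0 < 1 - r ^ n := by linarith
  rcases eq_or_ne (∫⁻ x in K, F x) ⊤ with h | h
  · rw [h, ENNReal.mul_top (by simpa using hrn)]
    exact le_top
  have hrm : MeasurableSet (r • K) := (hK.2.1.smul r).measurableSet
  have hsub : r • K ⊆ K := by
    have := smul_subset_smul hK h0 hr.le hr1.le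
    rwa [one_smul] at this
  have h1 : ∫⁻ x in r • K, F x = ENNReal.ofReal (r ^ n) * ∫⁻ x in K, F x := by
    rw [setLIntegral_smul hr]
    simp only [hom _ _ hr]
  have h2 := lintegral_inter_add_sdiff (μ := volume) F K hrm
  rw [inter_eq_right.2 hsub, h1] at h2
  have h3 : ∫⁻ x in K \ r • K, F x =
      (∫⁻ x in K, F x) - ENNReal.ofReal (r ^ n) * ∫⁻ x in K, F x := by
    refine ENNReal.eq_sub_of_add_eq (ENNReal.mul_ne_top ENNReal.ofReal_ne_top h) ?_
    rw [add_comm]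
    exact h2
  rw [h3, ENNReal.ofReal_sub _ (by positivity), ENNReal.ofReal_one, ENNReal.sub_mul
    (fun _ _ => h), one_mul]

lemma measurable_shellWeight {s : ℝ} (hK : IsConvexBody K) (h0 : K ∈ 𝓝 0) (r : ℝ) :
    Measurable fun p : Eucl n × Sph n => shellWeight s K r (radialProj K p.1) p.2 := by
  have hKm := hK.2.1.measurableSet
  have e0 : Measurable fun q : Eucl n × Eucl n => chordWeight s K 0 q.2 :=
    (measurable_chordWeight_right s hKm 0).comp measurable_snd
  have e1 : Measurable fun q : Eucl n × Eucl n => chordWeight s K q.1 q.2 :=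
    measurable_chordWeight s hKm
  have e2 : Measurable fun q : Eucl n × Eucl n => chord K q.1 q.2 := measurable_chord hKm
  have e3 : Measurable fun q : Eucl n × Eucl n => chord (r • K) q.1 q.2 :=
    measurable_chord (hK.2.1.smul r).measurableSet
  have e4 : Measurable fun q : Eucl n × Eucl n =>
      min (ENNReal.ofReal r * chord K q.1 q.2) (chord (r • K) q.1 q.2) ^ (-s) :=
    ((e2.const_mul _).min e3).pow_const _
  have e5 : Measurable fun q : Eucl n × Eucl n => shellWeight s K r q.1 q.2 := by
    simp only [shellWeight]
    exact (e0.add e1).min (e4.const_mul _)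
  exact measurable_comp_radialProj hK h0 (F := shellWeight s K r) e5

lemma chordEnergy_le_shell {s : ℝ} (hs0 : 0 < s) (hs1 : s < 1) (hK : IsConvexBody K)
    (h0 : K ∈ 𝓝 0) (hL : IsSymmConvexBody L) (hn : 0 < n) {r : ℝ} (hr : 0 < r) (hr1 : r < 1) :
    chordEnergy s K L ≤ ENNReal.ofReal (r ^ ((n : ℝ) - s)) * chordEnergy s K L +
      ENNReal.ofReal (1 - r ^ n) * ∫⁻ p, shellWeight s K r (radialProj K p.1) p.2
        ∂((volume.restrict K).prod (sphWeight s L)) := by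
  have hKm := hK.2.1.measurableSet
  have := isFiniteMeasure_sphWeight (s := s) hL.1 (symm_mem_nhds_zero hL)
  have hrK := isConvexBody_smul hK hr.ne'
  have hrm : MeasurableSet (r • K) := hrK.2.1.measurableSet
  have hsub : r • K ⊆ K := by
    have := smul_subset_smul hK h0 hr.le hr1.le
    rwa [one_smul] at this
  have hGm := measurable_shellWeight (s := s) hK h0 r
  have hGx : ∀ u : Sph n, Measurable fun x : Eucl n => shellWeight s K r (radialProj K x) u :=
    measurable_uncurry_left (F := fun x u => shellWeight s K r (radialProj K x) u) hGm
  rw [← chordEnergy_smul hr hK, lintegral_prod_symm' _ hGm]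
  have hswap : Measurable fun p : Sph n × Eucl n => shellWeight s K r (radialProj K p.2) p.1 :=
    measurable_uncurry_swap (F := fun x u => shellWeight s K r (radialProj K x) u) hGm
  rw [← lintegral_const_mul _ hswap.lintegral_prod_right']
  have hmw : Measurable fun p : Sph n × Eucl n => chordWeight s (r • K) p.2 p.1 :=
    measurable_uncurry_swap (F := fun x u => chordWeight s (r • K) x u)
      (measurable_chordWeight_sph s hrm)
  rw [chordEnergy, chordEnergy, ← lintegral_add_left hmw.lintegral_prod_right']
  refine lintegral_mono fun u => (chordWeight_subset hs0 hs1 hK hrK hsub u).trans ?_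
  refine add_le_add le_rfl ?_
  refine le_trans (setLIntegral_mono (hGx u) fun x hx =>
    min_chordWeight_le_shellWeight hs0 hK h0 hr hr1 hx u) ?_
  exact setLIntegral_shell_le hK h0 hr hr1 hn fun t x ht => by rw [radialProj_smul ht]

lemma dirEnergy_zero_ne_top {s : ℝ} (hs0 : 0 < s) (h0 : K ∈ 𝓝 0)
    (hL : IsSymmConvexBody L) : dirEnergy s K L 0 ≠ ⊤ := by
  have := isFiniteMeasure_sphWeight (s := s) hL.1 (symm_mem_nhds_zero hL)
  obtain ⟨r, hr, hrK⟩ := exists_closedBall_subset h0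
  have h1 : ∀ u : Sph n, chordWeight s K 0 u ≤ ENNReal.ofReal (r ^ (-s)) := by
    intro u
    rw [← ENNReal.ofReal_rpow_of_pos hr]
    refine rpow_neg_anti hs0.le ?_
    have : Icc 0 r ⊆ lineSet K 0 u := by
      intro b hb
      refine hrK ?_
      simp only [zero_add, mem_closedBall_zero_iff, norm_smul, norm_sph, mul_one, Real.norm_eq_abs]
      rw [abs_of_nonneg hb.1]
      exact hb.2
    refine le_trans (le_of_eq ?_) (measure_mono this)
    rw [Real.volume_Icc, sub_zero]
  refine ne_top_of_le_ne_top ?_ (lintegral_mono h1)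
  rw [lintegral_const]
  exact ENNReal.mul_ne_top ENNReal.ofReal_ne_top (measure_ne_top _ _)

/-- A line in a non-tangential direction meets the interior, so the chord lengths of `r K` converge
to that of `K`, and the sharp half of `shellWeight` passes to the limit. -/
lemma limsup_shellWeight_le {s : ℝ} (hK : IsConvexBody K) (h0 : K ∈ 𝓝 0)
    {z : Eucl n} (hz : z ∈ frontier K) (hd : DifferentiableAt ℝ (gauge K) z) {u : Sph n}
    (hu : inner ℝ (u : Eucl n) (grad K z) ≠ 0) :
    limsup (fun k => shellWeight s K (ratioSeq k) z u) atTop ≤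
      ENNReal.ofReal (1 - s) * chordWeight s K z u := by
  obtain ⟨b₀, hb₀⟩ : ∃ b₀ : ℝ, z + b₀ • (u : Eucl n) ∈ interior K := by
    rw [real_inner_comm] at hu
    rcases lt_or_gt_of_ne hu with h | h
    · obtain ⟨t, -, ht⟩ := exists_mem_interior_of_inner_neg hK h0 hz hd h
      exact ⟨t, ht⟩
    · obtain ⟨t, -, ht⟩ := exists_mem_interior_of_inner_neg hK h0 hz hd (w := -(u : Eucl n))
        (by rw [inner_neg_right]; linarith)
      exact ⟨-t, by rwa [neg_smul, ← smul_neg]⟩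
  have h1 := tendsto_chord_ratioSeq hK h0 hb₀
  have h2 : Tendsto (fun k => ENNReal.ofReal (ratioSeq k) * chord K z u) atTop
      (𝓝 (chord K z u)) := by
    have := ENNReal.Tendsto.mul_const (b := chord K z u) (ENNReal.tendsto_ofReal tendsto_ratioSeq)
      (Or.inl (by simp))
    rwa [ENNReal.ofReal_one, one_mul] at this
  have h3 := h2.min h1
  rw [min_self] at h3
  have h4 := ENNReal.Tendsto.const_mul (a := ENNReal.ofReal (1 - s))
    (((ENNReal.continuous_rpow_const (y := -s)).tendsto _).comp h3) (Or.inr ENNReal.ofReal_ne_top)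
  rw [chordWeight, ← h4.limsup_eq]
  exact limsup_le_limsup (Eventually.of_forall fun k => by
    exact shellWeight_le_right _ _ _ _ _)

lemma tendsto_power_ratio {s : ℝ} (hn : 0 < n) :
    Tendsto (fun k => (1 - ratioSeq k ^ ((n : ℝ) - s)) / (1 - ratioSeq k ^ n)) atTop
      (𝓝 (((n : ℝ) - s) / n)) := by
  have hn0 : (n : ℝ) ≠ 0 := by exact_mod_cast hn.ne'
  have hr : Tendsto ratioSeq atTop (𝓝[≠] 1) :=
    tendsto_nhdsWithin_iff.2 ⟨tendsto_ratioSeq,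
      Eventually.of_forall fun k => (ratioSeq_lt_one k).ne⟩
  have d1 : HasDerivAt (fun r : ℝ => r ^ ((n : ℝ) - s)) ((n : ℝ) - s) 1 := by
    simpa using Real.hasDerivAt_rpow_const (x := 1) (p := (n : ℝ) - s) (Or.inl one_ne_zero)
  have d2 : HasDerivAt (fun r : ℝ => r ^ n) (n : ℝ) 1 := by
    simpa using hasDerivAt_pow n (1 : ℝ)
  have t1 := d1.tendsto_slope.comp hr
  have t2 := d2.tendsto_slope.comp hr
  refine (t1.div t2 hn0).congr fun k => ?_
  have h1 : ratioSeq k - 1 ≠ 0 := (sub_neg.2 (ratioSeq_lt_one k)).ne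
  simp only [Pi.div_apply, Function.comp, slope_def_field, Real.one_rpow, one_pow]
  rw [div_div_div_cancel_right₀ h1, ← neg_sub, ← neg_sub (1 : ℝ) (ratioSeq k ^ n), neg_div_neg_eq]

/-- The total energy of `K` is controlled by the energies at its boundary points. -/
theorem chordEnergy_le_boundary [NeZero n] {s : ℝ} (hs0 : 0 < s) (hs1 : s < 1)
    (hK : IsConvexBody K) (h0 : K ∈ 𝓝 0) (hL : IsSymmConvexBody L) :
    ENNReal.ofReal ((n : ℝ) - s) * chordEnergy s K L ≤ ENNReal.ofReal (1 - s) *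
      ∫⁻ u : Sph n, ENNReal.ofReal (radial K 0 u ^ n) * dirEnergy s K L (radialProj K (u : Eucl n))
        ∂((volume : Measure (Eucl n)).toSphere) := by
  have hn : 0 < n := Nat.pos_of_ne_zero (NeZero.ne n)
  have hn0 : (0 : ℝ) < n := by exact_mod_cast hn
  have hn1 : (1 : ℝ) ≤ n := by exact_mod_cast hn
  have hKm := hK.2.1.measurableSet
  have := isFiniteMeasure_sphWeight (s := s) hL.1 (symm_mem_nhds_zero hL)
  have hWm := measurable_dirEnergy (s := s) hK hL
  have hrp := measurable_radialProj hK h0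
  have hWr : Measurable fun x => dirEnergy s K L (radialProj K x) := hWm.comp hrp
  set I := ∫⁻ x in K, dirEnergy s K L (radialProj K x) with hI
  have hpolar : ∫⁻ u : Sph n, ENNReal.ofReal (radial K 0 u ^ n) *
      dirEnergy s K L (radialProj K (u : Eucl n)) ∂((volume : Measure (Eucl n)).toSphere) =
      ENNReal.ofReal n * I := by
    rw [hI, lintegral_body_of_homogeneous hK h0 hWr fun r x hr => by rw [radialProj_smul hr],
      ← lintegral_const_mul]
    · refine lintegral_congr fun u => ?_
      rw [← mul_assoc, ← ENNReal.ofReal_mul hn0.le]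
      congr 2
      field_simp
    · exact ((((continuous_radial_zero hK h0).measurable.pow_const _).div_const _).ennreal_ofReal).mul
        (hWr.comp measurable_subtype_coe)
  rw [hpolar]
  -- An infinite boundary energy leaves nothing to prove; a finite one gives the integrable majorant
  -- for the reverse Fatou lemma.
  rcases eq_or_ne I ⊤ with hItop | hItop
  · rw [hItop, ENNReal.mul_top (by simpa using hn.ne'), ENNReal.mul_top (by simpa using hs1)]
    exact le_top
  set π := (volume.restrict K).prod (sphWeight s L) with hπ
  set T : ℕ → ℝ≥0∞ := fun k => ∫⁻ p, shellWeight s K (ratioSeq k) (radialProj K p.1) p.2 ∂π with hT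
  have hcm : Measurable fun p : Eucl n × Sph n => chordWeight s K (radialProj K p.1) p.2 :=
    measurable_comp_radialProj hK h0 (F := chordWeight s K) (measurable_chordWeight s hKm)
  have hc0 : Measurable fun p : Eucl n × Sph n => chordWeight s K 0 p.2 :=
    (measurable_chordWeight_right s hKm 0).comp (measurable_subtype_coe.comp measurable_snd)
  have hdom : ∫⁻ p, (chordWeight s K 0 p.2 + chordWeight s K (radialProj K p.1) p.2) ∂π ≠ ⊤ := by
    rw [lintegral_add_left hc0, hπ, lintegral_prod _ hc0.aemeasurable,
      lintegral_prod _ hcm.aemeasurable]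
    refine ENNReal.add_ne_top.2 ⟨?_, hItop⟩
    simp only [lintegral_const, Measure.restrict_apply_univ]
    exact ENNReal.mul_ne_top (dirEnergy_zero_ne_top hs0 h0 hL) hK.2.1.measure_lt_top.ne
  have hGm := fun k => measurable_shellWeight (s := s) hK h0 (ratioSeq k)
  have hlim : limsup T atTop ≤ ENNReal.ofReal (1 - s) * I := by
    refine (limsup_lintegral_le _ hGm (fun k => Eventually.of_forall fun p => by
      exact shellWeight_le_left _ _ _ _ _)
      hdom).trans ?_
    have hlm : Measurable fun p : Eucl n × Sph n =>
        limsup (fun k => shellWeight s K (ratioSeq k) (radialProj K p.1) p.2) atTop :=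
      Measurable.limsup hGm
    rw [hπ, lintegral_prod _ hlm.aemeasurable, hI, ← lintegral_const_mul _ hWr]
    have hz0 : ∀ᵐ x : Eucl n, x ≠ 0 := by rw [ae_iff]; simp
    refine lintegral_mono_ae (ae_restrict_of_ae ?_)
    filter_upwards [ae_differentiableAt_gauge hK h0, hz0] with x hd hx
    have hz := radialProj_mem_frontier hK h0 hx
    have hdz : DifferentiableAt ℝ (gauge K) (radialProj K x) :=
      (differentiableAt_gauge_smul_iff (inv_pos.2 (gauge_pos_of_ne hK h0 hx))).2 hd
    have hcw : Measurable fun u : Sph n => chordWeight s K (radialProj K x) u :=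
      measurable_uncurry_right (F := fun x u => chordWeight s K (radialProj K x) u) hcm x
    rw [dirEnergy, ← lintegral_const_mul _ hcw]
    refine lintegral_mono_ae ?_
    filter_upwards [sphWeight_ae (s := s) (L := L) (ae_toSphere_inner_ne_zero
      (ne_zero_of_mem_normals (grad_mem_normals hK h0 hz hdz)))] with u hu
    exact limsup_shellWeight_le hK h0 hz hdz hu
  have hQ := chordEnergy_ne_top hs0 hs1 hK hL
  set Q := chordEnergy s K L with hQd
  -- The shell inequality reads `(1 - r^(n-s)) Q ≤ (1 - r^n) T`. The quotient of the two factors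
  -- tends to `(n-s)/n` as `r → 1`.
  have hstep : ∀ k, ENNReal.ofReal ((1 - ratioSeq k ^ ((n : ℝ) - s)) / (1 - ratioSeq k ^ n)) * Q ≤
      T k := by
    intro k
    have hr := ratioSeq_pos k
    have hr1 := ratioSeq_lt_one k
    have hrn : ratioSeq k ^ n < 1 := pow_lt_one₀ hr.le hr1 hn.ne'
    have hrs : ratioSeq k ^ ((n : ℝ) - s) < 1 := Real.rpow_lt_one hr.le hr1 (by linarith)
    have hpos : 0 < 1 - ratioSeq k ^ n := by linarith
    have h1 := chordEnergy_le_shell hs0 hs1 hK h0 hL hn hr hr1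
    have h2 : ENNReal.ofReal (1 - ratioSeq k ^ ((n : ℝ) - s)) * Q ≤
        ENNReal.ofReal (1 - ratioSeq k ^ n) * T k := by
      rw [ENNReal.ofReal_sub _ (by positivity), ENNReal.ofReal_one,
        ENNReal.sub_mul (fun _ _ => hQ), one_mul, tsub_le_iff_left]
      exact h1
    rw [div_eq_inv_mul, ENNReal.ofReal_mul (by positivity), ENNReal.ofReal_inv_of_pos hpos,
      mul_assoc]
    rw [ENNReal.inv_mul_le_iff (by simpa using hrn) ENNReal.ofReal_ne_top]
    exact h2
  have ht := ENNReal.Tendsto.mul_const (b := Q)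
    (ENNReal.tendsto_ofReal (tendsto_power_ratio (s := s) hn)) (Or.inr hQ)
  have hfin : ENNReal.ofReal (((n : ℝ) - s) / n) * Q ≤ ENNReal.ofReal (1 - s) * I := by
    rw [← ht.limsup_eq]
    exact (limsup_le_limsup (Eventually.of_forall hstep)).trans hlim
  calc ENNReal.ofReal ((n : ℝ) - s) * Q
      = ENNReal.ofReal n * (ENNReal.ofReal (((n : ℝ) - s) / n) * Q) := by
        rw [← mul_assoc, ← ENNReal.ofReal_mul hn0.le]
        congr 2
        field_simp
    _ ≤ ENNReal.ofReal n * (ENNReal.ofReal (1 - s) * I) := by gcongr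
    _ = _ := by ring

end BoundaryEnergy

/-! ### First variation along Wulff shapes. -/

section Wulff

variable {n : ℕ} {K L : Set (Eucl n)}

/-- The Wulff shape of the perturbation `h_K + t f` of the support function of `K`. -/
def wulff (K : Set (Eucl n)) (f : Sph n → ℝ) (t : ℝ) : Set (Eucl n) :=
  {x | ∀ v : Sph n, inner ℝ (v : Eucl n) x ≤ supp K v + t * f v}

lemma subset_wulff (hK : IsConvexBody K) {f : Sph n → ℝ} (hf : ∀ v, 0 ≤ f v) {t : ℝ} (ht : 0 ≤ t) :
    K ⊆ wulff K f t := fun _ hx v =>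
  (inner_le_supp hK v hx).trans (le_add_of_nonneg_right (mul_nonneg ht (hf v)))

/-- Compactness of the sphere bounds `f / h_K` by a constant `C`, so `h_K + t f ≤ (1 + C t) h_K`. -/
lemma exists_wulff_subset (hK : IsConvexBody K) (h0 : K ∈ 𝓝 0) {f : Sph n → ℝ}
    (hfc : Continuous f) :
    ∃ C : ℝ, 0 < C ∧ ∀ t : ℝ, 0 ≤ t → wulff K f t ⊆ (1 + C * t) • K := by
  obtain ⟨C, hC⟩ := (isCompact_univ (X := Sph n)).bddAbove_image
    ((hfc.div (continuous_supp hK) fun v => (supp_pos hK h0 v).ne').continuousOn)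
  refine ⟨max C 1, by positivity, fun t ht x hx => ?_⟩
  have hpos : 0 < 1 + max C 1 * t := by positivity
  refine mem_of_forall_inner_le_supp (isConvexBody_smul hK hpos.ne') fun v => ?_
  rw [supp_smul hK hpos]
  refine (hx v).trans ?_
  have h1 : f v / supp K v ≤ max C 1 := (hC ⟨v, mem_univ v, rfl⟩).trans (le_max_left _ _)
  rw [div_le_iff₀ (supp_pos hK h0 v)] at h1
  nlinarith

lemma isConvexBody_wulff (hK : IsConvexBody K) (h0 : K ∈ 𝓝 0) {f : Sph n → ℝ}
    (hfc : Continuous f) (hf : ∀ v, 0 ≤ f v) {t : ℝ} (ht : 0 ≤ t) :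
    IsConvexBody (wulff K f t) := by
  have heq : wulff K f t = ⋂ v : Sph n, {x | inner ℝ (v : Eucl n) x ≤ supp K v + t * f v} := by
    ext x; simp [wulff]
  refine ⟨?_, ?_, ?_⟩
  · rw [heq]
    exact convex_iInter fun v => convex_halfSpace_le
      ⟨fun x y => inner_add_right _ _ _, fun c x => inner_smul_right _ _ _⟩ _
  · obtain ⟨C, hC, hsub⟩ := exists_wulff_subset hK h0 hfc
    refine (hK.2.1.smul (1 + C * t)).of_isClosed_subset ?_ (hsub t ht)
    rw [heq]
    exact isClosed_iInter fun v => isClosed_le (by fun_prop) continuous_const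
  · exact hK.2.2.mono (interior_mono (subset_wulff hK hf ht))

lemma supp_wulff_le (hK : IsConvexBody K) (h0 : K ∈ 𝓝 0) {f : Sph n → ℝ}
    (hfc : Continuous f) (hf : ∀ v, 0 ≤ f v) {t : ℝ} (ht : 0 ≤ t) (v : Sph n) :
    supp (wulff K f t) v ≤ supp K v + t * f v :=
  supp_le (isConvexBody_wulff hK h0 hfc hf ht) v fun _ hx => hx v

lemma supp_unitNormal (hK : IsConvexBody K) (h0 : K ∈ 𝓝 0) {u : Sph n}
    (hd : DifferentiableAt ℝ (gauge K) (u : Eucl n)) :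
    ((unitNormal K u : Eucl n) = ‖grad K (u : Eucl n)‖⁻¹ • grad K (u : Eucl n)) ∧
      supp K (unitNormal K u) = ‖grad K (u : Eucl n)‖⁻¹ := by
  have hz := radialProj_mem_frontier hK h0 (sph_ne_zero u)
  have ha := grad_mem_normals hK h0 hz (differentiableAt_radialProj hK h0 hd)
  rw [grad_radialProj hK h0] at ha
  have hne := ne_zero_of_mem_normals ha
  have hN : (unitNormal K u : Eucl n) = ‖grad K (u : Eucl n)‖⁻¹ • grad K (u : Eucl n) := by
    rw [unitNormal, dif_neg hne]
  refine ⟨hN, le_antisymm (supp_le hK _ fun x hx => ?_) ?_⟩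
  · rw [hN, real_inner_smul_left]
    exact mul_le_of_le_one_right (by positivity) (ha.2 x hx)
  · refine le_trans (le_of_eq ?_) (inner_le_supp hK _ (frontier_subset_body hK hz))
    rw [hN, real_inner_smul_left, ha.1, mul_one]

/-- Near a smooth boundary point, the Wulff shape contains the dilate of that point by every
factor smaller than the one predicted by the first-order expansion. -/
lemma eventually_smul_mem_wulff (hK : IsConvexBody K) (h0 : K ∈ 𝓝 0) {f : Sph n → ℝ}
    (hfc : Continuous f) {u : Sph n} (hd : DifferentiableAt ℝ (gauge K) (u : Eucl n)) {c : ℝ}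
    (hc : c < f (unitNormal K u) * ‖grad K (u : Eucl n)‖) :
    ∀ᶠ t in 𝓝[>] (0 : ℝ), (1 + t * c) • radialProj K (u : Eucl n) ∈ wulff K f t := by
  obtain ⟨hN, hsN⟩ := supp_unitNormal hK h0 hd
  have hz := radialProj_mem_frontier hK h0 (sph_ne_zero u)
  have hdz := differentiableAt_radialProj hK h0 hd
  have ha := grad_mem_normals hK h0 hz hdz
  set z := radialProj K (u : Eucl n) with hzdef
  have hgz : grad K z = grad K (u : Eucl n) := grad_radialProj hK h0 u
  have hne : grad K (u : Eucl n) ≠ 0 := hgz ▸ ne_zero_of_mem_normals ha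
  have hgpos : 0 < ‖grad K (u : Eucl n)‖ := norm_pos_iff.2 hne
  have hNz : inner ℝ (unitNormal K u : Eucl n) z = ‖grad K (u : Eucl n)‖⁻¹ := by
    rw [hN, real_inner_smul_left, ← hgz, ha.1, mul_one]
  have hzK := frontier_subset_body hK hz
  have hci : Continuous fun v : Sph n => inner ℝ (v : Eucl n) z :=
    continuous_subtype_val.inner continuous_const
  -- Outside `A` the constraint in direction `v` holds for every `t ≥ 0`. The unit normal at `z` is
  -- not in `A`, by the choice of `c`, so on the compact set `A` the gap `h_K(v) - v · z` is bounded
  -- below and a small `t` cannot use it up.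
  set A : Set (Sph n) := {v : Sph n | f v ≤ c * inner ℝ (v : Eucl n) z} with hA
  have hAc : IsCompact A := (isClosed_le hfc (continuous_const.mul hci)).isCompact
  have hApos : ∀ v ∈ A, 0 < supp K v - inner ℝ (v : Eucl n) z := by
    intro v hv
    refine sub_pos.2 (lt_of_le_of_ne (inner_le_supp hK v hzK) fun heq => ?_)
    have hp := supp_pos hK h0 v
    have hmem : (supp K v)⁻¹ • (v : Eucl n) ∈ normals K z := by
      refine ⟨?_, fun x hx => ?_⟩
      · rw [real_inner_smul_left, heq, inv_mul_cancel₀ hp.ne']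
      · rw [real_inner_smul_left, inv_mul_le_iff₀ hp, mul_one]
        exact inner_le_supp hK v hx
    have hvg := eq_grad_of_mem_normals hK h0 hz hdz hmem
    rw [hgz] at hvg
    have hnorm : ‖grad K (u : Eucl n)‖ = (supp K v)⁻¹ := by
      rw [← hvg, norm_smul, norm_sph, mul_one, Real.norm_of_nonneg (inv_pos.2 hp).le]
    have hvN : v = unitNormal K u := by
      apply Subtype.ext
      rw [hN, hnorm, ← hvg, smul_smul, inv_inv, mul_inv_cancel₀ hp.ne', one_smul]
    rw [hA, mem_ofPred_eq, hvN, hNz] at hv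
    have := mul_lt_mul_of_pos_right hc (inv_pos.2 hgpos)
    rw [mul_inv_cancel_right₀ hgpos.ne'] at this
    linarith
  obtain ⟨δ, hδ, hδA⟩ : ∃ δ : ℝ, 0 < δ ∧ ∀ v ∈ A, δ ≤ supp K v - inner ℝ (v : Eucl n) z := by
    rcases A.eq_empty_or_nonempty with h | h
    · exact ⟨1, one_pos, by simp [h]⟩
    · obtain ⟨v₀, hv₀, hmin⟩ := hAc.exists_isMinOn h
        ((continuous_supp hK).sub hci).continuousOn
      exact ⟨_, hApos v₀ hv₀, fun v hv => hmin hv⟩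
  obtain ⟨B, hB⟩ := (isCompact_univ (X := Sph n)).bddAbove_image
    ((continuous_const.mul hci).sub hfc : Continuous fun v : Sph n =>
      c * inner ℝ (v : Eucl n) z - f v).continuousOn
  have hB' : ∀ v : Sph n, c * inner ℝ (v : Eucl n) z - f v ≤ max B 1 := fun v =>
    (hB ⟨v, mem_univ v, rfl⟩).trans (le_max_left _ _)
  have hB0 : 0 < max B 1 := by positivity
  filter_upwards [Ioo_mem_nhdsGT (div_pos hδ hB0)] with t ht v
  have ht1 : t * max B 1 < δ := (lt_div_iff₀ hB0).1 ht.2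
  rw [real_inner_smul_right]
  by_cases hv : v ∈ A
  · have h1 := hδA v hv
    have h2 := mul_le_mul_of_nonneg_left (hB' v) ht.1.le
    linarith
  · have h1 : c * inner ℝ (v : Eucl n) z < f v := not_le.1 hv
    have h2 := mul_le_mul_of_nonneg_left h1.le ht.1.le
    have h3 := inner_le_supp hK v hzK
    linarith

lemma chordEnergy_superset {s : ℝ} (hs0 : 0 < s) (hs1 : s < 1) {K' : Set (Eucl n)}
    (hK : IsConvexBody K) (hK' : IsConvexBody K') (hL : IsSymmConvexBody L) (h : K ⊆ K') :
    chordEnergy s K L + ENNReal.ofReal (1 - s) * ∫⁻ x in K' \ K, dirEnergy s K' L x ≤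
      chordEnergy s K' L := by
  have := isFiniteMeasure_sphWeight (s := s) hL.1 (symm_mem_nhds_zero hL)
  have hm : Measurable fun p : Sph n × Eucl n => chordWeight s K p.2 p.1 :=
    measurable_uncurry_swap (F := fun x u => chordWeight s K x u)
      (measurable_chordWeight_sph s hK.2.1.measurableSet)
  have hm0 := measurable_chordWeight_sph (n := n) s hK'.2.1.measurableSet
  have hm' : Measurable fun p : Sph n × Eucl n => chordWeight s K' p.2 p.1 :=
    measurable_uncurry_swap (F := fun x u => chordWeight s K' x u) hm0
  have hswap : ∫⁻ x in K' \ K, dirEnergy s K' L x =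
      ∫⁻ u, (∫⁻ x in K' \ K, chordWeight s K' x (u : Sph n)) ∂(sphWeight s L) :=
    lintegral_lintegral_swap (f := fun x (u : Sph n) => chordWeight s K' x u) hm0.aemeasurable
  rw [hswap, chordEnergy, chordEnergy, ← lintegral_const_mul _ hm'.lintegral_prod_right',
    ← lintegral_add_left hm.lintegral_prod_right']
  exact lintegral_mono fun u => chordWeight_superset hs0 hs1 hK hK' h u

/-- In polar coordinates, `r^(n-1)` is at least its value at the inner radius throughout the shell.
-/
lemma le_lintegral_diff_of_homogeneous [NeZero n] {K' : Set (Eucl n)} (hK : IsConvexBody K)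
    (h0 : K ∈ 𝓝 0) (hK' : IsConvexBody K') (h : K ⊆ K') {F : Eucl n → ℝ≥0∞} (hF : Measurable F)
    (hom : ∀ (r : ℝ) (x : Eucl n), 0 < r → F (r • x) = F x) :
    ∫⁻ u : Sph n, ENNReal.ofReal (radial K 0 u ^ (n - 1) * (radial K' 0 u - radial K 0 u)) *
      F (u : Eucl n) ∂((volume : Measure (Eucl n)).toSphere) ≤ ∫⁻ x in K' \ K, F x := by
  have hm : MeasurableSet (K' \ K) := hK'.2.1.measurableSet.diff hK.2.1.measurableSet
  have h0K := mem_of_mem_nhds h0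
  rw [← lintegral_indicator hm, lintegral_polar (hF.indicator hm)]
  refine lintegral_mono fun u => ?_
  have hρ := radial_nonneg hK h0K u
  have key : ∀ r ∈ Ioc (radial K 0 u) (radial K' 0 u),
      ENNReal.ofReal (radial K 0 u ^ (n - 1)) * F (u : Eucl n) ≤
        ENNReal.ofReal (r ^ (n - 1)) * (K' \ K).indicator F (r • (u : Eucl n)) := by
    intro r hr
    have hr0 : 0 < r := hρ.trans_lt hr.1
    have hmem : r • (u : Eucl n) ∈ K' \ K := by
      have e1 := add_smul_mem_iff_le_radial hK h0K u hr0.le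
      have e2 := add_smul_mem_iff_le_radial hK' (h h0K) u hr0.le
      rw [zero_add] at e1 e2
      exact ⟨e2.2 hr.2, fun hh => absurd (e1.1 hh) (not_le.2 hr.1)⟩
    rw [indicator_of_mem hmem, hom _ _ hr0]
    gcongr
    exact hr.1.le
  calc _ = ∫⁻ r in Ioc (radial K 0 u) (radial K' 0 u),
        ENNReal.ofReal (radial K 0 u ^ (n - 1)) * F (u : Eucl n) := by
        rw [setLIntegral_const, Real.volume_Ioc, ENNReal.ofReal_mul (by positivity)]
        ring
    _ ≤ ∫⁻ r in Ioc (radial K 0 u) (radial K' 0 u),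
        ENNReal.ofReal (r ^ (n - 1)) * (K' \ K).indicator F (r • (u : Eucl n)) :=
        setLIntegral_mono' measurableSet_Ioc key
    _ ≤ _ := lintegral_mono_set fun r hr => hρ.trans_lt hr.1

/-- Write `x = τ z` with `z` on the boundary and `1 < τ ≤ a`. The chord at `x` is at most the one of
`a K`, which by scaling is at most `a` times the chord of `a K` at `z`. The lower bound obtained is
constant on rays, as integration over the shell requires. -/
lemma dirEnergy_smul_le {s : ℝ} (hs0 : 0 < s) (hK : IsConvexBody K) (h0 : K ∈ 𝓝 0)
    {K' : Set (Eucl n)} {a : ℝ} (ha : 0 < a) (hsub : K' ⊆ a • K) {x : Eucl n} (hx : x ∈ K' \ K) :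
    ENNReal.ofReal a ^ (-s) * dirEnergy s (a • K) L (radialProj K x) ≤ dirEnergy s K' L x := by
  have hx0 : x ≠ 0 := fun h => hx.2 (h ▸ mem_of_mem_nhds h0)
  set τ := gauge K x with hτ
  have hxz : τ • radialProj K x = x := gauge_smul_radialProj hK h0 hx0
  have hτ1 : 1 < τ := by
    by_contra h
    exact hx.2 ((mem_iff_gauge_le_one hK h0).2 (not_lt.1 h))
  have hτ0 : 0 < τ := one_pos.trans hτ1
  have hτa : τ ≤ a := by
    have := hsub hx.1
    rwa [Set.mem_smul_set_iff_inv_smul_mem₀ ha.ne', mem_iff_gauge_le_one hK h0,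
      gauge_smul_pos _ (inv_pos.2 ha).le, inv_mul_le_iff₀ ha, mul_one] at this
  refine (lintegral_const_mul_le _ _).trans (lintegral_mono fun u => ?_)
  rw [chordWeight, chordWeight, ← ENNReal.mul_rpow_of_ne_top ENNReal.ofReal_ne_top
    (chord_ne_top (hK.2.1.smul a) _ u)]
  refine rpow_neg_anti hs0.le ?_
  calc chord K' x u ≤ chord (a • K) x u := chord_mono hsub _ _
    _ = chord (τ • (τ⁻¹ * a) • K) (τ • radialProj K x) u := by
        rw [hxz, smul_smul, mul_inv_cancel_left₀ hτ0.ne']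
    _ = ENNReal.ofReal τ * chord ((τ⁻¹ * a) • K) (radialProj K x) u := chord_smul hτ0 _ _
    _ ≤ ENNReal.ofReal a * chord (a • K) (radialProj K x) u := by
        refine mul_le_mul' (ENNReal.ofReal_le_ofReal hτa) (chord_mono ?_ _ _)
        refine smul_subset_smul hK h0 (by positivity) ?_
        exact mul_le_of_le_one_left ha.le (inv_le_one_of_one_le₀ hτ1.le)

lemma tendsto_chord_smul_of_antitone (hK : IsConvexBody K) (h0 : K ∈ 𝓝 0) {a : ℕ → ℝ}
    (ha : Antitone a) (ha1 : ∀ k, 1 < a k) (hlim : Tendsto a atTop (𝓝 1)) (z : Eucl n) (u : Sph n) :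
    Tendsto (fun k => chord (a k • K) z u) atTop (𝓝 (chord K z u)) := by
  have hmono : Antitone fun k => lineSet (a k • K) z u := by
    intro i j hij b hb
    exact smul_subset_smul hK h0 (one_pos.trans (ha1 j)).le (ha hij) hb
  have hm : ∀ k, NullMeasurableSet (lineSet (a k • K) z u) volume := fun k =>
    (measurableSet_lineSet (hK.2.1.smul (a k)).measurableSet z u).nullMeasurableSet
  have h1 := tendsto_measure_iInter_atTop hm hmono ⟨0, chord_ne_top (hK.2.1.smul (a 0)) z u⟩
  have h2 : ⋂ k, lineSet (a k • K) z u = lineSet K z u := by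
    refine Subset.antisymm (fun b hb => ?_) (subset_iInter fun k b hb => ?_)
    · refine (mem_iff_gauge_le_one hK h0).2 (ge_of_tendsto hlim (Eventually.of_forall fun k => ?_))
      have hp := one_pos.trans (ha1 k)
      have := mem_iInter.1 hb k
      rwa [lineSet, mem_ofPred_eq, Set.mem_smul_set_iff_inv_smul_mem₀ hp.ne',
        mem_iff_gauge_le_one hK h0, gauge_smul_pos _ (inv_pos.2 hp).le, inv_mul_le_iff₀ hp,
        mul_one] at this
    · have := smul_subset_smul hK h0 zero_le_one (ha1 k).le
      rw [one_smul] at this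
      exact this hb
  rw [h2] at h1
  exact h1

lemma tendsto_dirEnergy_smul {s : ℝ} (hs0 : 0 < s) (hK : IsConvexBody K) (h0 : K ∈ 𝓝 0) {a : ℕ → ℝ}
    (ha : Antitone a) (ha1 : ∀ k, 1 < a k) (hlim : Tendsto a atTop (𝓝 1)) (z : Eucl n) :
    Tendsto (fun k => ENNReal.ofReal (a k) ^ (-s) * dirEnergy s (a k • K) L z) atTop
      (𝓝 (dirEnergy s K L z)) := by
  have h1 : Tendsto (fun k => dirEnergy s (a k • K) L z) atTop (𝓝 (dirEnergy s K L z)) := by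
    refine lintegral_tendsto_of_tendsto_of_monotone (fun k => ?_) ?_ ?_
    · exact (measurable_uncurry_right (F := fun x u => chordWeight s (a k • K) x u)
        (measurable_chordWeight_sph s (hK.2.1.smul (a k)).measurableSet) z).aemeasurable
    · refine Eventually.of_forall fun u i j hij => rpow_neg_anti hs0.le (chord_mono ?_ _ _)
      exact smul_subset_smul hK h0 (one_pos.trans (ha1 j)).le (ha hij)
    · exact Eventually.of_forall fun u => ((ENNReal.continuous_rpow_const (y := -s)).tendsto _).comp
        (tendsto_chord_smul_of_antitone hK h0 ha ha1 hlim z u)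
  have h2 : Tendsto (fun k => ENNReal.ofReal (a k) ^ (-s)) atTop (𝓝 1) := by
    have := ((ENNReal.continuous_rpow_const (y := -s)).tendsto _).comp (ENNReal.tendsto_ofReal hlim)
    simpa [Function.comp_def] using this
  have := ENNReal.Tendsto.mul h2 (Or.inl one_ne_zero) h1 (Or.inr ENNReal.one_ne_top)
  rwa [one_mul] at this

lemma lintegral_areaMeasure {s : ℝ} (hK : IsConvexBody K) (h0 : K ∈ 𝓝 0) (hL : IsSymmConvexBody L)
    {F : Sph n → ℝ≥0∞} (hF : Measurable F) :
    ∫⁻ v, F v ∂(areaMeasure s K L) = ∫⁻ u, areaDensity s K L u * F (unitNormal K u)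
      ∂((volume : Measure (Eucl n)).toSphere) := by
  rw [areaMeasure, lintegral_map hF (measurable_unitNormal K),
    lintegral_withDensity_eq_lintegral_mul _ (measurable_areaDensity hK h0 hL)
      (g := fun u => F (unitNormal K u)) (hF.comp (measurable_unitNormal K))]
  rfl

/-- First-order lower bound for the energy of Wulff shapes. -/
theorem exists_chordEnergy_wulff_ge [NeZero n] {s : ℝ} (hs0 : 0 < s) (hs1 : s < 1)
    (hK : IsConvexBody K) (h0 : K ∈ 𝓝 0) (hL : IsSymmConvexBody L) {f : Sph n → ℝ}
    (hfc : Continuous f) (hf : ∀ v, 0 ≤ f v) :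
    ∃ J : ℕ → ℝ≥0∞, (∀ k : ℕ, chordEnergy s K L +
        ENNReal.ofReal (1 - s) * (ENNReal.ofReal (1 / ((k : ℝ) + 1)) * J k) ≤
          chordEnergy s (wulff K f (1 / ((k : ℝ) + 1))) L) ∧
      ∫⁻ v, ENNReal.ofReal (f v) ∂(areaMeasure s K L) ≤ liminf J atTop := by
  obtain ⟨C, hC, hsub⟩ := exists_wulff_subset hK h0 hfc
  set t : ℕ → ℝ := fun k => 1 / ((k : ℝ) + 1) with ht
  have ht0 : ∀ k, 0 < t k := fun k => Nat.one_div_pos_of_nat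
  have htlim : Tendsto t atTop (𝓝 0) := tendsto_one_div_add_atTop_nhds_zero_nat
  have htgt : Tendsto t atTop (𝓝[>] 0) :=
    tendsto_nhdsWithin_iff.2 ⟨htlim, Eventually.of_forall ht0⟩
  set a : ℕ → ℝ := fun k => 1 + C * t k with ha
  have ha1 : ∀ k, 1 < a k := fun k => lt_add_of_pos_right _ (mul_pos hC (ht0 k))
  have ha0 : ∀ k, 0 < a k := fun k => one_pos.trans (ha1 k)
  have haanti : Antitone a := by
    intro i j hij
    have := Nat.one_div_le_one_div (α := ℝ) hij
    simp only [ha, ht]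
    gcongr
  have halim : Tendsto a atTop (𝓝 1) := by
    simpa using (htlim.const_mul C).const_add 1
  have hKt := fun k => isConvexBody_wulff hK h0 hfc hf (ht0 k).le
  have hKsub := fun k => subset_wulff hK hf (ht0 k).le
  have hrp := measurable_radialProj hK h0
  set Φ : ℕ → Eucl n → ℝ≥0∞ := fun k x =>
    ENNReal.ofReal (a k) ^ (-s) * dirEnergy s (a k • K) L (radialProj K x) with hΦ
  have hΦm : ∀ k, Measurable (Φ k) := fun k =>
    ((measurable_dirEnergy (isConvexBody_smul hK (ha0 k).ne') hL).comp hrp).const_mul _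
  have hΦh : ∀ k (r : ℝ) (x : Eucl n), 0 < r → Φ k (r • x) = Φ k x := fun k r x hr => by
    simp only [hΦ, radialProj_smul hr]
  -- The difference quotient of the radial function, times the ray-constant lower bound for the
  -- energy on the shell; Fatou's lemma is applied to this sequence.
  set W : ℕ → Sph n → ℝ≥0∞ := fun k u => ENNReal.ofReal (radial K 0 u ^ (n - 1) *
    ((radial (wulff K f (t k)) 0 u - radial K 0 u) / t k)) * Φ k (u : Eucl n) with hW
  have hρm : Measurable fun u : Sph n => radial K 0 u := (continuous_radial_zero hK h0).measurable
  have hρtm : ∀ k, Measurable fun u : Sph n => radial (wulff K f (t k)) 0 u := fun k =>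
    (continuous_radial_zero (hKt k) (mem_of_superset h0 (hKsub k))).measurable
  have hWm : ∀ k, Measurable (W k) := fun k =>
    (((hρm.pow_const _).mul (((hρtm k).sub hρm).div_const _)).ennreal_ofReal).mul
      ((hΦm k).comp measurable_subtype_coe)
  refine ⟨fun k => ∫⁻ u, W k u ∂((volume : Measure (Eucl n)).toSphere), fun k => ?_, ?_⟩
  · refine le_trans ?_ (chordEnergy_superset hs0 hs1 hK (hKt k) hL (hKsub k))
    gcongr
    have hms : MeasurableSet (wulff K f (t k) \ K) :=
      (hKt k).2.1.measurableSet.diff hK.2.1.measurableSet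
    calc _ = ∫⁻ u : Sph n, ENNReal.ofReal (radial K 0 u ^ (n - 1) *
          (radial (wulff K f (t k)) 0 u - radial K 0 u)) * Φ k (u : Eucl n)
            ∂((volume : Measure (Eucl n)).toSphere) := by
          rw [← lintegral_const_mul _ (hWm k)]
          refine lintegral_congr fun u => ?_
          rw [hW, ← mul_assoc, ← ENNReal.ofReal_mul (ht0 k).le]
          congr 2
          have := (ht0 k).ne'
          simp only [ht] at this ⊢
          field_simp
      _ ≤ ∫⁻ x in wulff K f (t k) \ K, Φ k x :=
          le_lintegral_diff_of_homogeneous hK h0 (hKt k) (hKsub k) (hΦm k) (hΦh k)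
      _ ≤ _ := setLIntegral_mono' hms fun x hx =>
          dirEnergy_smul_le hs0 hK h0 (ha0 k) (hsub _ (ht0 k).le) hx
  · rw [lintegral_areaMeasure hK h0 hL hfc.measurable.ennreal_ofReal]
    refine le_trans (lintegral_mono_ae ?_) (lintegral_liminf_le hWm)
    filter_upwards [ae_sph_differentiableAt_gauge hK h0] with u hd
    set D := dirEnergy s K L (radialProj K (u : Eucl n)) with hD
    have hDlim : Tendsto (fun k => Φ k (u : Eucl n)) atTop (𝓝 D) :=
      tendsto_dirEnergy_smul hs0 hK h0 haanti ha1 halim _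
    have hρ : 0 < radial K 0 u := by
      rw [radial_zero_eq hK h0]
      exact inv_pos.2 (gauge_pos_of_ne hK h0 (sph_ne_zero u))
    have hre : areaDensity s K L u * ENNReal.ofReal (f (unitNormal K u)) =
        ENNReal.ofReal (f (unitNormal K u) * ‖grad K (u : Eucl n)‖) *
          (ENNReal.ofReal (radial K 0 u ^ n) * D) := by
      rw [areaDensity, ENNReal.ofReal_mul (by positivity), ENNReal.ofReal_mul (hf _)]
      ring
    rw [hre]
    -- Each `b` below the expected rate of growth is an admissible slope for
    -- `eventually_smul_mem_wulff`, so a lower bound on the quotient is enough and the radial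
    -- function need not be differentiated.
    refine ENNReal.mul_le_of_forall_lt fun b hb d hd' => ?_
    refine (mul_le_mul_right hd'.le b).trans ?_
    have hbt : b ≠ ⊤ := (hb.trans ENNReal.ofReal_lt_top).ne
    have hbc : b.toReal < f (unitNormal K u) * ‖grad K (u : Eucl n)‖ := by
      rw [← ENNReal.ofReal_toReal hbt] at hb
      exact (ENNReal.ofReal_lt_ofReal_iff'.1 hb).1
    have hev := htgt.eventually (eventually_smul_mem_wulff hK h0 hfc hd hbc)
    have hle : ∀ᶠ k in atTop, b * (ENNReal.ofReal (radial K 0 u ^ n) * Φ k (u : Eucl n)) ≤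
        W k u := by
      filter_upwards [hev] with k hk
      have htk := ht0 k
      have hb0 : 0 ≤ b.toReal := ENNReal.toReal_nonneg
      have h1 : radial K 0 u * (1 + t k * b.toReal) ≤ radial (wulff K f (t k)) 0 u := by
        rw [← add_smul_mem_iff_le_radial (hKt k) (hKsub k (mem_of_mem_nhds h0)) u (by positivity),
          zero_add, mul_comm, mul_smul, radial_zero_eq hK h0]
        exact hk
      have h2 : b.toReal * radial K 0 u ≤
          (radial (wulff K f (t k)) 0 u - radial K 0 u) / t k := by
        rw [le_div_iff₀ htk]
        linarith
      rw [← mul_assoc, hW]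
      refine mul_le_mul' ?_ le_rfl
      nth_rewrite 1 [← ENNReal.ofReal_toReal hbt]
      rw [← ENNReal.ofReal_mul hb0]
      refine ENNReal.ofReal_le_ofReal ?_
      calc b.toReal * radial K 0 u ^ n = radial K 0 u ^ (n - 1) * (b.toReal * radial K 0 u) := by
            rw [← pow_sub_one_mul (NeZero.ne n)]
            ring
        _ ≤ _ := mul_le_mul_of_nonneg_left h2 (by positivity)
    have hlim' : Tendsto (fun k => b * (ENNReal.ofReal (radial K 0 u ^ n) * Φ k (u : Eucl n)))
        atTop (𝓝 (b * (ENNReal.ofReal (radial K 0 u ^ n) * D))) :=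
      ENNReal.Tendsto.const_mul (ENNReal.Tendsto.const_mul hDlim (Or.inr ENNReal.ofReal_ne_top))
        (Or.inr hbt)
    rw [← hlim'.liminf_eq]
    exact liminf_le_liminf hle

end Wulff

/-! ### Translation and dilation of the fractional area measure. -/

section Invariance

variable {n : ℕ} {K L : Set (Eucl n)}

lemma radial_translate (a z : Eucl n) (u : Sph n) : radial (a +ᵥ K) (a + z) u = radial K z u := by
  have h : ∀ x : Eucl n, a + x ∈ a +ᵥ K ↔ x ∈ K := fun x => Set.vadd_mem_vadd_set_iff
  simp only [radial, add_assoc, h]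

lemma mem_invGauss_translate (hK : IsConvexBody K) (a z : Eucl n) (η : Set (Sph n)) :
    a + z ∈ invGauss (a +ᵥ K) η ↔ z ∈ invGauss K η := by
  have hfr : a + z ∈ frontier (a +ᵥ K) ↔ z ∈ frontier K := by
    have h := (Homeomorph.addLeft a).image_frontier K
    have h' : (Homeomorph.addLeft a) '' K = a +ᵥ K := rfl
    rw [h'] at h
    rw [← h]
    exact (Homeomorph.addLeft a).injective.mem_set_image
  simp only [invGauss, mem_ofPred_eq, hfr, inner_add_right, supp_translate hK, add_right_inj]

lemma fracArea_translate {s : ℝ} (hK : IsConvexBody K) (a : Eucl n) (η : Set (Sph n)) :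
    fracArea s (a +ᵥ K) L η = fracArea s K L η := by
  have hmp := (IsometryEquiv.addLeft a).measurePreserving_euclideanHausdorffMeasure (n - 1)
  have hemb : MeasurableEmbedding (IsometryEquiv.addLeft a) :=
    (IsometryEquiv.addLeft a).toHomeomorph.measurableEmbedding
  have hpre : (IsometryEquiv.addLeft a) ⁻¹' invGauss (a +ᵥ K) η = invGauss K η :=
    Set.ext fun z => mem_invGauss_translate hK a z η
  rw [fracArea, fracArea, ← hmp.setLIntegral_comp_preimage_emb hemb, hpre]
  simp only [dualMixedVolume, IsometryEquiv.addLeft_apply, radial_translate]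

lemma gauge_smul_body {c : ℝ} (hc : 0 < c) (x : Eucl n) : gauge (c • K) x = c⁻¹ * gauge K x := by
  rw [gauge_smul_left_of_nonneg hc.le]
  rfl

lemma grad_smul_body {c : ℝ} (hc : 0 < c) (x : Eucl n) : grad (c • K) x = c⁻¹ • grad K x := by
  have h : gauge (c • K) = c⁻¹ • gauge K := gauge_smul_left_of_nonneg hc.le
  rw [grad, grad, h, fderiv_const_smul_field, Pi.smul_apply, map_smulₛₗ]
  rfl

lemma unitNormal_smul_body {c : ℝ} (hc : 0 < c) (u : Sph n) :
    unitNormal (c • K) u = unitNormal K u := by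
  by_cases h : grad K (u : Eucl n) = 0
  · have h' : grad (c • K) (u : Eucl n) = 0 := by rw [grad_smul_body hc, h, smul_zero]
    rw [unitNormal, unitNormal, dif_pos h, dif_pos h']
  · have h' : grad (c • K) (u : Eucl n) ≠ 0 := by
      rw [grad_smul_body hc]
      exact smul_ne_zero (inv_pos.2 hc).ne' h
    rw [unitNormal, unitNormal, dif_neg h, dif_neg h']
    refine Subtype.ext ?_
    simp only [grad_smul_body hc, norm_smul, norm_inv, Real.norm_of_nonneg hc.le, mul_inv, inv_inv,
      smul_smul]
    congr 1
    field_simp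

/-- The exponent collects `n` from the radial power, `-1` from the gradient of the gauge and `-s`
from the chord weight. -/
lemma areaDensity_smul_body [NeZero n] {s c : ℝ} (hc : 0 < c) (hK : IsConvexBody K) (h0 : K ∈ 𝓝 0)
    (u : Sph n) :
    areaDensity s (c • K) L u = ENNReal.ofReal (c ^ ((n : ℝ) - 1 - s)) * areaDensity s K L u := by
  have hr : radial (c • K) 0 u = c * radial K 0 u := by
    rw [radial_zero_eq (isConvexBody_smul hK hc.ne') (smul_mem_nhds_zero h0 hc.ne'),
      radial_zero_eq hK h0, gauge_smul_body hc, mul_inv, inv_inv]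
  have hp : radialProj (c • K) (u : Eucl n) = c • radialProj K (u : Eucl n) := by
    rw [radialProj, radialProj, gauge_smul_body hc, mul_inv, inv_inv, mul_smul]
  have hd : dirEnergy s (c • K) L (radialProj (c • K) (u : Eucl n)) =
      ENNReal.ofReal (c ^ (-s)) * dirEnergy s K L (radialProj K (u : Eucl n)) := by
    rw [hp, dirEnergy, dirEnergy, ← lintegral_const_mul _ (measurable_uncurry_right
      (F := fun x u => chordWeight s K x u)
        (measurable_chordWeight_sph s hK.2.1.measurableSet) _)]
    simp only [chordWeight_smul hc]
  have hρ := radial_nonneg hK (mem_of_mem_nhds h0) u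
  rw [areaDensity, areaDensity, hd, hr, grad_smul_body hc, norm_smul, norm_inv,
    Real.norm_of_nonneg hc.le, ← mul_assoc (ENNReal.ofReal _) (ENNReal.ofReal (c ^ (-s))),
    ← ENNReal.ofReal_mul (by positivity), ← mul_assoc (ENNReal.ofReal (c ^ ((n : ℝ) - 1 - s))),
    ← ENNReal.ofReal_mul (by positivity)]
  congr 2
  rw [Real.rpow_sub hc, Real.rpow_sub hc, Real.rpow_natCast, Real.rpow_one, Real.rpow_neg hc.le]
  field_simp
  ring

lemma areaMeasure_smul_body [NeZero n] {s c : ℝ} (hc : 0 < c) (hK : IsConvexBody K) (h0 : K ∈ 𝓝 0)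
    (hL : IsSymmConvexBody L) :
    areaMeasure s (c • K) L = ENNReal.ofReal (c ^ ((n : ℝ) - 1 - s)) • areaMeasure s K L := by
  have h1 : areaDensity s (c • K) L =
      ENNReal.ofReal (c ^ ((n : ℝ) - 1 - s)) • areaDensity s K L :=
    funext fun u => areaDensity_smul_body hc hK h0 u
  have h2 : unitNormal (c • K) = unitNormal K := funext fun u => unitNormal_smul_body hc u
  rw [areaMeasure, areaMeasure, h1, h2, withDensity_smul _ (measurable_areaDensity hK h0 hL),
    Measure.map_smul]

lemma fracArea_smul_body [NeZero n] {s c : ℝ} (hs0 : 0 < s) (hc : 0 < c) (hK : IsConvexBody K)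
    (h0 : K ∈ 𝓝 0) (hL : IsSymmConvexBody L) {η : Set (Sph n)} (hη : MeasurableSet η) :
    fracArea s (c • K) L η = ENNReal.ofReal (c ^ ((n : ℝ) - 1 - s)) *
      (ENNReal.ofReal (1 / (2 * s)) * areaMeasure s K L η) := by
  rw [fracArea_eq hs0 (isConvexBody_smul hK hc.ne') (smul_mem_nhds_zero h0 hc.ne') hL hη,
    areaMeasure_smul_body hc hK h0 hL, Measure.smul_apply, smul_eq_mul]
  ring

end Invariance

/-! ### Comparison of measures by test functions. -/

section MeasureComparison

/-- Finite measures on a metric space are compared by testing on continuous functions. -/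
lemma measure_le_of_forall_lintegral_le {X : Type*} [MetricSpace X] [MeasurableSpace X]
    [BorelSpace X] {μ ν : Measure X} [IsFiniteMeasure μ] [IsFiniteMeasure ν]
    (h : ∀ f : X → ℝ, Continuous f → (∀ x, 0 ≤ f x) →
      ∫⁻ x, ENNReal.ofReal (f x) ∂ν ≤ ∫⁻ x, ENNReal.ofReal (f x) ∂μ) : ν ≤ μ := by
  have hcl : ∀ F : Set X, IsClosed F → ν F ≤ μ F := by
    intro F hF
    have hpos : ∀ k : ℕ, 0 < 1 / ((k : ℝ) + 1) := fun k => Nat.one_div_pos_of_nat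
    refine le_of_tendsto_of_tendsto'
      (tendsto_lintegral_thickenedIndicator_of_isClosed ν hF hpos
        tendsto_one_div_add_atTop_nhds_zero_nat)
      (tendsto_lintegral_thickenedIndicator_of_isClosed μ hF hpos
        tendsto_one_div_add_atTop_nhds_zero_nat) fun k => ?_
    have := h (fun x => (thickenedIndicator (hpos k) F x : ℝ)) (by fun_prop)
      fun x => NNReal.coe_nonneg _
    simpa only [ENNReal.ofReal_coe_nnreal] using this
  refine Measure.le_iff.2 fun A hA => ?_
  rw [hA.measure_eq_iSup_isClosed_of_ne_top (measure_ne_top ν A)]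
  exact iSup₂_le fun F hF => iSup_le fun hFc => (hcl F hFc).trans (measure_mono hF)

/-- The difference `μ - ν` is a measure against which a nowhere vanishing function integrates to
zero. Finiteness of the integral permits the cancellation. -/
lemma eq_of_le_of_lintegral_le {X : Type*} [MeasurableSpace X] {μ ν : Measure X}
    [IsFiniteMeasure μ] (hle : ν ≤ μ) {f : X → ℝ≥0∞}
    (hf : Measurable f) (hpos : ∀ x, f x ≠ 0) (hfin : ∫⁻ x, f x ∂μ ≠ ⊤)
    (h : ∫⁻ x, f x ∂μ ≤ ∫⁻ x, f x ∂ν) : μ = ν := by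
  have : IsFiniteMeasure ν := isFiniteMeasure_of_le μ hle
  have hadd : μ - ν + ν = μ := Measure.sub_add_cancel_of_le hle
  have h1 : ∫⁻ x, f x ∂(μ - ν) + ∫⁻ x, f x ∂ν = ∫⁻ x, f x ∂μ := by
    rw [← lintegral_add_measure, hadd]
  have hνfin : ∫⁻ x, f x ∂ν ≠ ⊤ := ne_top_of_le_ne_top hfin (lintegral_mono' hle le_rfl)
  have h2 : ∫⁻ x, f x ∂(μ - ν) = 0 := by
    rw [← h1] at h
    by_contra hne
    exact absurd h (not_le.2 (by
      rw [add_comm]; exact ENNReal.lt_add_right hνfin hne))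
  rw [lintegral_eq_zero_iff hf] at h2
  have h3 : μ - ν = 0 := by
    rw [← ae_eq_bot, ← eventually_false_iff_eq_bot]
    filter_upwards [h2] with x hx using hpos x hx
  rw [← hadd, h3, zero_add]

end MeasureComparison

/-! ### Optimality conditions at a minimizer. -/

section Minimizer

variable {n : ℕ} {K L : Set (Eucl n)}

lemma integrable_supp (hK : IsConvexBody K) (μ : Measure (Sph n)) [IsFiniteMeasure μ] :
    Integrable (supp K) μ :=
  (continuous_supp hK).integrable_of_hasCompactSupport (HasCompactSupport.of_compactSpace _)

lemma fracPerimeter_ne_top [NeZero n] {s : ℝ} (hs0 : 0 < s) (hs1 : s < 1) (hK : IsConvexBody K)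
    (hL : IsSymmConvexBody L) : fracPerimeter s K L ≠ ⊤ := by
  rw [fracPerimeter_eq hs0 hs1 hK hL]
  exact ENNReal.mul_ne_top ENNReal.ofReal_ne_top (chordEnergy_ne_top hs0 hs1 hK hL)

lemma integral_supp_pos (hK : IsConvexBody K) (h0 : K ∈ 𝓝 0) {μ : Measure (Sph n)}
    [IsFiniteMeasure μ] (hμ : μ ≠ 0) : 0 < ∫ v, supp K v ∂μ := by
  rw [integral_pos_iff_support_of_nonneg (fun v => (supp_pos hK h0 v).le) (integrable_supp hK μ)]
  have : Function.support (supp K) = univ :=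
    eq_univ_of_forall fun v => (supp_pos hK h0 v).ne'
  rw [this]
  exact Measure.measure_univ_pos.2 hμ

/-- The lower bound for the mean width of a body of arbitrary fractional perimeter obtained by
normalizing the perimeter. -/
lemma mul_rpow_le_integral_supp [NeZero n] {s : ℝ} (hs0 : 0 < s) (hs1 : s < 1)
    (hL : IsSymmConvexBody L) {μ : Measure (Sph n)} {M : ℝ}
    (hmin : ∀ K' : Set (Eucl n), IsConvexBody K' → fracPerimeter s K' L = 1 →
      M ≤ ∫ v, supp K' v ∂μ) (hK : IsConvexBody K) {p : ℝ} (hp : 0 < p)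
    (hP : fracPerimeter s K L = ENNReal.ofReal p) :
    M * p ^ (1 / ((n : ℝ) - s)) ≤ ∫ v, supp K v ∂μ := by
  have hn1 : (1 : ℝ) ≤ n := by exact_mod_cast Nat.one_le_iff_ne_zero.2 (NeZero.ne n)
  have hns : 0 < (n : ℝ) - s := by linarith
  set c := p ^ (1 / ((n : ℝ) - s)) with hc
  have hc0 : 0 < c := Real.rpow_pos_of_pos hp _
  have hcp : c⁻¹ ^ ((n : ℝ) - s) = p⁻¹ := by
    rw [Real.inv_rpow hc0.le, hc, ← Real.rpow_mul hp.le, one_div, inv_mul_cancel₀ hns.ne',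
      Real.rpow_one]
  have hcinv := inv_pos.2 hc0
  have h1 : fracPerimeter s (c⁻¹ • K) L = 1 := by
    rw [fracPerimeter_smul hs0 hs1 hcinv hK hL, hP, hcp, ← ENNReal.ofReal_mul (by positivity),
      inv_mul_cancel₀ hp.ne', ENNReal.ofReal_one]
  have h2 := hmin _ (isConvexBody_smul hK hcinv.ne') h1
  simp only [supp_smul hK hcinv, integral_const_mul] at h2
  rw [mul_comm]
  rwa [le_inv_mul_iff₀ hc0] at h2

/-- The first variation inequality at a minimizer. -/
lemma lintegral_areaMeasure_le [NeZero n] {s : ℝ} (hs0 : 0 < s) (hs1 : s < 1)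
    (hK : IsConvexBody K) (h0 : K ∈ 𝓝 0) (hL : IsSymmConvexBody L) {μ : Measure (Sph n)}
    [IsFiniteMeasure μ] {M : ℝ} (hM : M = ∫ v, supp K v ∂μ) (hM0 : 0 < M)
    (hP : fracPerimeter s K L = 1)
    (hmin : ∀ K' : Set (Eucl n), IsConvexBody K' → fracPerimeter s K' L = 1 →
      M ≤ ∫ v, supp K' v ∂μ) {f : Sph n → ℝ} (hfc : Continuous f) (hf : ∀ v, 0 ≤ f v) :
    ∫⁻ v, ENNReal.ofReal (f v) ∂(areaMeasure s K L) ≤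
      ENNReal.ofReal (s * ((n : ℝ) - s) / M) * ∫⁻ v, ENNReal.ofReal (f v) ∂μ := by
  have hn1 : (1 : ℝ) ≤ n := by exact_mod_cast Nat.one_le_iff_ne_zero.2 (NeZero.ne n)
  have hns : 0 < (n : ℝ) - s := by linarith
  have h1s : 0 < 1 - s := by linarith
  have hfi : Integrable f μ :=
    hfc.integrable_of_hasCompactSupport (HasCompactSupport.of_compactSpace _)
  obtain ⟨J, hJ, hlim⟩ := exists_chordEnergy_wulff_ge hs0 hs1 hK h0 hL hfc hf
  rw [← ofReal_integral_eq_lintegral_ofReal hfi (Eventually.of_forall hf),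
    ← ENNReal.ofReal_mul (by positivity)]
  set F := ∫ v, f v ∂μ with hF
  have hF0 : 0 ≤ F := integral_nonneg hf
  set t : ℕ → ℝ := fun k => 1 / ((k : ℝ) + 1) with ht
  have ht0 : ∀ k, 0 < t k := fun k => Nat.one_div_pos_of_nat
  have htlim : Tendsto t atTop (𝓝[>] 0) :=
    tendsto_nhdsWithin_iff.2 ⟨tendsto_one_div_add_atTop_nhds_zero_nat, Eventually.of_forall ht0⟩
  -- An upper bound for `s` times the perimeter of the Wulff shape, sharp at `0`. The lower bound `s
  -- + t J` for the same quantity makes `J` at most the slope of `g`, whose limit is `s (n-s) F /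
  -- M`.
  set g : ℝ → ℝ := fun τ => s * (1 + τ * (F / M)) ^ ((n : ℝ) - s) with hg
  have hbound : ∀ k, J k ≤ ENNReal.ofReal ((t k)⁻¹ • (g (0 + t k) - g 0)) := by
    intro k
    have hKt := isConvexBody_wulff hK h0 hfc hf (ht0 k).le
    have hper : 1 + ENNReal.ofReal (1 / s) * (ENNReal.ofReal (t k) * J k) ≤
        fracPerimeter s (wulff K f (t k)) L := by
      rw [← hP, fracPerimeter_eq hs0 hs1 hK hL, fracPerimeter_eq hs0 hs1 hKt hL]
      refine le_trans (le_of_eq ?_) (mul_le_mul_right (hJ k) _)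
      rw [mul_add, ← mul_assoc (ENNReal.ofReal (1 / (s * (1 - s)))) (ENNReal.ofReal (1 - s)),
        ← ENNReal.ofReal_mul (by positivity)]
      congr 3
      field_simp
    have hfin := fracPerimeter_ne_top hs0 hs1 hKt hL
    have hJfin : J k ≠ ⊤ := by
      intro h
      rw [h, ENNReal.mul_top (by simpa using ht0 k), ENNReal.mul_top (by simpa using hs0),
        add_top] at hper
      exact hfin (top_le_iff.1 hper)
    set p := (fracPerimeter s (wulff K f (t k)) L).toReal with hp
    have hPp : fracPerimeter s (wulff K f (t k)) L = ENNReal.ofReal p :=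
      (ENNReal.ofReal_toReal hfin).symm
    have hj0 : 0 ≤ (J k).toReal := ENNReal.toReal_nonneg
    have hjp : 1 + 1 / s * (t k * (J k).toReal) ≤ p := by
      have htk := ht0 k
      rw [hPp, ← ENNReal.ofReal_toReal hJfin, ← ENNReal.ofReal_mul htk.le,
        ← ENNReal.ofReal_mul (by positivity), ← ENNReal.ofReal_one,
        ← ENNReal.ofReal_add zero_le_one (by positivity)] at hper
      exact (ENNReal.ofReal_le_ofReal_iff ENNReal.toReal_nonneg).1 hper
    have hp1 : 1 ≤ p := le_trans (le_add_of_nonneg_right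
      (by have := ht0 k; positivity)) hjp
    have hp0 : 0 < p := one_pos.trans_le hp1
    have h1 := mul_rpow_le_integral_supp hs0 hs1 hL hmin hKt hp0 hPp
    have h2 : ∫ v, supp (wulff K f (t k)) v ∂μ ≤ M + t k * F := by
      rw [hM, hF, ← integral_const_mul, ← integral_add (integrable_supp hK μ) (hfi.const_mul _)]
      exact integral_mono (integrable_supp hKt μ) ((integrable_supp hK μ).add (hfi.const_mul _))
        fun v => supp_wulff_le hK h0 hfc hf (ht0 k).le v
    have h3 : p ^ (1 / ((n : ℝ) - s)) ≤ 1 + t k * (F / M) := by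
      rw [← mul_le_mul_iff_right₀ hM0]
      refine (h1.trans h2).trans (le_of_eq ?_)
      field_simp
    have h4 : p ≤ (1 + t k * (F / M)) ^ ((n : ℝ) - s) := by
      have := Real.rpow_le_rpow (Real.rpow_nonneg hp0.le _) h3 hns.le
      rwa [← Real.rpow_mul hp0.le, one_div, inv_mul_cancel₀ hns.ne', Real.rpow_one] at this
    rw [← ENNReal.ofReal_toReal hJfin]
    refine ENNReal.ofReal_le_ofReal ?_
    have htk := ht0 k
    simp only [hg, zero_add, zero_mul, add_zero, Real.one_rpow, mul_one, smul_eq_mul]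
    rw [le_inv_mul_iff₀ htk]
    have h5 := mul_le_mul_of_nonneg_left (hjp.trans h4) hs0.le
    have h6 : s * (1 + 1 / s * (t k * (J k).toReal)) = s + t k * (J k).toReal := by field_simp
    linarith
  have hder : HasDerivAt g (s * ((n : ℝ) - s) / M * F) 0 := by
    have e1 : HasDerivAt (fun τ : ℝ => 1 + τ * (F / M)) (F / M) 0 := by
      simpa using ((hasDerivAt_id (0 : ℝ)).mul_const (F / M)).const_add 1
    have e2 := (e1.rpow_const (p := (n : ℝ) - s) (Or.inl (by simp))).const_mul s
    refine e2.congr_deriv ?_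
    simp only [zero_mul, add_zero, Real.one_rpow]
    field_simp
  have hlimB := ENNReal.tendsto_ofReal ((hder.tendsto_slope_zero_right).comp htlim)
  refine hlim.trans ?_
  rw [← hlimB.liminf_eq]
  exact liminf_le_liminf (Eventually.of_forall hbound)

/-- The integral of the support function against the area measure. -/
lemma lintegral_supp_areaMeasure [NeZero n] {s : ℝ} (hK : IsConvexBody K) (h0 : K ∈ 𝓝 0)
    (hL : IsSymmConvexBody L) :
    ∫⁻ v, ENNReal.ofReal (supp K v) ∂(areaMeasure s K L) =
      ∫⁻ u : Sph n, ENNReal.ofReal (radial K 0 u ^ n) * dirEnergy s K L (radialProj K (u : Eucl n))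
        ∂((volume : Measure (Eucl n)).toSphere) := by
  rw [lintegral_areaMeasure hK h0 hL (continuous_supp hK).measurable.ennreal_ofReal]
  refine lintegral_congr_ae ?_
  filter_upwards [ae_sph_differentiableAt_gauge hK h0] with u hd
  have hs := (supp_unitNormal hK h0 hd).2
  have hgpos : 0 < ‖grad K (u : Eucl n)‖ := by
    have := supp_pos hK h0 (unitNormal K u)
    rw [hs] at this
    exact inv_pos.1 this
  have hρ := radial_nonneg hK (mem_of_mem_nhds h0) u
  rw [hs, areaDensity, mul_right_comm, ← ENNReal.ofReal_mul (by positivity),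
    mul_inv_cancel_right₀ hgpos.ne']

/-- A minimizer containing the origin in its interior has area measure proportional to `μ`. -/
theorem eq_smul_areaMeasure [NeZero n] {s : ℝ} (hs0 : 0 < s) (hs1 : s < 1)
    (hK : IsConvexBody K) (h0 : K ∈ 𝓝 0) (hL : IsSymmConvexBody L) {μ : Measure (Sph n)}
    [IsFiniteMeasure μ] (hμ : μ ≠ 0) (hP : fracPerimeter s K L = 1)
    (hmin : ∀ K' : Set (Eucl n), IsConvexBody K' → fracPerimeter s K' L = 1 →
      ∫ v, supp K v ∂μ ≤ ∫ v, supp K' v ∂μ) :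
    ∃ l : ℝ, 0 < l ∧ μ = ENNReal.ofReal l • areaMeasure s K L := by
  have hn1 : (1 : ℝ) ≤ n := by exact_mod_cast Nat.one_le_iff_ne_zero.2 (NeZero.ne n)
  have hns : 0 < (n : ℝ) - s := by linarith
  have h1s : 0 < 1 - s := by linarith
  have hM0 := integral_supp_pos hK h0 hμ
  set M := ∫ v, supp K v ∂μ with hM
  have hvar := fun f hfc hf =>
    lintegral_areaMeasure_le (f := f) hs0 hs1 hK h0 hL hM hM0 hP hmin hfc hf
  -- The reciprocal of the factor in the variation inequality, so that `l` times the area measure is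
  -- dominated by `μ`.
  set l := M / (s * ((n : ℝ) - s)) with hl
  have hl0 : 0 < l := by positivity
  have hinv : l * (s * ((n : ℝ) - s) / M) = 1 := by
    rw [hl]; field_simp
  have hvar' : ∀ f : Sph n → ℝ, Continuous f → (∀ v, 0 ≤ f v) →
      ∫⁻ v, ENNReal.ofReal (f v) ∂(ENNReal.ofReal l • areaMeasure s K L) ≤
        ∫⁻ v, ENNReal.ofReal (f v) ∂μ := by
    intro f hfc hf
    rw [lintegral_smul_measure, smul_eq_mul]
    refine (mul_le_mul_right (hvar f hfc hf) _).trans (le_of_eq ?_)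
    rw [← mul_assoc, ← ENNReal.ofReal_mul hl0.le, hinv, ENNReal.ofReal_one, one_mul]
  -- The energy at a boundary point may be infinite; that the area measure is finite follows only
  -- from the variation inequality with `f = 1`.
  have hfinite : IsFiniteMeasure (ENNReal.ofReal l • areaMeasure s K L) := by
    refine ⟨?_⟩
    have := hvar' (fun _ => 1) continuous_const fun _ => zero_le_one
    rw [ENNReal.ofReal_one, lintegral_one, lintegral_one] at this
    exact this.trans_lt (measure_lt_top μ _)
  have hle := measure_le_of_forall_lintegral_le hvar'
  refine ⟨l, hl0, eq_of_le_of_lintegral_le hle (f := fun v => ENNReal.ofReal (supp K v))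
    (continuous_supp hK).measurable.ennreal_ofReal
    (fun v => by simpa using supp_pos hK h0 v) ?_ ?_⟩
  · rw [← ofReal_integral_eq_lintegral_ofReal (integrable_supp hK μ)
      (Eventually.of_forall fun v => (supp_pos hK h0 v).le)]
    exact ENNReal.ofReal_ne_top
  · rw [← ofReal_integral_eq_lintegral_ofReal (integrable_supp hK μ)
      (Eventually.of_forall fun v => (supp_pos hK h0 v).le), ← hM, lintegral_smul_measure,
      smul_eq_mul, lintegral_supp_areaMeasure hK h0 hL]
    set I := ∫⁻ u : Sph n, ENNReal.ofReal (radial K 0 u ^ n) *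
      dirEnergy s K L (radialProj K (u : Eucl n)) ∂((volume : Measure (Eucl n)).toSphere) with hI
    have hb : ENNReal.ofReal ((n : ℝ) - s) * chordEnergy s K L ≤ ENNReal.ofReal (1 - s) * I :=
      chordEnergy_le_boundary hs0 hs1 hK h0 hL
    have hQ : chordEnergy s K L = ENNReal.ofReal (s * (1 - s)) := by
      rw [fracPerimeter_eq hs0 hs1 hK hL] at hP
      calc chordEnergy s K L = ENNReal.ofReal (s * (1 - s)) *
            (ENNReal.ofReal (1 / (s * (1 - s))) * chordEnergy s K L) := by
            rw [← mul_assoc, ← ENNReal.ofReal_mul (by positivity), mul_one_div_cancel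
              (by positivity), ENNReal.ofReal_one, one_mul]
        _ = _ := by rw [hP, mul_one]
    rw [hQ] at hb
    calc ENNReal.ofReal M = ENNReal.ofReal (l / (1 - s)) *
          (ENNReal.ofReal ((n : ℝ) - s) * ENNReal.ofReal (s * (1 - s))) := by
          rw [← ENNReal.ofReal_mul hns.le, ← ENNReal.ofReal_mul (by positivity), hl]
          congr 1
          field_simp
      _ ≤ ENNReal.ofReal (l / (1 - s)) * (ENNReal.ofReal (1 - s) * I) := by gcongr
      _ = ENNReal.ofReal l * I := by
          rw [← mul_assoc, ← ENNReal.ofReal_mul (by positivity), div_mul_cancel₀ _ h1s.ne']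

/-- Since the problem is translation invariant, `μ` is centred. -/
lemma integral_inner_eq_zero [NeZero n] {s : ℝ} (hs0 : 0 < s) (hs1 : s < 1)
    (hK : IsConvexBody K) (hL : IsSymmConvexBody L) {μ : Measure (Sph n)} [IsFiniteMeasure μ]
    (hP : fracPerimeter s K L = 1)
    (hmin : ∀ K' : Set (Eucl n), IsConvexBody K' → fracPerimeter s K' L = 1 →
      ∫ v, supp K v ∂μ ≤ ∫ v, supp K' v ∂μ) (a : Eucl n) :
    ∫ v : Sph n, inner ℝ (v : Eucl n) a ∂μ = 0 := by
  have hi : ∀ a : Eucl n, Integrable (fun v : Sph n => inner ℝ (v : Eucl n) a) μ := fun a =>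
    (continuous_subtype_val.inner continuous_const).integrable_of_hasCompactSupport
      (HasCompactSupport.of_compactSpace _)
  have hnn : ∀ a : Eucl n, 0 ≤ ∫ v : Sph n, inner ℝ (v : Eucl n) a ∂μ := by
    intro a
    have h := hmin (a +ᵥ K) (isConvexBody_translate hK a)
      ((fracPerimeter_translate hs0 hs1 hK hL a).trans hP)
    simp only [supp_translate hK] at h
    rw [integral_add (hi a) (integrable_supp hK μ)] at h
    linarith
  -- Translating by `a` and by `-a` gives both signs.
  have h2 := hnn (-a)
  simp only [inner_neg_right, integral_neg] at h2
  linarith [hnn a]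

end Minimizer

end FractionalArea

end

theorem theorem5p1 (n : ℕ)
    (μ : Measure (FractionalArea.Sph n)) [IsFiniteMeasure μ] (hμ : μ ≠ 0)
    (s : ℝ) (hs0 : 0 < s) (hs1 : s < 1)
    (L : Set (FractionalArea.Eucl n)) (hL : FractionalArea.IsSymmConvexBody L)
    (K₀ : Set (FractionalArea.Eucl n)) (hK₀ : FractionalArea.IsConvexBody K₀)
    (hP : FractionalArea.fracPerimeter s K₀ L = 1)
    (hmin : IsGLB
      {r : ℝ | ∃ K : Set (FractionalArea.Eucl n), FractionalArea.IsConvexBody K ∧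
        FractionalArea.fracPerimeter s K L = 1 ∧ r = ∫ v, FractionalArea.supp K v ∂μ}
      (∫ v, FractionalArea.supp K₀ v ∂μ)) :
    ∃ c : ℝ, 0 < c ∧ ∀ η : Set (FractionalArea.Sph n), MeasurableSet η →
      μ η = FractionalArea.fracArea s (c • K₀) L η := by
  -- In dimension zero the sphere is empty and carries no nonzero measure.
  have hn : n ≠ 0 := by
    rintro rfl
    have : IsEmpty (FractionalArea.Sph 0) :=
      ⟨fun v => FractionalArea.sph_ne_zero v (Subsingleton.elim _ _)⟩
    exact hμ (Measure.eq_zero_of_isEmpty μ)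
  have : NeZero n := ⟨hn⟩
  have hmin' : ∀ K' : Set (FractionalArea.Eucl n), FractionalArea.IsConvexBody K' →
      FractionalArea.fracPerimeter s K' L = 1 →
        ∫ v, FractionalArea.supp K₀ v ∂μ ≤ ∫ v, FractionalArea.supp K' v ∂μ :=
    fun K' hK' hP' => hmin.1 ⟨K', hK', hP', rfl⟩
  obtain ⟨a, ha⟩ := hK₀.2.2
  set K := -a +ᵥ K₀ with hKdef
  have hK : FractionalArea.IsConvexBody K := FractionalArea.isConvexBody_translate hK₀ (-a)
  have h0 : K ∈ nhds 0 := by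
    have h := (vadd_mem_nhds_vadd_iff (-a)).2 (mem_interior_iff_mem_nhds.1 ha)
    rwa [vadd_eq_add, neg_add_cancel] at h
  have hK₀K : K₀ = a +ᵥ K := by rw [hKdef, vadd_vadd, add_neg_cancel, zero_vadd]
  have hPK : FractionalArea.fracPerimeter s K L = 1 :=
    (FractionalArea.fracPerimeter_translate hs0 hs1 hK₀ hL (-a)).trans hP
  have hint : ∫ v, FractionalArea.supp K v ∂μ = ∫ v, FractionalArea.supp K₀ v ∂μ := by
    simp only [hKdef, FractionalArea.supp_translate hK₀]
    rw [integral_add _ (FractionalArea.integrable_supp hK₀ μ),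
      FractionalArea.integral_inner_eq_zero hs0 hs1 hK₀ hL hP hmin', zero_add]
    exact (continuous_subtype_val.inner continuous_const).integrable_of_hasCompactSupport
      (HasCompactSupport.of_compactSpace _)
  obtain ⟨l, hl, hμl⟩ := FractionalArea.eq_smul_areaMeasure hs0 hs1 hK h0 hL hμ hPK
    fun K' hK' hP' => hint ▸ hmin' K' hK' hP'
  -- The exponent is negative for `n ≤ 1` and positive for `n ≥ 2`, as `0 < s < 1`.
  have hexp : (n : ℝ) - 1 - s ≠ 0 := by
    rcases Nat.lt_or_ge n 2 with h | h
    · have h1 : (n : ℝ) ≤ 1 := by exact_mod_cast Nat.lt_succ_iff.1 h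
      linarith
    · have h2 : (2 : ℝ) ≤ n := by exact_mod_cast h
      linarith
  have hb : 0 < 2 * s * l := by positivity
  -- Since `μ` is `l` times the area measure and the fractional area measure of `c K` is `c^(n-1-s)
  -- / (2s)` times it, `c` must satisfy `c^(n-1-s) = 2 s l`.
  refine ⟨(2 * s * l) ^ (1 / ((n : ℝ) - 1 - s)), Real.rpow_pos_of_pos hb _, fun η hη => ?_⟩
  set c := (2 * s * l) ^ (1 / ((n : ℝ) - 1 - s)) with hc
  have hc0 : 0 < c := Real.rpow_pos_of_pos hb _
  have hcpow : c ^ ((n : ℝ) - 1 - s) = 2 * s * l := by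
    rw [hc, ← Real.rpow_mul hb.le, one_div, inv_mul_cancel₀ hexp, Real.rpow_one]
  have hsmul : c • K₀ = c • a +ᵥ c • K := by
    rw [hK₀K]
    simp only [← image_smul, ← image_vadd, image_image, vadd_eq_add, smul_add]
  rw [hsmul, FractionalArea.fracArea_translate (FractionalArea.isConvexBody_smul hK hc0.ne'),
    FractionalArea.fracArea_smul_body hs0 hc0 hK h0 hL hη, hcpow, hμl, Measure.smul_apply,
    smul_eq_mul, ← mul_assoc, ← ENNReal.ofReal_mul hb.le]
  congr 2
  field_simp
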